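/- Let $\delta>0$ and let $\rho:(0,\delta)\to[0,\infty)$ be integrable with $\int_0^\delta\rho(s)\,ds=1$. Put $$\mathcal G_\delta v(t)=\int_0^\delta\frac{v(t)-v(t-s)}{s}\,\rho(s)\,ds:=\lim_{\varepsilon\downarrow0}\int_\varepsilon^\delta\frac{v(t)-v(t-s)}{s}\,\rho(s)\,ds .$$ A fundamental solution of the nonlocal-in-time diffusion equation $$\mathcal G_\delta u-\partial_x^2u=0\quad(x\in\mathbb R,\ t>0),\qquad u(\cdot,t)=\delta_0\ \text{(the Dirac mass at the origin)}\quad(-\delta<t<0)$$ is a function $u$, continuous on $\mathbb R\times(0,\infty)$, with $u(\cdot,t)\in L^1(\mathbb R)$ for every $t>0$ and $\sup_{0<t\le T}\|u(\cdot,t)\|_{L^1(\mathbb R)}<\infty$ for every $T>0$, which satisfies the equation in the sense of distributions, that is, with $\mathcal G_\delta^*\varphi(x,t)=\int_0^\delta\frac{\varphi(x,t)-\varphi(x,t+s)}{s}\rho(s)\,ds$, $$\int_{-\delta}^{0}\mathcal G_\delta^*\varphi(0,t)\,dt+\int_0^\infty\!\int_{\mathbb R}u\,\bigl(\mathcal G_\delta^*\varphi-\partial_x^2\varphi\bigr)\,dx\,dt=0\qquad\text{for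 all }\varphi\in C_c^\infty(\mathbb R\times(0,\infty)).$$ Its mean square displacement is $m(t)=\int_{\mathbb R}x^2u(x,t)\,dx$ for $t>0$, and $m(t)=\int_{\mathbb R} x^2\,d\delta_0(x)$ for $-\delta<t<0$. A fundamental solution exists, and for every fundamental solution $u$ the function $x\mapsto x^2u(x,t)$ is integrable for every $t>0$, and the mean square displacement solves the nonlocal initial value problem $$\mathcal G_\delta m(t)=2\quad\text{for every }t>0,\qquad m(t)=0\quad\text{for }t\in(-\delta,0),$$ and satisfies $m(t)\sim 2t$ as $t\to\infty$ (here $f\sim g$ means that $f/g\to1$). Moreover, for every $\alpha\in(0,1)$ the truncated fractional kernel $\rho(s)=(1-\alpha)\delta^{\alpha-1}s^{-\alpha}$, $0<s<\delta$, is a normalized density, and for this kernel $$m(t)\sim\frac{2\sin(\alpha\pi)\,\delta^{1-\alpha}}{(1-\alpha)\pi}\,t^{\alpha}\qquad\text{as }t\downarrow0,$$ so that the mean square displacement crosses over from sub-diffusion to normal diffusion. -/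

import Mathlib

open scoped Topology ContDiff

namespace NonlocalDiffusion

noncomputable section

/-- `ρ` is an admissible memory kernel on the window `(0, δ)` which is a normalized density:
nonnegative, integrable and of integral one.  Only the values of `ρ` on `(0, δ)` are ever used. -/
structure IsDensityKernel (δ : ℝ) (ρ : ℝ → ℝ) : Prop where
  nonneg : ∀ s ∈ Set.Ioo 0 δ, 0 ≤ ρ s
  integrableOn : MeasureTheory.IntegrableOn ρ (Set.Ioo 0 δ)
  integral_eq_one : ∫ s in Set.Ioo 0 δ, ρ s = 1

/-- The truncated fractional kernel `(1 - α) δ ^ (α - 1) s ^ (-α)` on `(0, δ)`. -/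
def fractionalKernel (α δ : ℝ) : ℝ → ℝ :=
  (Set.Ioo 0 δ).indicator fun s => (1 - α) * δ ^ (α - 1) * s ^ (-α)

/-- `HasNonlocalDeriv δ ρ v t L` says that `(𝒢_δ v)(t)` exists and equals `L`, where
`(𝒢_δ v)(t) = ∫₀^δ (v(t) - v(t - s)) / s * ρ(s) ds`
is the limit of the (absolutely convergent) integrals over `(ε, δ)` as `ε` decreases to `0`. -/
def HasNonlocalDeriv (δ : ℝ) (ρ v : ℝ → ℝ) (t L : ℝ) : Prop :=
  (∀ ε ∈ Set.Ioo 0 δ,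
    MeasureTheory.IntegrableOn (fun s => (v t - v (t - s)) / s * ρ s) (Set.Ioo ε δ)) ∧
  Filter.Tendsto (fun ε => ∫ s in Set.Ioo ε δ, (v t - v (t - s)) / s * ρ s)
    (𝓝[>] 0) (𝓝 L)

/-- The formal adjoint of `𝒢_δ`, acting on smooth compactly supported functions of time:
`∫₀^δ (ψ(t) - ψ(t + s)) / s * ρ(s) ds`. -/
def adjointNonlocal (δ : ℝ) (ρ ψ : ℝ → ℝ) (t : ℝ) : ℝ :=
  ∫ s in Set.Ioo 0 δ, (ψ t - ψ (t + s)) / s * ρ s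

/-- The integral of `ψ` against the spatial distribution at time `t`: this distribution is
`u(x, t) dx` for `t > 0`, and the Dirac mass at the origin at the earlier times. -/
def spatialIntegral (u : ℝ → ℝ → ℝ) (ψ : ℝ → ℝ) (t : ℝ) : ℝ :=
  if 0 < t then ∫ x, ψ x * u x t else ∫ x, ψ x ∂(MeasureTheory.Measure.dirac (0 : ℝ))

/-- `u = u(x, t)` is a fundamental solution of the nonlocal-in-time diffusion equation on the
real line: `𝒢_δ u - ∂ₓₓ u = 0` for `t > 0`, with `u(·, t)` the Dirac mass at `0` for
`t ∈ (-δ, 0)`.  It is continuous on `ℝ × (0, ∞)`, its spatial `L¹` norms are locally bounded in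
time, and the equation holds in the sense of distributions on `ℝ × (0, ∞)`. -/
structure IsFundamentalSolution (δ : ℝ) (ρ : ℝ → ℝ) (u : ℝ → ℝ → ℝ) : Prop where
  continuousOn : ContinuousOn (fun p : ℝ × ℝ => u p.1 p.2) {p | 0 < p.2}
  integrable : ∀ t, 0 < t → MeasureTheory.Integrable (fun x => u x t)
  locally_bounded : ∀ T, 0 < T → ∃ C : ℝ, ∀ t ∈ Set.Ioc 0 T, ∫ x, |u x t| ≤ C
  weak_equation : ∀ φ : ℝ × ℝ → ℝ, ContDiff ℝ ∞ φ → HasCompactSupport φ →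
    tsupport φ ⊆ {p | 0 < p.2} →
    ∫ t in Set.Ioi (-δ),
      spatialIntegral u
        (fun x => adjointNonlocal δ ρ (fun r => φ (x, r)) t
          - iteratedDeriv 2 (fun y => φ (y, t)) x) t = 0

/-- The mean square displacement `m(t) = ∫ x² u(x, t) dx`. -/
def meanSquareDisplacement (u : ℝ → ℝ → ℝ) (t : ℝ) : ℝ :=
  spatialIntegral u (fun x => x ^ 2) t

end

end NonlocalDiffusion

open scoped Topology ContDiff ENNReal FourierTransform
open MeasureTheory Set Filter

/-! ### Convolution algebra for `[0, ∞]`-valued functions and measures -/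

namespace NonlocalDiffusion

noncomputable section

/-! A Fourier transform in space, with `λ = (2πξ)²`, reduces the equation to the scalar problem `𝒢W
+ λW = 0` for `t > 0` with past `W = 1`. Let `T(r) = ∫_r^δ ρ(s)/s ds`. By Tonelli, `T` is a
probability density on `(0, δ)` even when `ρ(s)/s` is not integrable, and formally `𝒢v = (T * v)'`.
With convolutions over positive times, the scalar problem becomes `T * (1 - W) = λ (1 * W)`
(`relaxation_compl_convolution`). Its solution `W_λ` (`relaxation`) is an increasing limit over
integrable approximations of the jump kernel `ρ(s)/s`; for each of them the solution is the maximal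
one, a decreasing limit of Picard iterates. The comparison principle `le_relax` gives monotonicity
in the kernel and in `λ`, and, with a linear barrier, Lipschitz dependence on `λ`.

Existence. Unrolled, a Picard iterate is a positive superposition of powers of the resolvent `(a +
λ)⁻¹`, and these are mixtures of Gaussians. Hence the inverse transform `kern` of `W_λ` is
nonnegative, and it has mass `W_0 = 1`. The bound `λ t W_λ(t) ≤ 1` gives integrability in `ξ`. The
weak equation follows from the scalar one by Fourier inversion at the origin (`kern_weak_equation`).

Uniqueness. Testing any fundamental solution against plane waves gives the scalar equation in the
sense of distributions. Its integrated form is a Volterra equation with kernel `T + λ·1`, whose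
resolvent is explicitly `(1 - W_λ)/λ` (or `V` below when `λ = 0`); so every spatial transform is
`W_λ`, and the solution is `kern` (`IsFundamentalSolution.eq_kern`).

Moments. The mean square displacement is `2V` with `V = lim (1 - W_λ)/λ` as `λ → 0`, so dividing the
convolution identity by `λ` gives `T * V = t` (`halfMoment_convolution`). As `T` is a probability
density on `(0, δ)` and `V` increases, `t ≤ V(t) ≤ t + δ`, whence `m ~ 2t`. For `𝒢V = 1` at every `t
> 0` there are two cases. If `∫ ρ(s)/s` is finite, the scalar equation holds pointwise and `λ → 0`
in it. Otherwise `V` is continuous, the measure `U = dV` has no atoms, and `T * U = 1` is known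
almost everywhere; restarting the renewal measure at a good level upgrades this to every `t`
(`cv_tail_eq_one`), and Tonelli turns it into `𝒢V = 1`.

Fractional kernel. Here `T(r)` is comparable to a multiple of `r^(-α)` near zero. Convolving `T * U
= 1` with `r^(α-1)` and using the Beta integral `r^(-α) * r^(α-1) = π / sin(πα)` bounds `V(t)` on
both sides by multiples of `t^α` whose ratio tends to one (`fractional_bounds`). -/

/-- Convolution of a nonnegative function with a measure on the line. -/
def cv (g : ℝ → ℝ≥0∞) (ν : Measure ℝ) (t : ℝ) : ℝ≥0∞ := ∫⁻ r, g (t - r) ∂ν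

/-- The measure with density `h` with respect to Lebesgue measure. -/
abbrev wd (h : ℝ → ℝ≥0∞) : Measure ℝ := volume.withDensity h

/-- The indicator function of the positive half-line. -/
def unitStep : ℝ → ℝ≥0∞ := (Ioi (0 : ℝ)).indicator fun _ => 1

lemma measurable_unitStep : Measurable unitStep :=
  measurable_const.indicator measurableSet_Ioi

lemma unitStep_of_pos {t : ℝ} (h : 0 < t) : unitStep t = 1 := by simp [unitStep, h]

lemma unitStep_of_nonpos {t : ℝ} (h : t ≤ 0) : unitStep t = 0 := by simp [unitStep, h]

lemma measurable_cv {g : ℝ → ℝ≥0∞} (hg : Measurable g) (ν : Measure ℝ) [SFinite ν] :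
    Measurable (cv g ν) :=
  Measurable.lintegral_prod_right' (f := fun p : ℝ × ℝ => g (p.1 - p.2))
    (hg.comp (measurable_fst.sub measurable_snd))

/-- Tonelli. With `cv_swap` this supplies commutativity and associativity of convolution for
functions and s-finite measures alike, with no integrability to check because values lie in `[0,
∞]`. -/
lemma cv_comm {g : ℝ → ℝ≥0∞} (hg : Measurable g) (ν μ : Measure ℝ) [SFinite ν] [SFinite μ] :
    cv (cv g ν) μ = cv (cv g μ) ν := by
  funext t
  unfold cv
  rw [lintegral_lintegral_swap]
  · refine lintegral_congr fun r => lintegral_congr fun r' => ?_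
    rw [sub_right_comm]
  · exact (hg.comp (by fun_prop : Measurable fun p : ℝ × ℝ => t - p.1 - p.2)).aemeasurable

lemma cv_wd {g h : ℝ → ℝ≥0∞} (hg : Measurable g) (hh : Measurable h) (t : ℝ) :
    cv g (wd h) t = ∫⁻ r, h r * g (t - r) := by
  unfold cv wd
  have : Measurable fun r => g (t - r) := hg.comp (by fun_prop)
  rw [lintegral_withDensity_eq_lintegral_mul _ hh this]
  rfl

lemma cv_swap {g h : ℝ → ℝ≥0∞} (hg : Measurable g) (hh : Measurable h) :
    cv g (wd h) = cv h (wd g) := by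
  funext t
  rw [cv_wd hg hh, cv_wd hh hg]
  rw [← lintegral_sub_left_eq_self (fun r => h r * g (t - r)) t]
  refine lintegral_congr fun r => ?_
  rw [sub_sub_cancel, mul_comm]

lemma cv_add {g h : ℝ → ℝ≥0∞} (hg : Measurable g) (ν : Measure ℝ) (t : ℝ) :
    cv (fun r => g r + h r) ν t = cv g ν t + cv h ν t :=
  lintegral_add_left (hg.comp (measurable_const.sub measurable_id)) _

lemma cv_const_mul {g : ℝ → ℝ≥0∞} (hg : Measurable g) (c : ℝ≥0∞) (ν : Measure ℝ) (t : ℝ) :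
    cv (fun r => c * g r) ν t = c * cv g ν t :=
  lintegral_const_mul _ (hg.comp (measurable_const.sub measurable_id))

lemma cv_mono {g h : ℝ → ℝ≥0∞} (hgh : ∀ r, g r ≤ h r) (ν : Measure ℝ) (t : ℝ) :
    cv g ν t ≤ cv h ν t := lintegral_mono fun _ => hgh _

/-- Almost everywhere identities may be convolved only with absolutely continuous measures. For the
renewal measure this is unavailable, which is why `cv_tail_eq_one` needs a separate argument. -/
lemma cv_congr_ae {g h : ℝ → ℝ≥0∞} (hgh : g =ᵐ[volume] h) (f : ℝ → ℝ≥0∞) :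
    cv g (wd f) = cv h (wd f) := by
  funext t
  refine lintegral_congr_ae ((withDensity_absolutelyContinuous volume f).ae_le ?_)
  have : Measure.QuasiMeasurePreserving (fun r : ℝ => t - r) volume volume :=
    (Measure.measurePreserving_sub_left volume t).quasiMeasurePreserving
  exact this.ae_eq_comp hgh

lemma cv_unitStep (μ : Measure ℝ) (t : ℝ) : cv unitStep μ t = μ (Iio t) := by
  unfold cv
  rw [← lintegral_indicator_one measurableSet_Iio]
  refine lintegral_congr fun r => ?_
  by_cases h : r < t
  · rw [unitStep_of_pos (by linarith), Set.indicator_of_mem (mem_Iio.2 h), Pi.one_apply]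
  · rw [unitStep_of_nonpos (by linarith), Set.indicator_of_notMem (by simpa using h)]

lemma cv_unitStep_wd (h : ℝ → ℝ≥0∞) (t : ℝ) :
    cv unitStep (wd h) t = ∫⁻ r in Iio t, h r := by
  rw [cv_unitStep, withDensity_apply _ measurableSet_Iio]

lemma cv_unitStep_unitStep (t : ℝ) : cv unitStep (wd unitStep) t = ENNReal.ofReal t := by
  rw [cv_unitStep_wd, unitStep, setLIntegral_indicator measurableSet_Ioi]
  simp [Ioi_inter_Iio]

/-- The function `t ↦ μ (Iio t)` is left-continuous, so agreement on a dense set is agreement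
everywhere, and finite values on half-lines determine the measure of every half-open interval by
subtraction. -/
lemma measure_eq_of_cv_unitStep_ae {μ ν : Measure ℝ}
    (h : ∀ᵐ t, cv unitStep μ t = cv unitStep ν t) (hf : ∀ t, cv unitStep μ t < ⊤) : μ = ν := by
  simp only [cv_unitStep] at h hf
  have hd : Dense {t | μ (Iio t) = ν (Iio t)} := Measure.dense_of_ae h
  have key : ∀ t, μ (Iio t) = ν (Iio t) := by
    intro t
    obtain ⟨u, hu, hut, hlim⟩ := hd.exists_seq_strictMono_tendsto t
    have hU : Iio t = ⋃ n, Iio (u n) := by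
      ext x
      simp only [mem_Iio, mem_iUnion]
      constructor
      · intro hx
        exact ((hlim.eventually (lt_mem_nhds hx)).exists)
      · rintro ⟨n, hn⟩
        exact hn.trans (hut n).1
    have hm : Monotone fun n => Iio (u n) := fun i j hij => Iio_subset_Iio (hu.monotone hij)
    rw [hU, hm.measure_iUnion, hm.measure_iUnion]
    exact iSup_congr fun n => (hut n).2
  have hfin : ∀ t, μ (Iio t) ≠ ⊤ := fun t => (hf t).ne
  have : IsLocallyFiniteMeasure μ := ⟨fun x => ⟨Iio (x + 1), Iio_mem_nhds (by linarith), hf _⟩⟩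
  refine Measure.ext_of_Ico μ ν fun a b hab => ?_
  have hI : Ico a b = Iio b \ Iio a := by
    ext x
    simp
  rw [hI, measure_sdiff (Iio_subset_Iio hab.le) measurableSet_Iio.nullMeasurableSet
    (hfin a), measure_sdiff (Iio_subset_Iio hab.le) measurableSet_Iio.nullMeasurableSet
    (key a ▸ hfin a), key, key]

lemma ae_eq_of_cv_unitStep_ae {g h : ℝ → ℝ≥0∞} (hg : Measurable g) (hh : Measurable h)
    (hgh : ∀ᵐ t, cv unitStep (wd g) t = cv unitStep (wd h) t)
    (hf : ∀ t, cv unitStep (wd g) t < ⊤) : g =ᵐ[volume] h := by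
  have he := measure_eq_of_cv_unitStep_ae hgh hf
  have : IsLocallyFiniteMeasure (wd g) := ⟨fun x =>
    ⟨Iio (x + 1), Iio_mem_nhds (by linarith), by rw [← cv_unitStep]; exact hf _⟩⟩
  exact (withDensity_eq_iff_of_sigmaFinite hg.aemeasurable hh.aemeasurable).1 he

lemma cv_unitStep_unitStep_lt_top {e : ℝ → ℝ≥0∞} (h0 : ∀ r ≤ 0, e r = 0)
    (hf : ∀ t, cv unitStep (wd e) t < ⊤) (t : ℝ) :
    cv unitStep (wd (cv unitStep (wd e))) t < ⊤ := by
  rw [cv_unitStep_wd]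
  calc ∫⁻ r in Iio t, cv unitStep (wd e) r
      ≤ ∫⁻ r in Iio t, (Ioi (0 : ℝ)).indicator (fun _ => cv unitStep (wd e) t) r := by
        refine setLIntegral_mono' measurableSet_Iio fun r hr => ?_
        by_cases h : 0 < r
        · rw [Set.indicator_of_mem (mem_Ioi.2 h), cv_unitStep, cv_unitStep]
          exact measure_mono (Iio_subset_Iio (le_of_lt hr))
        · rw [cv_unitStep_wd, setLIntegral_congr_fun (g := fun _ => 0) measurableSet_Iio]
          · simp
          · intro x hx
            exact h0 x (by simp only [mem_Iio] at hx; linarith)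
    _ < ⊤ := by
        rw [setLIntegral_indicator measurableSet_Ioi, setLIntegral_const]
        refine ENNReal.mul_lt_top (hf t) ?_
        rw [Ioi_inter_Iio]
        simp

/-- Uniqueness for Volterra equations of the first kind whose kernel `M` has a resolvent `V`. -/
lemma volterra_unique {M V e₁ e₂ : ℝ → ℝ≥0∞} (hM : Measurable M)
    (h₁ : Measurable e₁) (h₂ : Measurable e₂)
    (hMV : cv M (wd V) = cv unitStep (wd unitStep))
    (h₁0 : ∀ r ≤ 0, e₁ r = 0) (h₁f : ∀ t, cv unitStep (wd e₁) t < ⊤)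
    (he : cv M (wd e₁) =ᵐ[volume] cv M (wd e₂)) : e₁ =ᵐ[volume] e₂ := by
  have key : ∀ e : ℝ → ℝ≥0∞, Measurable e →
      cv (cv M (wd e)) (wd V) = cv unitStep (wd (cv unitStep (wd e))) := by
    intro e hme
    rw [cv_comm hM, hMV, cv_comm measurable_unitStep,
      cv_swap (measurable_cv measurable_unitStep _) measurable_unitStep]
  -- Convolving with the resolvent turns the two sides into double primitives of `e₁` and `e₂`; the
  -- primitive is then inverted twice.
  have h := cv_congr_ae he V
  rw [key _ h₁, key _ h₂] at h
  have h' := ae_eq_of_cv_unitStep_ae (measurable_cv measurable_unitStep _)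
    (measurable_cv measurable_unitStep _) (ae_of_all _ (congrFun h))
    (cv_unitStep_unitStep_lt_top h₁0 h₁f)
  exact ae_eq_of_cv_unitStep_ae h₁ h₂ h' h₁f

end

end NonlocalDiffusion

/-! ### The relaxation equation for an integrable jump kernel -/

namespace NonlocalDiffusion

noncomputable section

/-- A nonzero integrable jump kernel. -/
structure IsJumpKernel (κ : ℝ → ℝ) : Prop where
  measurable : Measurable κ
  nonneg : ∀ s, 0 ≤ κ s
  integrable : Integrable κ
  mass_pos : 0 < ∫ s, κ s

/-- Picard iterates, from above, of the relaxation equation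
`(a + l) W(t) = ∫ κ(s) W(t - s) ds` for `t > 0` with past `W = 1`, where `a = ∫ κ`. -/
def iter (κ : ℝ → ℝ) (l : ℝ) : ℕ → ℝ → ℝ
  | 0 => fun _ => 1
  | J + 1 => fun t => if t ≤ 0 then 1 else (∫ s, κ s * iter κ l J (t - s)) / ((∫ s, κ s) + l)

/-- The relaxation function of an integrable kernel. -/
def relax (κ : ℝ → ℝ) (l t : ℝ) : ℝ := ⨅ J, iter κ l J t

lemma iter_of_nonpos (κ : ℝ → ℝ) (l : ℝ) (J : ℕ) {t : ℝ} (ht : t ≤ 0) : iter κ l J t = 1 := by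
  cases J <;> simp [iter, ht]

lemma iter_succ_of_pos (κ : ℝ → ℝ) (l : ℝ) (J : ℕ) {t : ℝ} (ht : 0 < t) :
    iter κ l (J + 1) t = (∫ s, κ s * iter κ l J (t - s)) / ((∫ s, κ s) + l) := by
  simp [iter, ht]

lemma measurable_iter_uncurry {κ : ℝ → ℝ} (hκ : Measurable κ) (J : ℕ) :
    Measurable fun p : ℝ × ℝ => iter κ p.1 J p.2 := by
  induction J with
  | zero => exact measurable_const
  | succ J ih =>
    refine Measurable.ite (measurableSet_le measurable_snd measurable_const) measurable_const ?_
    refine Measurable.div ?_ (by fun_prop)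
    have h : StronglyMeasurable fun q : (ℝ × ℝ) × ℝ => κ q.2 * iter κ q.1.1 J (q.1.2 - q.2) :=
      ((hκ.comp measurable_snd).mul (ih.comp
        (by fun_prop : Measurable fun q : (ℝ × ℝ) × ℝ => (q.1.1, q.1.2 - q.2)))).stronglyMeasurable
    exact h.integral_prod_right'.measurable

lemma measurable_iter {κ : ℝ → ℝ} (hκ : Measurable κ) (l : ℝ) (J : ℕ) :
    Measurable (iter κ l J) :=
  (measurable_iter_uncurry hκ J).comp (measurable_const.prodMk measurable_id)

lemma measurable_relax_uncurry {κ : ℝ → ℝ} (hκ : Measurable κ) :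
    Measurable fun p : ℝ × ℝ => relax κ p.1 p.2 :=
  Measurable.iInf fun J => measurable_iter_uncurry hκ J

lemma measurable_relax {κ : ℝ → ℝ} (hκ : Measurable κ) (l : ℝ) : Measurable (relax κ l) :=
  (measurable_relax_uncurry hκ).comp (measurable_const.prodMk measurable_id)

section

variable {κ : ℝ → ℝ} (hκ : IsJumpKernel κ)

include hκ

lemma IsJumpKernel.integrable_mul_shift {f : ℝ → ℝ} (hf : Measurable f) {C : ℝ}
    (hC : ∀ r, |f r| ≤ C) (t : ℝ) : Integrable fun s => κ s * f (t - s) :=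
  hκ.integrable.mul_bdd (hf.comp (by fun_prop)).aestronglyMeasurable (ae_of_all _ fun s => hC _)

lemma IsJumpKernel.integral_mono_shift {f g : ℝ → ℝ} (hf : Measurable f) (hg : Measurable g)
    {C D : ℝ} (hC : ∀ r, |f r| ≤ C) (hD : ∀ r, |g r| ≤ D) {t u : ℝ}
    (h : ∀ s, f (t - s) ≤ g (u - s)) :
    ∫ s, κ s * f (t - s) ≤ ∫ s, κ s * g (u - s) :=
  integral_mono (hκ.integrable_mul_shift hf hC t) (hκ.integrable_mul_shift hg hD u)
    fun s => mul_le_mul_of_nonneg_left (h s) (hκ.nonneg s)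

end

section

variable {κ : ℝ → ℝ} (hκ : IsJumpKernel κ) {l : ℝ} (hl : 0 ≤ l)

include hκ hl

lemma mass_add_pos : 0 < (∫ s, κ s) + l := add_pos_of_pos_of_nonneg hκ.mass_pos hl

lemma iter_mem_Icc (J : ℕ) (t : ℝ) : iter κ l J t ∈ Icc (0 : ℝ) 1 := by
  induction J generalizing t with
  | zero => simp [iter]
  | succ J ih =>
    rcases le_or_gt t 0 with ht | ht
    · simp [iter_of_nonpos _ _ _ ht]
    · rw [iter_succ_of_pos _ _ _ ht]
      have hp := mass_add_pos hκ hl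
      constructor
      · exact div_nonneg (integral_nonneg fun s => mul_nonneg (hκ.nonneg s) (ih _).1) hp.le
      · rw [div_le_one hp]
        have h := hκ.integral_mono_shift (measurable_iter hκ.measurable l J)
          (measurable_const (a := (1 : ℝ))) (C := 1) (D := 1)
          (fun r => abs_le.2 ⟨by linarith [(ih r).1], (ih r).2⟩) (by simp) (t := t) (u := t)
          (fun s => (ih _).2)
        simp only [mul_one] at h
        linarith

lemma abs_iter_le (J : ℕ) (t : ℝ) : |iter κ l J t| ≤ 1 :=
  abs_le.2 ⟨by linarith [(iter_mem_Icc hκ hl J t).1], (iter_mem_Icc hκ hl J t).2⟩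

lemma antitone_iter (J : ℕ) : Antitone (iter κ l J) := by
  induction J with
  | zero => exact antitone_const
  | succ J ih =>
    intro t u htu
    rcases le_or_gt t 0 with ht | ht
    · rw [iter_of_nonpos _ _ _ ht]
      exact (iter_mem_Icc hκ hl _ _).2
    · rw [iter_succ_of_pos _ _ _ ht, iter_succ_of_pos _ _ _ (ht.trans_le htu)]
      refine div_le_div_of_nonneg_right ?_ (mass_add_pos hκ hl).le
      exact hκ.integral_mono_shift (measurable_iter hκ.measurable l J)
        (measurable_iter hκ.measurable l J) (abs_iter_le hκ hl J) (abs_iter_le hκ hl J)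
        fun s => ih (by linarith)

lemma iter_succ_le (J : ℕ) (t : ℝ) : iter κ l (J + 1) t ≤ iter κ l J t := by
  induction J generalizing t with
  | zero => exact (iter_mem_Icc hκ hl _ _).2
  | succ J ih =>
    rcases le_or_gt t 0 with ht | ht
    · simp [iter_of_nonpos _ _ _ ht]
    · rw [iter_succ_of_pos _ _ _ ht, iter_succ_of_pos _ _ _ ht]
      refine div_le_div_of_nonneg_right ?_ (mass_add_pos hκ hl).le
      exact hκ.integral_mono_shift (measurable_iter hκ.measurable l _)
        (measurable_iter hκ.measurable l J) (abs_iter_le hκ hl _) (abs_iter_le hκ hl J)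
        fun s => ih _

lemma tendsto_iter (t : ℝ) : Tendsto (fun J => iter κ l J t) atTop (𝓝 (relax κ l t)) :=
  tendsto_atTop_ciInf (antitone_nat_of_succ_le fun J => iter_succ_le hκ hl J t)
    ⟨0, by rintro _ ⟨J, rfl⟩; exact (iter_mem_Icc hκ hl J t).1⟩

lemma relax_mem_Icc (t : ℝ) : relax κ l t ∈ Icc (0 : ℝ) 1 :=
  isClosed_Icc.mem_of_tendsto (tendsto_iter hκ hl t)
    (Eventually.of_forall fun J => iter_mem_Icc hκ hl J t)

lemma abs_relax_le (t : ℝ) : |relax κ l t| ≤ 1 :=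
  abs_le.2 ⟨by linarith [(relax_mem_Icc hκ hl t).1], (relax_mem_Icc hκ hl t).2⟩

lemma antitone_relax : Antitone (relax κ l) := fun t u htu =>
  le_of_tendsto_of_tendsto' (tendsto_iter hκ hl u) (tendsto_iter hκ hl t)
    fun J => antitone_iter hκ hl J htu

omit hκ hl in
lemma relax_of_nonpos {t : ℝ} (ht : t ≤ 0) : relax κ l t = 1 := by
  simp [relax, iter_of_nonpos _ _ _ ht]

lemma relax_eq {t : ℝ} (ht : 0 < t) :
    ((∫ s, κ s) + l) * relax κ l t = ∫ s, κ s * relax κ l (t - s) := by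
  have h1 : Tendsto (fun J => ((∫ s, κ s) + l) * iter κ l (J + 1) t) atTop
      (𝓝 (((∫ s, κ s) + l) * relax κ l t)) :=
    ((tendsto_iter hκ hl t).comp (tendsto_add_atTop_nat 1)).const_mul _
  have h2 : Tendsto (fun J => ∫ s, κ s * iter κ l J (t - s)) atTop
      (𝓝 (∫ s, κ s * relax κ l (t - s))) := by
    refine tendsto_integral_of_dominated_convergence κ
      (fun J => (hκ.integrable_mul_shift (measurable_iter hκ.measurable l J)
        (abs_iter_le hκ hl J) t).aestronglyMeasurable) hκ.integrable
      (fun J => ae_of_all _ fun s => ?_)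
      (ae_of_all _ fun s => (tendsto_iter hκ hl (t - s)).const_mul _)
    rw [norm_mul, Real.norm_eq_abs, Real.norm_eq_abs, abs_of_nonneg (hκ.nonneg s)]
    exact mul_le_of_le_one_right (hκ.nonneg s) (abs_iter_le hκ hl J _)
  refine tendsto_nhds_unique h1 (h2.congr fun J => ?_)
  rw [iter_succ_of_pos _ _ _ ht, mul_div_cancel₀ _ (mass_add_pos hκ hl).ne']

/-- Comparison principle: subsolutions of the relaxation equation lie below its solution. -/
lemma le_relax {S : ℝ → ℝ} (hS : Measurable S) {C : ℝ} (hC : ∀ r, |S r| ≤ C)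
    (h1 : ∀ t, S t ≤ 1)
    (hsub : ∀ t, 0 < t → ((∫ s, κ s) + l) * S t ≤ ∫ s, κ s * S (t - s)) (t : ℝ) :
    S t ≤ relax κ l t := by
  refine le_ciInf fun J => ?_
  induction J generalizing t with
  | zero => exact h1 t
  | succ J ih =>
    rcases le_or_gt t 0 with ht | ht
    · rw [iter_of_nonpos _ _ _ ht]
      exact h1 t
    · rw [iter_succ_of_pos _ _ _ ht, le_div_iff₀ (mass_add_pos hκ hl), mul_comm]
      exact (hsub t ht).trans (hκ.integral_mono_shift hS
        (measurable_iter hκ.measurable l J) hC (abs_iter_le hκ hl J) fun s => ih _)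

end

end

end NonlocalDiffusion

/-! ### Positive definiteness of the relaxation function in frequency -/

namespace NonlocalDiffusion

noncomputable section

/-- The symbol `(2πξ)²` of `-∂ₓ²`. -/
def symb (ξ : ℝ) : ℝ := (2 * Real.pi * ξ) ^ 2

lemma symb_nonneg (ξ : ℝ) : 0 ≤ symb ξ := sq_nonneg _

lemma continuous_symb : Continuous symb := by unfold symb; fun_prop

lemma integral_cos_mul_exp {b : ℝ} (hb : 0 < b) (t : ℝ) :
    ∫ x : ℝ, Real.cos (t * x) * Real.exp (-(b * x ^ 2)) =
      (Real.pi / b) ^ (1 / 2 : ℝ) * Real.exp (-t ^ 2 / (4 * b)) := by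
  have hi : Integrable fun x : ℝ => Complex.exp (Complex.I * t * x) * Complex.exp (-(b : ℂ) * x ^ 2) := by
    have := (integrable_exp_neg_mul_sq hb).ofReal (𝕜 := ℂ)
    refine (this.bdd_mul (f := fun x : ℝ => Complex.exp (Complex.I * t * x)) (c := 1)
      (by fun_prop : Continuous fun x : ℝ => Complex.exp (Complex.I * t * x)).aestronglyMeasurable
      (ae_of_all _ fun x => ?_)).congr (ae_of_all _ fun x => ?_)
    · have h : Complex.I * t * x = ((t * x : ℝ) : ℂ) * Complex.I := by push_cast; ring
      rw [h, Complex.norm_exp_ofReal_mul_I]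
    · simp
  have h := fourierIntegral_gaussian (b := (b : ℂ)) (by simpa using hb) (t : ℂ)
  have h2 := congrArg Complex.re h
  have h3 : ∀ x : ℝ, (Complex.exp (Complex.I * t * x) * Complex.exp (-(b : ℂ) * x ^ 2)).re
      = Real.cos (t * x) * Real.exp (-(b * x ^ 2)) := by
    intro x
    have h : Complex.I * t * x = ((t * x : ℝ) : ℂ) * Complex.I := by push_cast; ring
    have h' : (-(b : ℂ) * x ^ 2) = ((-(b * x ^ 2) : ℝ) : ℂ) := by push_cast; ring
    rw [h, h', ← Complex.ofReal_exp, Complex.re_mul_ofReal, Complex.exp_ofReal_mul_I_re]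
  rw [← Complex.reCLM_apply, ← Complex.reCLM.integral_comp_comm hi] at h2
  simp only [Complex.reCLM_apply, h3] at h2
  rw [h2]
  have h4 : ((Real.pi : ℂ) / b) ^ (1 / 2 : ℂ) * Complex.exp (-(t : ℂ) ^ 2 / (4 * b))
      = (((Real.pi / b) ^ (1 / 2 : ℝ) * Real.exp (-t ^ 2 / (4 * b)) : ℝ) : ℂ) := by
    push_cast
    rw [Complex.ofReal_cpow (by positivity)]
    push_cast
    rfl
  rw [h4, Complex.ofReal_re]

lemma integral_cos_mul_exp_nonneg {b : ℝ} (hb : 0 < b) (t : ℝ) :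
    0 ≤ ∫ x : ℝ, Real.cos (t * x) * Real.exp (-(b * x ^ 2)) := by
  rw [integral_cos_mul_exp hb]
  positivity

lemma sq_le_symb (ξ : ℝ) : ξ ^ 2 ≤ symb ξ := by
  unfold symb
  have : (1 : ℝ) ≤ (2 * Real.pi) ^ 2 := by nlinarith [Real.pi_gt_three]
  rw [mul_pow]
  nlinarith [sq_nonneg ξ]

lemma integrable_inv_add_symb {a : ℝ} (ha : 0 < a) (m : ℕ) :
    Integrable fun ξ : ℝ => ((a + symb ξ) ^ (m + 1))⁻¹ := by
  have hpos : ∀ ξ, 0 < a + symb ξ := fun ξ => by linarith [symb_nonneg ξ]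
  have hc : Continuous fun ξ : ℝ => ((a + symb ξ) ^ (m + 1))⁻¹ :=
    ((continuous_const.add continuous_symb).pow _).inv₀ fun ξ => (pow_pos (hpos ξ) _).ne'
  refine (integrable_inv_one_add_sq.const_mul ((a ^ m)⁻¹ * (min a 1)⁻¹)).mono'
    hc.aestronglyMeasurable (ae_of_all _ fun ξ => ?_)
  rw [Real.norm_of_nonneg (by have := hpos ξ; positivity), ← mul_inv, ← mul_inv]
  have hm : 0 < min a 1 := lt_min ha one_pos
  refine inv_anti₀ (by positivity) ?_
  rw [pow_succ (a + symb ξ) m, mul_assoc]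
  have h1 : a ^ m ≤ (a + symb ξ) ^ m := pow_le_pow_left₀ ha.le (by linarith [symb_nonneg ξ]) m
  have h2 : min a 1 * (1 + ξ ^ 2) ≤ a + symb ξ := by
    have h3 := sq_le_symb ξ
    have h4 : min a 1 * ξ ^ 2 ≤ ξ ^ 2 := mul_le_of_le_one_left (sq_nonneg ξ) (min_le_right _ _)
    have h5 : min a 1 ≤ a := min_le_left _ _
    nlinarith
  exact mul_le_mul h1 h2 (by positivity) (by have := hpos ξ; positivity)

lemma integral_rpow_exp_eq {b : ℝ} (hb : 0 < b) (m : ℕ) :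
    ∫ τ in Ioi (0 : ℝ), τ ^ (m : ℝ) * Real.exp (-(b * τ)) =
      (b ^ (m + 1))⁻¹ * Real.Gamma (m + 1) := by
  have h := Real.integral_rpow_mul_exp_neg_mul_Ioi (a := (m : ℝ) + 1) (r := b) (by positivity) hb
  rw [add_sub_cancel_right] at h
  rw [h, one_div, Real.inv_rpow hb.le]
  congr 2
  exact_mod_cast Real.rpow_natCast b (m + 1)

/-- The Gamma integral writes a power of the resolvent as `∫ τ^m exp(-(a + symb ξ) τ) dτ` up to the
positive factor `Γ(m + 1)`: a positive mixture of Gaussians in `ξ`, each with positive transform. -/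
lemma integral_cos_mul_inv_nonneg {a : ℝ} (ha : 0 < a) (m : ℕ) (x : ℝ) :
    0 ≤ ∫ ξ : ℝ, Real.cos (2 * Real.pi * x * ξ) * ((a + symb ξ) ^ (m + 1))⁻¹ := by
  have hpos : ∀ ξ, 0 < a + symb ξ := fun ξ => by linarith [symb_nonneg ξ]
  have hG : 0 < Real.Gamma (m + 1) := Real.Gamma_pos_of_pos (by positivity)
  have hmeas : Measurable (Function.uncurry fun ξ τ : ℝ =>
      Real.cos (2 * Real.pi * x * ξ) * (τ ^ (m : ℝ) * Real.exp (-((a + symb ξ) * τ)))) := by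
    have := continuous_symb.measurable
    unfold Function.uncurry
    fun_prop
  have hint : Integrable (Function.uncurry fun ξ τ : ℝ =>
      Real.cos (2 * Real.pi * x * ξ) * (τ ^ (m : ℝ) * Real.exp (-((a + symb ξ) * τ))))
      (volume.prod (volume.restrict (Ioi 0))) := by
    have hτ : ∀ ξ, IntegrableOn (fun τ : ℝ => τ ^ (m : ℝ) * Real.exp (-((a + symb ξ) * τ)))
        (Ioi 0) := by
      intro ξ
      have := integrableOn_rpow_mul_exp_neg_mul_rpow (p := 1) (s := m) (b := a + symb ξ)
        (by linarith [(Nat.cast_nonneg m : (0 : ℝ) ≤ m)]) one_pos (hpos ξ)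
      simpa only [neg_mul, Real.rpow_one] using this
    rw [integrable_prod_iff hmeas.aestronglyMeasurable]
    refine ⟨ae_of_all _ fun ξ => (hτ ξ).const_mul (Real.cos (2 * Real.pi * x * ξ)), ?_⟩
    refine ((integrable_inv_add_symb ha m).mul_const (Real.Gamma (m + 1))).mono'
      (hmeas.norm.stronglyMeasurable.integral_prod_right').aestronglyMeasurable
      (ae_of_all _ fun ξ => ?_)
    rw [Real.norm_of_nonneg (integral_nonneg fun _ => norm_nonneg _),
      ← integral_rpow_exp_eq (hpos ξ)]
    refine setIntegral_mono_on ((hτ ξ).const_mul (Real.cos (2 * Real.pi * x * ξ))).norm (hτ ξ) measurableSet_Ioi fun τ hτ0 => ?_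
    have h0 : 0 ≤ τ ^ (m : ℝ) * Real.exp (-((a + symb ξ) * τ)) :=
      mul_nonneg (Real.rpow_nonneg (le_of_lt hτ0) _) (Real.exp_pos _).le
    simp only [Function.uncurry]
    rw [norm_mul, Real.norm_of_nonneg h0]
    exact mul_le_of_le_one_left h0 (Real.abs_cos_le_one _)
  have h := integral_integral_swap hint
  have hl : ∀ ξ : ℝ, (∫ τ in Ioi (0 : ℝ), Real.cos (2 * Real.pi * x * ξ) *
      (τ ^ (m : ℝ) * Real.exp (-((a + symb ξ) * τ)))) =
      Real.Gamma (m + 1) * (Real.cos (2 * Real.pi * x * ξ) * ((a + symb ξ) ^ (m + 1))⁻¹) := by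
    intro ξ
    rw [integral_const_mul, integral_rpow_exp_eq (hpos ξ)]
    ring
  simp only [hl] at h
  rw [integral_const_mul] at h
  refine nonneg_of_mul_nonneg_right (h ▸ ?_) hG
  refine setIntegral_nonneg measurableSet_Ioi fun τ hτ => ?_
  have hτ' : 0 < τ := hτ
  have he : ∀ ξ : ℝ, Real.cos (2 * Real.pi * x * ξ) * (τ ^ (m : ℝ) *
      Real.exp (-((a + symb ξ) * τ))) = (τ ^ (m : ℝ) * Real.exp (-(a * τ))) *
      (Real.cos (2 * Real.pi * x * ξ) * Real.exp (-(((2 * Real.pi) ^ 2 * τ) * ξ ^ 2))) := by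
    intro ξ
    rw [show -((a + symb ξ) * τ) = -(a * τ) + -(((2 * Real.pi) ^ 2 * τ) * ξ ^ 2) by
      unfold symb; ring, Real.exp_add]
    ring
  simp only [he]
  rw [integral_const_mul]
  have := integral_cos_mul_exp_nonneg (b := (2 * Real.pi) ^ 2 * τ) (by positivity)
    (2 * Real.pi * x)
  positivity

/-- Fubini in the Picard recursion: one step back in time averages over the jump `s` and contributes
one more factor `(a + symb ξ)⁻¹`. -/
lemma integral_cos_mul_iter_succ {κ : ℝ → ℝ} (hκ : IsJumpKernel κ) (J m : ℕ) (x : ℝ) {t : ℝ}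
    (ht : 0 < t) :
    ∫ ξ : ℝ, Real.cos (2 * Real.pi * x * ξ) *
      ((((∫ s, κ s) + symb ξ) ^ m)⁻¹ * iter κ (symb ξ) (J + 1) t) =
    ∫ s, κ s * ∫ ξ : ℝ, Real.cos (2 * Real.pi * x * ξ) *
      ((((∫ s, κ s) + symb ξ) ^ (m + 1))⁻¹ * iter κ (symb ξ) J (t - s)) := by
  have hpos : ∀ ξ, 0 < (∫ s, κ s) + symb ξ := fun ξ => by
    linarith [symb_nonneg ξ, hκ.mass_pos]
  have hmI : Measurable fun p : ℝ × ℝ => iter κ (symb p.1) J (t - p.2) :=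
    (measurable_iter_uncurry hκ.measurable J).comp
      ((continuous_symb.measurable.comp measurable_fst).prodMk
        (measurable_const.sub measurable_snd))
  have hmeas : Measurable (Function.uncurry fun ξ s : ℝ =>
      Real.cos (2 * Real.pi * x * ξ) * ((((∫ s, κ s) + symb ξ) ^ (m + 1))⁻¹ *
        (κ s * iter κ (symb ξ) J (t - s)))) := by
    have h1 := continuous_symb.measurable
    have h2 := hκ.measurable
    unfold Function.uncurry
    refine Measurable.mul (by fun_prop) (Measurable.mul (by fun_prop)
      (Measurable.mul (by fun_prop) hmI))
  have hint : Integrable (Function.uncurry fun ξ s : ℝ =>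
      Real.cos (2 * Real.pi * x * ξ) * ((((∫ s, κ s) + symb ξ) ^ (m + 1))⁻¹ *
        (κ s * iter κ (symb ξ) J (t - s)))) (volume.prod volume) := by
    refine ((integrable_inv_add_symb hκ.mass_pos m).mul_prod hκ.integrable).mono'
      hmeas.aestronglyMeasurable (ae_of_all _ fun p => ?_)
    have h0 : 0 ≤ (((∫ s, κ s) + symb p.1) ^ (m + 1))⁻¹ := by
      have := hpos p.1
      positivity
    simp only [Function.uncurry]
    rw [norm_mul, norm_mul, norm_mul, Real.norm_of_nonneg h0,
      Real.norm_of_nonneg (hκ.nonneg _), ← one_mul ((((∫ s, κ s) + symb p.1) ^ _)⁻¹ * κ p.2)]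
    refine mul_le_mul (Real.abs_cos_le_one _) ?_ (by have := hκ.nonneg p.2; positivity)
      zero_le_one
    exact mul_le_mul_of_nonneg_left (mul_le_of_le_one_right (hκ.nonneg _)
      (abs_iter_le hκ (symb_nonneg _) J _)) h0
  have h := integral_integral_swap hint
  have hl : ∀ ξ : ℝ, (∫ s, Real.cos (2 * Real.pi * x * ξ) *
      ((((∫ s, κ s) + symb ξ) ^ (m + 1))⁻¹ * (κ s * iter κ (symb ξ) J (t - s)))) =
      Real.cos (2 * Real.pi * x * ξ) *
        ((((∫ s, κ s) + symb ξ) ^ m)⁻¹ * iter κ (symb ξ) (J + 1) t) := by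
    intro ξ
    rw [integral_const_mul, integral_const_mul, iter_succ_of_pos _ _ _ ht]
    have := (hpos ξ).ne'
    field_simp
    try ring
  simp only [hl] at h
  rw [h]
  refine integral_congr_ae (ae_of_all _ fun s => ?_)
  simp only
  rw [← integral_const_mul]
  exact integral_congr_ae (ae_of_all _ fun ξ => by simp only; ring)

/-- Every Picard step raises the power of the resolvent, so the induction runs over all `m` and all
times at once. It ends where the iterate is identically one, leaving a bare power of the resolvent;
the exponent `m + 1` keeps everything integrable in `ξ`. -/
lemma integral_cos_mul_iter_nonneg {κ : ℝ → ℝ} (hκ : IsJumpKernel κ) (J m : ℕ) (x t : ℝ) :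
    0 ≤ ∫ ξ : ℝ, Real.cos (2 * Real.pi * x * ξ) *
      ((((∫ s, κ s) + symb ξ) ^ (m + 1))⁻¹ * iter κ (symb ξ) J t) := by
  induction J generalizing m t with
  | zero => simpa [iter] using integral_cos_mul_inv_nonneg hκ.mass_pos m x
  | succ J ih =>
    rcases le_or_gt t 0 with ht | ht
    · simpa [iter_of_nonpos _ _ _ ht] using integral_cos_mul_inv_nonneg hκ.mass_pos m x
    · rw [integral_cos_mul_iter_succ hκ J (m + 1) x ht]
      exact integral_nonneg fun s => mul_nonneg (hκ.nonneg s) (ih (m + 1) (t - s))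

lemma integral_cos_mul_relax_nonneg {κ : ℝ → ℝ} (hκ : IsJumpKernel κ) (x : ℝ) {t : ℝ}
    (ht : 0 < t) : 0 ≤ ∫ ξ : ℝ, Real.cos (2 * Real.pi * x * ξ) * relax κ (symb ξ) t := by
  have hpos : ∀ ξ, 0 < (∫ s, κ s) + symb ξ := fun ξ => by
    linarith [symb_nonneg ξ, hκ.mass_pos]
  have h1 : Tendsto (fun J => ∫ ξ : ℝ, Real.cos (2 * Real.pi * x * ξ) *
      iter κ (symb ξ) (J + 1) t) atTop
      (𝓝 (∫ ξ : ℝ, Real.cos (2 * Real.pi * x * ξ) * relax κ (symb ξ) t)) := by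
    have hm : ∀ J, Measurable fun ξ => iter κ (symb ξ) J t := fun J =>
      (measurable_iter_uncurry hκ.measurable J).comp
        (continuous_symb.measurable.prodMk measurable_const)
    -- For `t > 0` the first iterate is `a / (a + symb ξ)` and later ones lie below it. The zeroth
    -- iterate is the constant one, which is not integrable, hence the shift to `J + 1`.
    refine tendsto_integral_of_dominated_convergence
      (fun ξ => (∫ s, κ s) * (((∫ s, κ s) + symb ξ) ^ (0 + 1))⁻¹)
      (fun J => (Measurable.mul (by fun_prop) (hm _)).aestronglyMeasurable)
      ((integrable_inv_add_symb hκ.mass_pos 0).const_mul _)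
      (fun J => ae_of_all _ fun ξ => ?_) (ae_of_all _ fun ξ => ?_)
    · have h0 := iter_mem_Icc hκ (symb_nonneg ξ) (J + 1) t
      rw [norm_mul, Real.norm_of_nonneg h0.1]
      refine (mul_le_of_le_one_left h0.1 (Real.abs_cos_le_one _)).trans ?_
      refine (antitone_nat_of_succ_le (f := fun J => iter κ (symb ξ) J t) (fun J => iter_succ_le hκ (symb_nonneg ξ) J t)
        (Nat.le_add_left 1 J)).trans ?_
      simp only
      rw [iter_succ_of_pos _ _ _ ht]
      simp [iter, div_eq_mul_inv]
    · exact ((tendsto_iter hκ (symb_nonneg ξ) t).comp (tendsto_add_atTop_nat 1)).const_mul _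
  refine ge_of_tendsto' h1 fun J => ?_
  have h2 := integral_cos_mul_iter_succ hκ J 0 x ht
  simp only [pow_zero, inv_one, one_mul] at h2
  rw [h2]
  exact integral_nonneg fun s => mul_nonneg (hκ.nonneg s)
    (integral_cos_mul_iter_nonneg hκ J 0 x (t - s))

end

end NonlocalDiffusion

/-! ### The relaxation function of `ρ(s)/s`, and its dependence on the rate -/

namespace NonlocalDiffusion

noncomputable section

/-- A normalized density which is measurable, nonnegative and vanishes off the window `(0, δ)`. -/
structure IsKernel (δ : ℝ) (ρ : ℝ → ℝ) : Prop where
  delta_pos : 0 < δ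
  measurable : Measurable ρ
  nonneg : ∀ s, 0 ≤ ρ s
  eq_zero : ∀ s, s ∉ Ioo 0 δ → ρ s = 0
  integrable : Integrable ρ
  integral_eq_one : ∫ s, ρ s = 1

/-- The bounded approximations `ρ(s) / (s + 1 / (n + 1))` of the jump kernel `ρ(s) / s`. -/
def kap (ρ : ℝ → ℝ) (n : ℕ) (s : ℝ) : ℝ := ρ s / (s + 1 / ((n : ℝ) + 1))

/-- The relaxation function of the jump kernel `ρ(s) / s`. -/
def relaxation (ρ : ℝ → ℝ) (l t : ℝ) : ℝ := ⨆ n, relax (kap ρ n) l t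

section

variable {δ : ℝ} {ρ : ℝ → ℝ} (h : IsKernel δ ρ)

include h

lemma IsKernel.pos_or (s : ℝ) : ρ s = 0 ∨ (0 < s ∧ s < δ) := by
  by_cases hs : s ∈ Ioo 0 δ
  · exact Or.inr hs
  · exact Or.inl (h.eq_zero s hs)

lemma measurable_kap (n : ℕ) : Measurable (kap ρ n) :=
  h.measurable.div (by fun_prop)

lemma kap_nonneg (n : ℕ) (s : ℝ) : 0 ≤ kap ρ n s := by
  rcases h.pos_or s with h0 | ⟨h0, -⟩
  · simp [kap, h0]
  · have := h.nonneg s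
    unfold kap
    positivity

lemma kap_le (n : ℕ) (s : ℝ) : kap ρ n s ≤ (n + 1) * ρ s := by
  rcases h.pos_or s with h0 | ⟨h0, -⟩
  · simp [kap, h0]
  · unfold kap
    rw [div_le_iff₀ (by positivity)]
    have h1 : ((n : ℝ) + 1) * ρ s * (s + 1 / (n + 1)) = ρ s + (n + 1) * ρ s * s := by
      field_simp
      ring
    rw [h1]
    have := h.nonneg s
    have : 0 ≤ (n + 1) * ρ s * s := by positivity
    linarith

lemma integrable_kap (n : ℕ) : Integrable (kap ρ n) :=
  (h.integrable.const_mul ((n : ℝ) + 1)).mono' (measurable_kap h n).aestronglyMeasurable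
    (ae_of_all _ fun s => by
      rw [Real.norm_of_nonneg (kap_nonneg h n s)]
      exact kap_le h n s)

lemma kap_mono {m n : ℕ} (hmn : m ≤ n) (s : ℝ) : kap ρ m s ≤ kap ρ n s := by
  rcases h.pos_or s with h0 | ⟨h0, -⟩
  · simp [kap, h0]
  · unfold kap
    refine div_le_div_of_nonneg_left (h.nonneg s) (by positivity) ?_
    have := Nat.one_div_le_one_div (α := ℝ) hmn
    linarith

lemma tendsto_kap (s : ℝ) : Tendsto (fun n => kap ρ n s) atTop (𝓝 (ρ s / s)) := by
  rcases h.pos_or s with h0 | ⟨h0, -⟩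
  · simp [kap, h0]
  · unfold kap
    refine tendsto_const_nhds.div ?_ h0.ne'
    simpa using tendsto_one_div_add_atTop_nhds_zero_nat (𝕜 := ℝ) |>.const_add s

lemma isJumpKernel_kap (n : ℕ) : IsJumpKernel (kap ρ n) where
  measurable := measurable_kap h n
  nonneg := kap_nonneg h n
  integrable := integrable_kap h n
  mass_pos := by
    have hδ := h.delta_pos
    have h1 : ∫ s, (δ + 1)⁻¹ * ρ s ≤ ∫ s, kap ρ n s := by
      refine integral_mono (h.integrable.const_mul _) (integrable_kap h n) fun s => ?_
      rcases h.pos_or s with h0 | ⟨h0, h1⟩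
      · simp [kap, h0]
      · unfold kap
        rw [inv_mul_eq_div]
        refine div_le_div_of_nonneg_left (h.nonneg s) (by positivity) ?_
        have : 1 / ((n : ℝ) + 1) ≤ 1 := by
          rw [div_le_one (by positivity)]
          linarith [(Nat.cast_nonneg n : (0 : ℝ) ≤ n)]
        linarith
    rw [integral_const_mul, h.integral_eq_one, mul_one] at h1
    exact lt_of_lt_of_le (by positivity) h1

/-- The first moment of the coarsest approximate kernel. -/
lemma exists_moment_pos : ∃ c > 0, ∀ n, Integrable (fun s => kap ρ n s * s) ∧
    c ≤ ∫ s, kap ρ n s * s := by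
  have hint : ∀ n, Integrable fun s => kap ρ n s * s := by
    intro n
    refine ((integrable_kap h n).const_mul δ).mono'
      ((measurable_kap h n).mul measurable_id).aestronglyMeasurable (ae_of_all _ fun s => ?_)
    rcases h.pos_or s with h0 | ⟨h0, h1⟩
    · simp [kap, h0]
    · rw [Real.norm_of_nonneg (mul_nonneg (kap_nonneg h n s) h0.le), mul_comm]
      exact mul_le_mul_of_nonneg_right h1.le (kap_nonneg h n s)
  have hnn : ∀ n s, 0 ≤ kap ρ n s * s := by
    intro n s
    rcases h.pos_or s with h0 | ⟨h0, -⟩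
    · simp [kap, h0]
    · exact mul_nonneg (kap_nonneg h n s) h0.le
  refine ⟨∫ s, kap ρ 0 s * s, ?_, fun n => ⟨hint n, integral_mono (hint 0) (hint n) fun s => ?_⟩⟩
  · refine lt_of_le_of_ne (integral_nonneg (hnn 0)) fun h0 => ?_
    have h1 := (integral_eq_zero_iff_of_nonneg (hnn 0) (hint 0)).1 h0.symm
    have h2 : ρ =ᵐ[volume] 0 := by
      filter_upwards [h1] with s hs
      rcases h.pos_or s with h0 | ⟨h0, -⟩
      · exact h0
      · simp only [kap, Pi.zero_apply, mul_eq_zero, div_eq_zero_iff] at hs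
        rcases hs with (hs | hs) | hs
        · exact hs
        · norm_num at hs
          linarith
        · linarith
    have h3 := integral_congr_ae h2
    rw [h.integral_eq_one] at h3
    simp at h3
  · rcases h.pos_or s with h0 | ⟨h0, -⟩
    · simp [kap, h0]
    · exact mul_le_mul_of_nonneg_right (kap_mono h (Nat.zero_le n) s) h0.le

/-- The additional jumps of the larger kernel land at earlier times, where the decreasing solution
for the smaller kernel is larger. So that solution is a subsolution for the larger kernel, and
comparison applies. -/
lemma relax_kap_mono {l : ℝ} (hl : 0 ≤ l) (t : ℝ) : Monotone fun n => relax (kap ρ n) l t := by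
  intro m n hmn
  have hm := isJumpKernel_kap h m
  have hn := isJumpKernel_kap h n
  refine le_relax hn hl (measurable_relax hm.measurable l) (abs_relax_le hm hl)
    (fun t => (relax_mem_Icc hm hl t).2) (fun t ht => ?_) t
  have hmt := measurable_relax hm.measurable l
  have hab := abs_relax_le hm hl
  have h1 : ∫ s, (kap ρ n s - kap ρ m s) * relax (kap ρ m) l t ≤
      ∫ s, (kap ρ n s * relax (kap ρ m) l (t - s) - kap ρ m s * relax (kap ρ m) l (t - s)) := by
    refine integral_mono ((hn.integrable.sub hm.integrable).mul_const _)
      ((hn.integrable_mul_shift hmt hab t).sub (hm.integrable_mul_shift hmt hab t)) fun s => ?_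
    rcases h.pos_or s with h0 | ⟨h0, -⟩
    · simp [kap, h0]
    · simp only
      rw [← sub_mul]
      exact mul_le_mul_of_nonneg_left (antitone_relax hm hl (by linarith))
        (sub_nonneg.2 (kap_mono h hmn s))
  rw [integral_mul_const, integral_sub hn.integrable hm.integrable,
    integral_sub (hn.integrable_mul_shift hmt hab t) (hm.integrable_mul_shift hmt hab t),
    ← relax_eq hm hl ht] at h1
  linarith

lemma relax_antitone_param (n : ℕ) {l μ : ℝ} (hμ : 0 ≤ μ) (hl : μ ≤ l) (t : ℝ) :
    relax (kap ρ n) l t ≤ relax (kap ρ n) μ t := by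
  have hn := isJumpKernel_kap h n
  have hl0 := hμ.trans hl
  refine le_relax hn hμ (measurable_relax hn.measurable l) (abs_relax_le hn hl0)
    (fun t => (relax_mem_Icc hn hl0 t).2) (fun t ht => ?_) t
  rw [← relax_eq hn hl0 ht]
  exact mul_le_mul_of_nonneg_right (by linarith) (relax_mem_Icc hn hl0 t).1

/-- A barrier argument: with `B(t) = (t + δ)/c` for `t > 0` and `B = 0` before, every jump `s < δ`
from a positive time lowers `B` by at least `s/c`, even if it lands in the past. Averaged over the
jump kernel the decrease is at least one, which pays for the change of rate from `μ` to `l`. -/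
lemma relax_lipschitz {c : ℝ} (hc : 0 < c) (hcn : ∀ n, Integrable (fun s => kap ρ n s * s) ∧
    c ≤ ∫ s, kap ρ n s * s) (n : ℕ) {l μ : ℝ} (hμ : 0 ≤ μ) (hl : μ ≤ l) {t : ℝ} (ht : 0 < t) :
    relax (kap ρ n) μ t ≤ relax (kap ρ n) l t + (l - μ) * ((t + δ) / c) := by
  have hn := isJumpKernel_kap h n
  have hl0 := hμ.trans hl
  have hδ := h.delta_pos
  set B : ℝ → ℝ := fun t => if 0 < t then (t + δ) / c else 0 with hB
  have hB0 : ∀ t, 0 ≤ B t := by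
    intro t
    simp only [hB]
    split_ifs with h
    · positivity
    · exact le_rfl
  have hBm : Measurable B :=
    Measurable.ite measurableSet_Ioi (by fun_prop) measurable_const
  -- The truncation at zero keeps the subsolution bounded, as `le_relax` requires, although `B`
  -- grows linearly.
  set S : ℝ → ℝ := fun t => max (relax (kap ρ n) μ t - (l - μ) * B t) 0 with hS
  have hSm : Measurable S :=
    ((measurable_relax hn.measurable μ).sub (hBm.const_mul _)).max measurable_const
  have hS1 : ∀ t, S t ≤ 1 := fun t => max_le (by
    have := mul_nonneg (sub_nonneg.2 hl) (hB0 t)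
    linarith [(relax_mem_Icc hn hμ t).2]) zero_le_one
  have hS0 : ∀ t, 0 ≤ S t := fun t => le_max_right _ _
  have hSa : ∀ t, |S t| ≤ 1 := fun t => abs_le.2 ⟨by linarith [hS0 t], hS1 t⟩
  have key := le_relax hn hl0 hSm hSa hS1 (fun t ht => ?_) t
  · have := (le_max_left _ _).trans key
    simp only [hB, if_pos ht] at this
    linarith
  · rcases le_or_gt (relax (kap ρ n) μ t - (l - μ) * B t) 0 with h0 | h0
    · have : S t = 0 := max_eq_right h0
      rw [this, mul_zero]
      exact integral_nonneg fun s => mul_nonneg (kap_nonneg h n s) (hS0 _)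
    · have hSt : S t = relax (kap ρ n) μ t - (l - μ) * B t := max_eq_left h0.le
      have hrm := measurable_relax hn.measurable μ
      have hra := abs_relax_le hn hμ
      have e1 := hn.integrable_mul_shift hrm hra t
      have e2 : Integrable fun s => kap ρ n s * ((l - μ) * B t) := hn.integrable.mul_const _
      have e3 : Integrable fun s => (l - μ) / c * (kap ρ n s * s) := (hcn n).1.const_mul _
      have e4 : Integrable fun s => kap ρ n s * relax (kap ρ n) μ (t - s) -
        kap ρ n s * ((l - μ) * B t) := e1.sub e2
      have h1 : ∫ s, ((kap ρ n s * relax (kap ρ n) μ (t - s) - kap ρ n s * ((l - μ) * B t))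
          + (l - μ) / c * (kap ρ n s * s)) ≤ ∫ s, kap ρ n s * S (t - s) := by
        refine integral_mono (e4.add e3)
          (hn.integrable_mul_shift hSm hSa t) fun s => ?_
        rcases h.pos_or s with h0 | ⟨h0, h1⟩
        · simp [kap, h0]
        · have h2 : relax (kap ρ n) μ (t - s) - (l - μ) * B (t - s) ≤ S (t - s) :=
            le_max_left _ _
          have h3 : B (t - s) + s / c ≤ B t := by
            simp only [hB, if_pos ht]
            split_ifs with h4
            · rw [← add_div]
              exact div_le_div_of_nonneg_right (by linarith) hc.le
            · rw [zero_add]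
              exact div_le_div_of_nonneg_right (by linarith) hc.le
          have h4 : (l - μ) * (B (t - s) + s / c) ≤ (l - μ) * B t :=
            mul_le_mul_of_nonneg_left h3 (sub_nonneg.2 hl)
          have h5 : relax (kap ρ n) μ (t - s) - (l - μ) * B t + (l - μ) / c * s ≤ S (t - s) := by
            have : (l - μ) / c * s = (l - μ) * (s / c) := by ring
            rw [this]
            linarith
          have h6 := mul_le_mul_of_nonneg_left h5 (kap_nonneg h n s)
          simp only
          linarith
      rw [integral_add e4 e3, integral_sub e1 e2, ← relax_eq hn hμ ht, integral_mul_const, integral_const_mul] at h1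
      have h2 : l - μ ≤ (l - μ) / c * ∫ s, kap ρ n s * s := by
        rw [div_mul_eq_mul_div, le_div_iff₀ hc]
        exact mul_le_mul_of_nonneg_left (hcn n).2 (sub_nonneg.2 hl)
      rw [hSt]
      have h3 := mul_nonneg hl0 (mul_nonneg (sub_nonneg.2 hl) (hB0 t))
      have h4 := mul_nonneg (sub_nonneg.2 hl) (sub_nonneg.2 (relax_mem_Icc hn hμ t).2)
      nlinarith

lemma bddAbove_relax {l : ℝ} (hl : 0 ≤ l) (t : ℝ) :
    BddAbove (range fun n => relax (kap ρ n) l t) :=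
  ⟨1, by rintro _ ⟨n, rfl⟩; exact (relax_mem_Icc (isJumpKernel_kap h n) hl t).2⟩

lemma tendsto_relax {l : ℝ} (hl : 0 ≤ l) (t : ℝ) :
    Tendsto (fun n => relax (kap ρ n) l t) atTop (𝓝 (relaxation ρ l t)) :=
  tendsto_atTop_ciSup (relax_kap_mono h hl t) (bddAbove_relax h hl t)

lemma relax_le_relaxation {l : ℝ} (hl : 0 ≤ l) (n : ℕ) (t : ℝ) :
    relax (kap ρ n) l t ≤ relaxation ρ l t :=
  le_ciSup (bddAbove_relax h hl t) n

lemma relaxation_mem_Icc {l : ℝ} (hl : 0 ≤ l) (t : ℝ) : relaxation ρ l t ∈ Icc (0 : ℝ) 1 :=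
  isClosed_Icc.mem_of_tendsto (tendsto_relax h hl t)
    (Eventually.of_forall fun n => relax_mem_Icc (isJumpKernel_kap h n) hl t)

lemma abs_relaxation_le {l : ℝ} (hl : 0 ≤ l) (t : ℝ) : |relaxation ρ l t| ≤ 1 :=
  abs_le.2 ⟨by linarith [(relaxation_mem_Icc h hl t).1], (relaxation_mem_Icc h hl t).2⟩

omit h in
lemma relaxation_of_nonpos (l : ℝ) {t : ℝ} (ht : t ≤ 0) : relaxation ρ l t = 1 := by
  simp [relaxation, relax_of_nonpos ht]

lemma antitone_relaxation {l : ℝ} (hl : 0 ≤ l) : Antitone (relaxation ρ l) := fun t u htu =>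
  le_of_tendsto_of_tendsto' (tendsto_relax h hl u) (tendsto_relax h hl t)
    fun n => antitone_relax (isJumpKernel_kap h n) hl htu

lemma measurable_relaxation_uncurry : Measurable fun p : ℝ × ℝ => relaxation ρ p.1 p.2 := by
  unfold relaxation
  exact Measurable.iSup fun n => measurable_relax_uncurry (measurable_kap h n)

lemma measurable_relaxation (l : ℝ) : Measurable (relaxation ρ l) := by
  have hp : Measurable fun t : ℝ => (l, t) := measurable_const.prodMk measurable_id
  have := (measurable_relaxation_uncurry h).comp hp
  simpa only [Function.comp_def] using this

lemma relaxation_antitone_param {l μ : ℝ} (hμ : 0 ≤ μ) (hl : μ ≤ l) (t : ℝ) :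
    relaxation ρ l t ≤ relaxation ρ μ t :=
  le_of_tendsto_of_tendsto' (tendsto_relax h (hμ.trans hl) t) (tendsto_relax h hμ t)
    fun n => relax_antitone_param h n hμ hl t

/-- At rate zero the constant one is a solution, and the construction from above selects the largest
one. -/
lemma relaxation_zero (t : ℝ) : relaxation ρ 0 t = 1 := by
  refine le_antisymm (relaxation_mem_Icc h le_rfl t).2 ?_
  refine le_trans ?_ (relax_le_relaxation h le_rfl 0 t)
  exact le_relax (isJumpKernel_kap h 0) le_rfl (measurable_const (a := (1 : ℝ))) (C := 1)
    (by simp) (fun _ => le_rfl) (fun t _ => by simp) t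

lemma exists_relaxation_lipschitz : ∃ C > 0, ∀ l μ t : ℝ, 0 ≤ μ → μ ≤ l → 0 < t →
    relaxation ρ μ t ≤ relaxation ρ l t + (l - μ) * (C * (t + δ)) := by
  obtain ⟨c, hc, hcn⟩ := exists_moment_pos h
  refine ⟨c⁻¹, inv_pos.2 hc, fun l μ t hμ hl ht => ?_⟩
  refine le_of_tendsto_of_tendsto' (tendsto_relax h hμ t)
    ((tendsto_relax h (hμ.trans hl) t).add_const _) fun n => ?_
  rw [inv_mul_eq_div]
  exact relax_lipschitz h hc hcn n hμ hl ht

lemma continuousOn_relaxation_param (t : ℝ) :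
    ContinuousOn (fun l => relaxation ρ l t) (Ici 0) := by
  rcases le_or_gt t 0 with ht | ht
  · simp only [relaxation_of_nonpos _ ht]
    exact continuousOn_const
  · obtain ⟨C, hC, hL⟩ := exists_relaxation_lipschitz h
    have hδ := h.delta_pos
    have hK : 0 ≤ C * (t + δ) := by positivity
    refine LipschitzOnWith.continuousOn (K := (C * (t + δ)).toNNReal)
      (LipschitzOnWith.of_le_add_mul _ fun x hx y hy => ?_)
    rw [Real.coe_toNNReal _ hK, Real.dist_eq]
    rcases le_total x y with hxy | hxy
    · rw [abs_sub_comm, abs_of_nonneg (sub_nonneg.2 hxy), mul_comm]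
      exact hL y x t hx hxy ht
    · exact (relaxation_antitone_param h hy hxy t).trans
        (le_add_of_nonneg_right (mul_nonneg hK (abs_nonneg _)))

end

end

end NonlocalDiffusion

/-! ### The integrated relaxation equation in terms of the tail -/

namespace NonlocalDiffusion

noncomputable section

/-- The restriction of a real function to positive times, with values in `[0, ∞]`. -/
def cut (f : ℝ → ℝ) : ℝ → ℝ≥0∞ := (Ioi (0 : ℝ)).indicator fun t => ENNReal.ofReal (f t)

/-- The tail `r ↦ ∫_r^∞ k` of a kernel on the positive half-line. -/
def tail (k : ℝ → ℝ≥0∞) : ℝ → ℝ≥0∞ := (Ioi (0 : ℝ)).indicator fun r => ∫⁻ s in Ioi r, k s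

/-- The jump kernel `ρ(s) / s`. -/
def jump (ρ : ℝ → ℝ) (s : ℝ) : ℝ≥0∞ := ENNReal.ofReal (ρ s / s)

lemma measurable_cut {f : ℝ → ℝ} (hf : Measurable f) : Measurable (cut f) :=
  hf.ennreal_ofReal.indicator measurableSet_Ioi

lemma cut_of_pos (f : ℝ → ℝ) {t : ℝ} (ht : 0 < t) : cut f t = ENNReal.ofReal (f t) := by
  simp [cut, ht]

lemma cut_of_nonpos (f : ℝ → ℝ) {t : ℝ} (ht : t ≤ 0) : cut f t = 0 := by
  simp [cut, ht]

lemma cut_one : cut (fun _ => 1) = unitStep := by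
  simp [cut, unitStep]

lemma measurable_tail (k : ℝ → ℝ≥0∞) : Measurable (tail k) := by
  refine Measurable.indicator ?_ measurableSet_Ioi
  exact Antitone.measurable fun r s hrs => lintegral_mono_set (Ioi_subset_Ioi hrs)

lemma tail_of_pos (k : ℝ → ℝ≥0∞) {t : ℝ} (ht : 0 < t) : tail k t = ∫⁻ s in Ioi t, k s := by
  simp [tail, ht]

lemma tail_of_nonpos (k : ℝ → ℝ≥0∞) {t : ℝ} (ht : t ≤ 0) : tail k t = 0 := by
  simp [tail, ht]

lemma cut_le_one {f : ℝ → ℝ} (hf : ∀ t, f t ≤ 1) (t : ℝ) : cut f t ≤ unitStep t := by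
  rcases le_or_gt t 0 with ht | ht
  · rw [cut_of_nonpos _ ht]; exact zero_le
  · rw [cut_of_pos _ ht, unitStep_of_pos ht]
    exact ENNReal.ofReal_le_one.2 (hf t)

/-- Splitting of a convolution with a past identically one. -/
lemma lintegral_mul_shift_eq {k : ℝ → ℝ≥0∞} (hk : Measurable k) {f : ℝ → ℝ} (hf : Measurable f)
    (h1 : ∀ t ≤ 0, f t = 1) {t : ℝ} (ht : 0 < t) :
    ∫⁻ s, k s * ENNReal.ofReal (f (t - s)) = cv (cut f) (wd k) t + tail k t := by
  rw [cv_wd (measurable_cut hf) hk, tail_of_pos _ ht, ← lintegral_indicator measurableSet_Ioi,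
    ← lintegral_add_right _ (hk.indicator measurableSet_Ioi)]
  refine lintegral_congr_ae ?_
  filter_upwards [Measure.ae_ne volume t] with s hs
  rcases lt_or_gt_of_ne hs with h | h
  · rw [cut_of_pos _ (by linarith), Set.indicator_of_notMem (by simpa using h.le), add_zero]
  · rw [cut_of_nonpos _ (by linarith), Set.indicator_of_mem (mem_Ioi.2 h), h1 _ (by linarith)]
    simp

lemma cv_eq_zero_of_nonpos {g k : ℝ → ℝ≥0∞} (hg : Measurable g) (hk : Measurable k)
    (hg0 : ∀ t ≤ 0, g t = 0) (hk0 : ∀ t ≤ 0, k t = 0) {t : ℝ} (ht : t ≤ 0) :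
    cv g (wd k) t = 0 := by
  rw [cv_wd hg hk, lintegral_eq_zero_iff (by
    have : Measurable fun r => g (t - r) := hg.comp (by fun_prop)
    exact hk.mul this)]
  refine ae_of_all _ fun r => ?_
  rcases le_or_gt r 0 with h | h
  · simp [hk0 r h]
  · simp [hg0 (t - r) (by linarith)]

section

variable {κ : ℝ → ℝ} (hκ : IsJumpKernel κ) (h0 : ∀ s ≤ 0, κ s = 0)

include hκ h0

lemma cut_equation {f : ℝ → ℝ} (hf : Measurable f) (hf0 : ∀ t, f t ∈ Icc (0 : ℝ) 1)
    (h1 : ∀ t ≤ 0, f t = 1) {l : ℝ} (hl : 0 ≤ l)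
    (heq : ∀ t, 0 < t → ((∫ s, κ s) + l) * f t = ∫ s, κ s * f (t - s)) (t : ℝ) :
    (ENNReal.ofReal (∫ s, κ s) + ENNReal.ofReal l) * cut f t =
      cv (cut f) (wd fun s => ENNReal.ofReal (κ s)) t +
        tail (fun s => ENNReal.ofReal (κ s)) t := by
  have hk := hκ.measurable.ennreal_ofReal
  rcases le_or_gt t 0 with ht | ht
  · rw [cut_of_nonpos _ ht, tail_of_nonpos _ ht, cv_eq_zero_of_nonpos (measurable_cut hf) hk
      (fun t ht => cut_of_nonpos _ ht) (fun s hs => by simp [h0 s hs]) ht]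
    simp
  · rw [← lintegral_mul_shift_eq hk hf h1 ht, cut_of_pos _ ht,
      ← ENNReal.ofReal_add hκ.mass_pos.le hl,
      ← ENNReal.ofReal_mul (mass_add_pos hκ hl).le, heq t ht,
      ofReal_integral_eq_lintegral_ofReal (hκ.integrable_mul_shift hf (C := 1)
        (fun r => abs_le.2 ⟨by linarith [(hf0 r).1], (hf0 r).2⟩) t)
        (ae_of_all _ fun s => mul_nonneg (hκ.nonneg s) (hf0 _).1)]
    exact lintegral_congr fun s => ENNReal.ofReal_mul (hκ.nonneg s)

/-- Convolving the equation of `W` with the unit step gives `(a + l) 1*W = 1*k*W + T*1`; convolving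
the equation of the constant solution (rate zero) with `W` gives `a 1*W = 1*k*W + T*W`. The common
term `1*k*W` is finite and cancels. The total mass `a` disappears with it, so the identity can
survive a limit in which `a` diverges. -/
lemma relax_convolution {l : ℝ} (hl : 0 ≤ l) (t : ℝ) :
    cv (tail fun s => ENNReal.ofReal (κ s)) (wd (cut (relax κ l))) t +
      ENNReal.ofReal l * cv unitStep (wd (cut (relax κ l))) t =
      cv (tail fun s => ENNReal.ofReal (κ s)) (wd unitStep) t := by
  set k : ℝ → ℝ≥0∞ := fun s => ENNReal.ofReal (κ s) with hk
  have hkm : Measurable k := hκ.measurable.ennreal_ofReal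
  set W := cut (relax κ l) with hW
  have hWm : Measurable W := measurable_cut (measurable_relax hκ.measurable l)
  have e1 := cut_equation hκ h0 (measurable_relax hκ.measurable l) (relax_mem_Icc hκ hl)
    (fun t ht => relax_of_nonpos ht) hl (fun t ht => relax_eq hκ hl ht)
  have e2 := cut_equation hκ h0 (measurable_const (a := (1 : ℝ))) (fun t => by simp)
    (fun t ht => rfl) le_rfl (fun t ht => by simp)
  rw [cut_one] at e2
  simp only [ENNReal.ofReal_zero, add_zero] at e2
  have f1 : (ENNReal.ofReal (∫ s, κ s) + ENNReal.ofReal l) * cv unitStep (wd W) t =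
      cv (cv unitStep (wd k)) (wd W) t + cv (tail k) (wd unitStep) t := by
    rw [cv_swap measurable_unitStep hWm, ← cv_const_mul hWm]
    have : (fun r => (ENNReal.ofReal (∫ s, κ s) + ENNReal.ofReal l) * W r) =
      fun r => cv W (wd k) r + tail k r := funext e1
    rw [this, cv_add (measurable_cv hWm _), cv_comm hWm, ← cv_swap measurable_unitStep hWm,
      cv_comm measurable_unitStep]
  have f2 : ENNReal.ofReal (∫ s, κ s) * cv unitStep (wd W) t =
      cv (cv unitStep (wd k)) (wd W) t + cv (tail k) (wd W) t := by
    rw [← cv_const_mul measurable_unitStep]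
    have : (fun r => ENNReal.ofReal (∫ s, κ s) * unitStep r) =
      fun r => cv unitStep (wd k) r + tail k r := funext e2
    rw [this, cv_add (measurable_cv measurable_unitStep _)]
  have hfin : cv (cv unitStep (wd k)) (wd W) t ≠ ⊤ := by
    refine ne_top_of_le_ne_top ?_ (le_self_add.trans f2.ge)
    refine ENNReal.mul_ne_top ENNReal.ofReal_ne_top ?_
    rw [cv_swap measurable_unitStep hWm]
    refine ne_top_of_le_ne_top ?_ (cv_mono (cut_le_one fun t => (relax_mem_Icc hκ hl t).2) _ t)
    rw [cv_unitStep_unitStep]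
    exact ENNReal.ofReal_ne_top
  rw [add_mul, f2, add_assoc] at f1
  exact (ENNReal.add_right_inj hfin).1 f1

end

section

variable {δ : ℝ} {ρ : ℝ → ℝ} (h : IsKernel δ ρ)

include h

lemma measurable_jump : Measurable (jump ρ) :=
  (h.measurable.div measurable_id).ennreal_ofReal

lemma jump_of_nonpos {s : ℝ} (hs : s ≤ 0) : jump ρ s = 0 := by
  simp [jump, h.eq_zero s (by simp [hs])]

lemma tendsto_tail_kap (r : ℝ) :
    Tendsto (fun n => tail (fun s => ENNReal.ofReal (kap ρ n s)) r) atTop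
      (𝓝 (tail (jump ρ) r)) := by
  rcases le_or_gt r 0 with hr | hr
  · simp [tail_of_nonpos _ hr]
  · simp only [tail_of_pos _ hr]
    refine lintegral_tendsto_of_tendsto_of_monotone
      (fun n => (measurable_kap h n).ennreal_ofReal.aemeasurable)
      (ae_of_all _ fun s m n hmn => ENNReal.ofReal_le_ofReal (kap_mono h hmn s))
      (ae_of_all _ fun s => (ENNReal.continuous_ofReal.tendsto _).comp (tendsto_kap h s))

lemma tail_kap_mono (r : ℝ) : Monotone fun n => tail (fun s => ENNReal.ofReal (kap ρ n s)) r := by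
  intro m n hmn
  rcases le_or_gt r 0 with hr | hr
  · simp [tail_of_nonpos _ hr]
  · simp only [tail_of_pos _ hr]
    exact lintegral_mono fun s => ENNReal.ofReal_le_ofReal (kap_mono h hmn s)

/-- The tail of the jump kernel is a probability density. -/
lemma lintegral_tail : ∫⁻ r, tail (jump ρ) r = 1 := by
  have h1 : ∀ r, tail (jump ρ) r = ∫⁻ s, (Ioo 0 s).indicator (fun _ => jump ρ s) r := by
    intro r
    rcases le_or_gt r 0 with hr | hr
    · rw [tail_of_nonpos _ hr]
      simp [hr.not_gt]
    · rw [tail_of_pos _ hr, ← lintegral_indicator measurableSet_Ioi]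
      refine lintegral_congr fun s => ?_
      by_cases hs : r < s
      · simp [hs, hr]
      · simp [hs]
  simp only [h1]
  rw [lintegral_lintegral_swap]
  · have h2 : ∀ s, ∫⁻ r, (Ioo 0 s).indicator (fun _ => jump ρ s) r = ENNReal.ofReal (ρ s) := by
      intro s
      rw [lintegral_indicator measurableSet_Ioo, setLIntegral_const, Real.volume_Ioo, sub_zero]
      rcases h.pos_or s with h0 | ⟨h0, -⟩
      · simp [jump, h0]
      · rw [jump, ← ENNReal.ofReal_mul (div_nonneg (h.nonneg s) h0.le), div_mul_cancel₀ _ h0.ne']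
    simp only [h2]
    rw [← ofReal_integral_eq_lintegral_ofReal h.integrable (ae_of_all _ h.nonneg),
      h.integral_eq_one, ENNReal.ofReal_one]
  · have : (Function.uncurry fun r s : ℝ => (Ioo 0 s).indicator (fun _ => jump ρ s) r) =
        {p : ℝ × ℝ | 0 < p.1 ∧ p.1 < p.2}.indicator fun p => jump ρ p.2 := by
      ext p
      simp [Function.uncurry, Set.indicator]
    rw [this]
    refine (((measurable_jump h).comp measurable_snd).indicator ?_).aemeasurable
    exact (measurableSet_lt measurable_const measurable_fst).inter
      (measurableSet_lt measurable_fst measurable_snd)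

lemma tail_jump_ne_top (r : ℝ) : tail (jump ρ) r ≠ ⊤ := by
  rcases le_or_gt r 0 with hr | hr
  · simp [tail_of_nonpos _ hr]
  · rw [tail_of_pos _ hr]
    refine ne_top_of_le_ne_top (b := ∫⁻ s, ENNReal.ofReal (r⁻¹ * ρ s)) ?_ ?_
    · rw [← ofReal_integral_eq_lintegral_ofReal (h.integrable.const_mul _)
        (ae_of_all _ fun s => mul_nonneg (inv_nonneg.2 hr.le) (h.nonneg s))]
      exact ENNReal.ofReal_ne_top
    · refine (setLIntegral_mono' measurableSet_Ioi fun s hs => ?_).trans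
        (setLIntegral_le_lintegral _ _)
      refine ENNReal.ofReal_le_ofReal ?_
      rw [inv_mul_eq_div]
      exact div_le_div_of_nonneg_left (h.nonneg s) hr (le_of_lt hs)

/-- Tails and solutions both increase with `n`, so monotone convergence passes to the limit in each
term. Only the tail has to be finite, and it is even when `ρ(s)/s` is not integrable. -/
lemma relaxation_convolution {l : ℝ} (hl : 0 ≤ l) (t : ℝ) :
    cv (tail (jump ρ)) (wd (cut (relaxation ρ l))) t +
      ENNReal.ofReal l * cv unitStep (wd (cut (relaxation ρ l))) t =
      cv (tail (jump ρ)) (wd unitStep) t := by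
  have hWm : ∀ n, Measurable (cut (relax (kap ρ n) l)) := fun n =>
    measurable_cut (measurable_relax (measurable_kap h n) l)
  have hWl : Measurable (cut (relaxation ρ l)) := measurable_cut (measurable_relaxation h l)
  have hW : ∀ r, Tendsto (fun n => cut (relax (kap ρ n) l) r) atTop
      (𝓝 (cut (relaxation ρ l) r)) := by
    intro r
    rcases le_or_gt r 0 with hr | hr
    · simp [cut_of_nonpos _ hr]
    · simp only [cut_of_pos _ hr]
      exact (ENNReal.continuous_ofReal.tendsto _).comp (tendsto_relax h hl r)
  have hWmono : ∀ r, Monotone fun n => cut (relax (kap ρ n) l) r := by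
    intro r m n hmn
    rcases le_or_gt r 0 with hr | hr
    · simp [cut_of_nonpos _ hr]
    · simp only [cut_of_pos _ hr]
      exact ENNReal.ofReal_le_ofReal (relax_kap_mono h hl r hmn)
  have hWtop : ∀ r, cut (relaxation ρ l) r ≠ ⊤ := by
    intro r
    rcases le_or_gt r 0 with hr | hr
    · simp [cut_of_nonpos _ hr]
    · simp [cut_of_pos _ hr]
  have hTm : ∀ n, Measurable fun r => tail (fun s => ENNReal.ofReal (kap ρ n s)) (t - r) :=
    fun n => (measurable_tail _).comp (by fun_prop)
  have t1 : Tendsto (fun n => cv (tail fun s => ENNReal.ofReal (kap ρ n s))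
      (wd (cut (relax (kap ρ n) l))) t) atTop
      (𝓝 (cv (tail (jump ρ)) (wd (cut (relaxation ρ l))) t)) := by
    simp only [cv_wd (measurable_tail _) (hWm _), cv_wd (measurable_tail _) hWl]
    refine lintegral_tendsto_of_tendsto_of_monotone (fun n => ((hWm n).mul (hTm n)).aemeasurable)
      (ae_of_all _ fun r m n hmn => mul_le_mul' (hWmono r hmn) (tail_kap_mono h _ hmn))
      (ae_of_all _ fun r => ?_)
    exact ENNReal.Tendsto.mul (hW r) (Or.inr (tail_jump_ne_top h _)) (tendsto_tail_kap h _)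
      (Or.inr (hWtop r))
  have t2 : Tendsto (fun n => cv unitStep (wd (cut (relax (kap ρ n) l))) t) atTop
      (𝓝 (cv unitStep (wd (cut (relaxation ρ l))) t)) := by
    simp only [cv_unitStep_wd]
    exact lintegral_tendsto_of_tendsto_of_monotone (fun n => (hWm n).aemeasurable)
      (ae_of_all _ fun r => hWmono r) (ae_of_all _ hW)
  have t3 : Tendsto (fun n => cv (tail fun s => ENNReal.ofReal (kap ρ n s)) (wd unitStep) t)
      atTop (𝓝 (cv (tail (jump ρ)) (wd unitStep) t)) := by
    simp only [cv_wd (measurable_tail _) measurable_unitStep]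
    refine lintegral_tendsto_of_tendsto_of_monotone
      (fun n => (measurable_unitStep.mul (hTm n)).aemeasurable)
      (ae_of_all _ fun r m n hmn => mul_le_mul' le_rfl (tail_kap_mono h _ hmn))
      (ae_of_all _ fun r => ?_)
    exact ENNReal.Tendsto.const_mul (tendsto_tail_kap h _) (Or.inr (by
      rcases le_or_gt r 0 with hr | hr
      · simp [unitStep_of_nonpos hr]
      · simp [unitStep_of_pos hr]))
  refine tendsto_nhds_unique (t1.add (ENNReal.Tendsto.const_mul t2
    (Or.inr ENNReal.ofReal_ne_top))) (t3.congr fun n => ?_)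
  refine (relax_convolution (isJumpKernel_kap h n) (fun s hs => ?_) hl t).symm
  simp [kap, h.eq_zero s (by simp [hs])]

lemma cv_tail_unitStep_le_one (t : ℝ) : cv (tail (jump ρ)) (wd unitStep) t ≤ 1 := by
  rw [cv_swap (measurable_tail _) measurable_unitStep, cv_unitStep_wd, ← lintegral_tail h]
  exact setLIntegral_le_lintegral _ _

lemma mul_lintegral_relaxation_le {l : ℝ} (hl : 0 ≤ l) (t : ℝ) :
    ENNReal.ofReal l * ∫⁻ r in Ioo 0 t, ENNReal.ofReal (relaxation ρ l r) ≤ 1 := by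
  have h1 := (le_add_self.trans (relaxation_convolution h hl t).le).trans
    (cv_tail_unitStep_le_one h t)
  rwa [cv_unitStep_wd, cut, setLIntegral_indicator measurableSet_Ioi, Ioi_inter_Iio] at h1

/-- The integrated equation bounds `l ∫₀ᵗ W` by one and `W` decreases. This gives the decay in
frequency that makes inverse transforms converge absolutely. -/
lemma relaxation_le_div {l : ℝ} (hl : 0 ≤ l) {t : ℝ} (ht : 0 < t) :
    l * t * relaxation ρ l t ≤ 1 := by
  have h1 := mul_lintegral_relaxation_le h hl t
  have h2 : ENNReal.ofReal t * ENNReal.ofReal (relaxation ρ l t) ≤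
      ∫⁻ r in Ioo 0 t, ENNReal.ofReal (relaxation ρ l r) := by
    calc _ = ∫⁻ r in Ioo 0 t, ENNReal.ofReal (relaxation ρ l t) := by
          rw [setLIntegral_const, Real.volume_Ioo, sub_zero, mul_comm]
      _ ≤ _ := setLIntegral_mono' measurableSet_Ioo fun r hr =>
          ENNReal.ofReal_le_ofReal (antitone_relaxation h hl hr.2.le)
  have h3 := (mul_le_mul_right h2 (ENNReal.ofReal l)).trans h1
  rw [← ENNReal.ofReal_mul ht.le, ← ENNReal.ofReal_mul hl] at h3
  rw [mul_assoc]
  exact ENNReal.ofReal_le_one.1 h3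

end

end

end NonlocalDiffusion

/-! ### Continuity in time -/

namespace NonlocalDiffusion

noncomputable section

lemma monotone_cut {E : ℝ → ℝ} (hE : Monotone E) : Monotone (cut E) := by
  intro t u htu
  rcases le_or_gt t 0 with ht | ht
  · rw [cut_of_nonpos _ ht]; exact zero_le
  · rw [cut_of_pos _ ht, cut_of_pos _ (ht.trans_le htu)]
    exact ENNReal.ofReal_le_ofReal (hE htu)

lemma antitone_setLIntegral_Ioi (k : ℝ → ℝ≥0∞) : Antitone fun r => ∫⁻ s in Ioi r, k s :=
  fun _ _ hrs => lintegral_mono_set (Ioi_subset_Ioi hrs)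

section

variable {δ : ℝ} {ρ : ℝ → ℝ} (h : IsKernel δ ρ)

include h

lemma lintegral_jump_eq : ∫⁻ s, jump ρ s = ∫⁻ s in Ioi 0, jump ρ s := by
  rw [← lintegral_indicator measurableSet_Ioi]
  refine lintegral_congr fun s => ?_
  by_cases hs : 0 < s
  · simp [hs]
  · simp [hs, jump_of_nonpos h (not_lt.1 hs)]

lemma exists_lt_tail (hinf : ∫⁻ s, jump ρ s = ⊤) {C : ℝ≥0∞} (hC : C < ⊤) {a : ℝ} (ha : 0 < a) :
    ∃ r ∈ Ioo 0 a, C < tail (jump ρ) r := by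
  obtain ⟨u, hu, hut, hlim⟩ := exists_seq_strictAnti_tendsto (0 : ℝ)
  have hU : Ioi (0 : ℝ) = ⋃ n, Ioi (u n) := by
    ext x
    simp only [mem_Ioi, mem_iUnion]
    exact ⟨fun hx => (hlim.eventually (gt_mem_nhds hx)).exists, fun ⟨n, hn⟩ => (hut n).trans hn⟩
  have h1 : Tendsto (fun n => ∫⁻ s in Ioi (u n), jump ρ s) atTop (𝓝 ⊤) := by
    have hm : Monotone fun n => Ioi (u n) := fun i j hij => Ioi_subset_Ioi (hu.antitone hij)
    have h2 := tendsto_measure_iUnion_atTop (μ := wd (jump ρ)) hm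
    rw [← hU, withDensity_apply _ measurableSet_Ioi, ← lintegral_jump_eq h, hinf] at h2
    refine h2.congr fun n => ?_
    simp [withDensity_apply _ measurableSet_Ioi]
  obtain ⟨n, hn1, hn2⟩ := ((h1.eventually (lt_mem_nhds hC)).and
    (hlim.eventually (gt_mem_nhds ha))).exists
  exact ⟨u n, ⟨hut n, hn2⟩, by rwa [tail_of_pos _ (hut n)]⟩

omit h in
/-- A modulus of continuity for monotone functions with Lipschitz convolution against the tail. -/
lemma oscillation_mul_tail_le {E : ℝ → ℝ} (hE : Monotone E) {L : ℝ}
    (hfin : ∀ t, cv (tail (jump ρ)) (wd (cut E)) t ≠ ⊤)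
    (hlip : ∀ t u, t ≤ u → cv (tail (jump ρ)) (wd (cut E)) u ≤
      cv (tail (jump ρ)) (wd (cut E)) t + ENNReal.ofReal (L * (u - t)))
    (t : ℝ) {r : ℝ} (hr : 0 < r) :
    (cut E (t + r) - cut E (t - r)) * tail (jump ρ) r ≤ ENNReal.ofReal (4 * L) := by
  have hEm : Measurable (cut E) := measurable_cut hE.measurable
  have hEc := monotone_cut hE
  set j := cut E (t + r) - cut E (t - r) with hj
  -- For shifts `s ∈ (0, r)` the points `t - 2r - s` and `t + 2r - s` lie on either side of `[t - r,
  -- t + r]`, so the increment of `E` is at least `j`, with weight at least `tail r`. All other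
  -- shifts contribute nonnegatively. The distance `4r` between the endpoints produces the constant
  -- `4L`.
  have h1 : cv (tail (jump ρ)) (wd (cut E)) (t - 2 * r) + ENNReal.ofReal r *
      (j * tail (jump ρ) r) ≤ cv (tail (jump ρ)) (wd (cut E)) (t + 2 * r) := by
    rw [cv_swap (measurable_tail _) hEm, cv_wd hEm (measurable_tail _),
      cv_wd hEm (measurable_tail _)]
    have h2 : ENNReal.ofReal r * (j * tail (jump ρ) r) =
        ∫⁻ s, (Ioo 0 r).indicator (fun _ => j * tail (jump ρ) r) s := by
      rw [lintegral_indicator measurableSet_Ioo, setLIntegral_const, Real.volume_Ioo, sub_zero,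
        mul_comm]
    rw [h2, ← lintegral_add_right _ (measurable_const.indicator measurableSet_Ioo)]
    refine lintegral_mono fun s => ?_
    by_cases hs : s ∈ Ioo 0 r
    · rw [Set.indicator_of_mem hs]
      have h3 : tail (jump ρ) r ≤ tail (jump ρ) s := by
        rw [tail_of_pos _ hr, tail_of_pos _ hs.1]
        exact antitone_setLIntegral_Ioi _ hs.2.le
      calc tail (jump ρ) s * cut E (t - 2 * r - s) + j * tail (jump ρ) r
          ≤ tail (jump ρ) s * cut E (t - r) + j * tail (jump ρ) s :=
            add_le_add (mul_le_mul' le_rfl (hEc (by linarith [hs.1])))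
              (mul_le_mul' le_rfl h3)
        _ = tail (jump ρ) s * cut E (t + r) := by
            rw [mul_comm j, ← mul_add, hj, add_tsub_cancel_of_le (hEc (by linarith))]
        _ ≤ tail (jump ρ) s * cut E (t + 2 * r - s) :=
            mul_le_mul' le_rfl (hEc (by linarith [hs.2]))
    · rw [Set.indicator_of_notMem hs, add_zero]
      exact mul_le_mul' le_rfl (hEc (by linarith))
  have h2 := h1.trans (hlip (t - 2 * r) (t + 2 * r) (by linarith))
  have h3 := (ENNReal.add_le_add_iff_left (hfin _)).1 h2
  rw [show L * (t + 2 * r - (t - 2 * r)) = r * (4 * L) by ring, ENNReal.ofReal_mul hr.le] at h3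
  exact (ENNReal.mul_le_mul_iff_right (by simpa using hr) ENNReal.ofReal_ne_top).1 h3

/-- The oscillation over `(t - r, t + r)` times the tail at `r` is at most `4L`, and the tail is
unbounded near zero when the jump kernel has infinite mass. -/
lemma continuous_of_convolution_lipschitz (hinf : ∫⁻ s, jump ρ s = ⊤) {E : ℝ → ℝ}
    (hE : Monotone E) (hE0 : ∀ t ≤ 0, E t = 0) {L : ℝ}
    (hfin : ∀ t, cv (tail (jump ρ)) (wd (cut E)) t ≠ ⊤)
    (hlip : ∀ t u, t ≤ u → cv (tail (jump ρ)) (wd (cut E)) u ≤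
      cv (tail (jump ρ)) (wd (cut E)) t + ENNReal.ofReal (L * (u - t))) :
    Continuous E := by
  have hcut : ∀ t, cut E t = ENNReal.ofReal (E t) := by
    intro t
    rcases le_or_gt t 0 with ht | ht
    · rw [cut_of_nonpos _ ht, hE0 t ht, ENNReal.ofReal_zero]
    · exact cut_of_pos _ ht
  have hnn : ∀ t, 0 ≤ E t := by
    intro t
    rcases le_or_gt t 0 with ht | ht
    · exact (hE0 t ht).ge
    · rw [← hE0 0 le_rfl]
      exact hE ht.le
  rw [Metric.continuous_iff]
  intro t ε hε
  obtain ⟨r, ⟨hr, -⟩, hrt⟩ := exists_lt_tail h hinf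
    (C := ENNReal.ofReal (4 * L / ε)) ENNReal.ofReal_lt_top one_pos
  have h1 := oscillation_mul_tail_le hE hfin hlip t hr
  rw [hcut, hcut, ← ENNReal.ofReal_sub _ (hnn _)] at h1
  have hj : E (t + r) - E (t - r) < ε := by
    by_contra! hcon
    have h2 : ENNReal.ofReal (4 * L) < ENNReal.ofReal ε * tail (jump ρ) r := by
      calc ENNReal.ofReal (4 * L) = ENNReal.ofReal ε * ENNReal.ofReal (4 * L / ε) := by
            rw [← ENNReal.ofReal_mul hε.le, mul_div_cancel₀ _ hε.ne']
        _ < _ := (ENNReal.mul_lt_mul_iff_right (by simpa using hε) ENNReal.ofReal_ne_top).2 hrt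
    exact absurd (h1.trans_lt h2) (not_lt.2 (mul_le_mul' (ENNReal.ofReal_le_ofReal hcon) le_rfl))
  refine ⟨r, hr, fun u hu => ?_⟩
  rw [Real.dist_eq, abs_lt] at hu ⊢
  have h3 := hE (show t - r ≤ u by linarith)
  have h4 := hE (show u ≤ t + r by linarith)
  have h5 := hE (show t - r ≤ t by linarith)
  have h6 := hE (show t ≤ t + r by linarith)
  constructor <;> linarith

/-- The form of the equation used from here on: unlike `W`, the complement `1 - W` vanishes in the
past and increases, and the right side is Lipschitz in `t`. It results from cancelling `T * W`,
which is at most one. -/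
lemma relaxation_compl_convolution {l : ℝ} (hl : 0 ≤ l) (t : ℝ) :
    cv (tail (jump ρ)) (wd (cut fun r => 1 - relaxation ρ l r)) t =
      ENNReal.ofReal l * cv unitStep (wd (cut (relaxation ρ l))) t := by
  have hW := measurable_cut (measurable_relaxation h l)
  have hE : Measurable (cut fun r => 1 - relaxation ρ l r) :=
    measurable_cut ((measurable_relaxation h l).const_sub 1)
  have h1 : (fun r => cut (relaxation ρ l) r + cut (fun r => 1 - relaxation ρ l r) r) =
      unitStep := by
    funext r
    rcases le_or_gt r 0 with hr | hr
    · simp [cut_of_nonpos _ hr, unitStep_of_nonpos hr]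
    · rw [cut_of_pos _ hr, cut_of_pos _ hr, unitStep_of_pos hr,
        ← ENNReal.ofReal_add (relaxation_mem_Icc h hl r).1
          (sub_nonneg.2 (relaxation_mem_Icc h hl r).2)]
      simp
  have h2 := relaxation_convolution h hl t
  have h4 := (le_add_right le_rfl).trans (h2.le.trans (cv_tail_unitStep_le_one h t))
  have h3 : cv (tail (jump ρ)) (wd unitStep) t = cv (tail (jump ρ)) (wd (cut (relaxation ρ l))) t
      + cv (tail (jump ρ)) (wd (cut fun r => 1 - relaxation ρ l r)) t := by
    rw [cv_swap (measurable_tail _) measurable_unitStep, ← h1, cv_add hW,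
      cv_swap (measurable_tail _) hW, cv_swap (measurable_tail _) hE]
  rw [h3] at h2
  exact ((ENNReal.add_right_inj (ne_top_of_le_ne_top ENNReal.one_ne_top h4)).1 h2).symm

lemma integrable_div_of_lintegral_jump (hfin : ∫⁻ s, jump ρ s ≠ ⊤) :
    Integrable fun s => ρ s / s := by
  have hm : Measurable fun s => ρ s / s := h.measurable.div measurable_id
  refine (lintegral_ofReal_ne_top_iff_integrable hm.aestronglyMeasurable
    (ae_of_all _ fun s => ?_)).1 hfin
  rcases h.pos_or s with h0 | ⟨h0, -⟩
  · simp [h0]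
  · exact div_nonneg (h.nonneg s) h0.le

lemma div_self_nonneg (s : ℝ) : 0 ≤ ρ s / s := by
  rcases h.pos_or s with h0 | ⟨h0, -⟩
  · simp [h0]
  · exact div_nonneg (h.nonneg s) h0.le

lemma kap_le_div (n : ℕ) (s : ℝ) : kap ρ n s ≤ ρ s / s := by
  rcases h.pos_or s with h0 | ⟨h0, -⟩
  · simp [kap, h0]
  · refine div_le_div_of_nonneg_left (h.nonneg s) h0 ?_
    have : (0 : ℝ) ≤ 1 / (n + 1) := by positivity
    linarith

lemma relaxation_eq_of_integrable (hk : Integrable fun s => ρ s / s) {l : ℝ} (hl : 0 ≤ l)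
    {t : ℝ} (ht : 0 < t) :
    ((∫ s, ρ s / s) + l) * relaxation ρ l t = ∫ s, ρ s / s * relaxation ρ l (t - s) := by
  have h1 : Tendsto (fun n => ∫ s, kap ρ n s) atTop (𝓝 (∫ s, ρ s / s)) :=
    tendsto_integral_of_dominated_convergence _
      (fun n => (measurable_kap h n).aestronglyMeasurable) hk
      (fun n => ae_of_all _ fun s => by
        rw [Real.norm_of_nonneg (kap_nonneg h n s)]
        exact kap_le_div h n s) (ae_of_all _ fun s => tendsto_kap h s)
  have h2 : Tendsto (fun n => ∫ s, kap ρ n s * relax (kap ρ n) l (t - s)) atTop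
      (𝓝 (∫ s, ρ s / s * relaxation ρ l (t - s))) := by
    refine tendsto_integral_of_dominated_convergence (fun s => ρ s / s)
      (fun n => ((isJumpKernel_kap h n).integrable_mul_shift
        (measurable_relax (measurable_kap h n) l)
        (abs_relax_le (isJumpKernel_kap h n) hl) t).aestronglyMeasurable) hk
      (fun n => ae_of_all _ fun s => ?_)
      (ae_of_all _ fun s => (tendsto_kap h s).mul (tendsto_relax h hl (t - s)))
    rw [norm_mul, Real.norm_of_nonneg (kap_nonneg h n s), Real.norm_eq_abs]
    exact (mul_le_of_le_one_right (kap_nonneg h n s)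
      (abs_relax_le (isJumpKernel_kap h n) hl _)).trans (kap_le_div h n s)
  exact tendsto_nhds_unique ((h1.add_const l).mul (tendsto_relax h hl t))
    (h2.congr fun n => (relax_eq (isJumpKernel_kap h n) hl ht).symm)

lemma integral_div_pos (hk : Integrable fun s => ρ s / s) : 0 < ∫ s, ρ s / s :=
  (isJumpKernel_kap h 0).mass_pos.trans_le
    (integral_mono (integrable_kap h 0) hk fun s => kap_le_div h 0 s)

omit h in
-- A monotone function has only countably many discontinuities, so the integrand is continuous in
-- `t` for almost every `s`, and dominated convergence applies.
lemma continuous_integral_mul_shift {k f : ℝ → ℝ} (hk : Integrable k) (hf : Antitone f)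
    {C : ℝ} (hC : ∀ t, |f t| ≤ C) : Continuous fun t => ∫ s, k s * f (t - s) := by
  rw [continuous_iff_continuousAt]
  intro t
  refine continuousAt_of_dominated (bound := fun s => C * |k s|)
    (Eventually.of_forall fun u => hk.aestronglyMeasurable.mul
      (hf.measurable.comp (by fun_prop : Measurable fun s : ℝ => u - s)).aestronglyMeasurable)
    (Eventually.of_forall fun u => ae_of_all _ fun s => ?_) (hk.norm.const_mul C) ?_
  · rw [norm_mul, Real.norm_eq_abs, Real.norm_eq_abs, mul_comm]
    exact mul_le_mul_of_nonneg_right (hC _) (abs_nonneg _)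
  · have hc : {s | ¬ContinuousAt f (t - s)}.Countable :=
      hf.countable_not_continuousAt.preimage sub_right_injective
    filter_upwards [hc.ae_notMem volume] with s hs
    have hs' : ContinuousAt f (t - s) := by simpa using hs
    exact continuousAt_const.mul (hs'.comp (f := fun u : ℝ => u - s) (by fun_prop))

/-- If the jump kernel has infinite mass, the tail argument gives continuity on the whole line. If
its mass `a` is finite, the pointwise equation expresses `W` as a continuous convolution for `t > 0`
only: at time zero `W` drops from `1` to `a / (a + l)`. -/
lemma continuousOn_relaxation {l : ℝ} (hl : 0 ≤ l) : ContinuousOn (relaxation ρ l) (Ioi 0) := by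
  by_cases hfin : ∫⁻ s, jump ρ s = ⊤
  · refine Continuous.continuousOn ?_
    have hE : Continuous fun t => 1 - relaxation ρ l t := by
      have hlf : ∀ t, cv unitStep (wd (cut (relaxation ρ l))) t ≠ ⊤ := by
        intro t
        rw [cv_swap measurable_unitStep (measurable_cut (measurable_relaxation h l))]
        refine ne_top_of_le_ne_top ?_ (cv_mono (cut_le_one fun t => (relaxation_mem_Icc h hl t).2)
          _ t)
        rw [cv_unitStep_unitStep]
        exact ENNReal.ofReal_ne_top
      refine continuous_of_convolution_lipschitz h hfin
        (fun t u htu => sub_le_sub_left (antitone_relaxation h hl htu) 1)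
        (fun t ht => by rw [relaxation_of_nonpos _ ht, sub_self]) (L := l) (fun t => ?_)
        fun t u htu => ?_
      · rw [relaxation_compl_convolution h hl]
        exact ENNReal.mul_ne_top ENNReal.ofReal_ne_top (hlf t)
      · rw [relaxation_compl_convolution h hl, relaxation_compl_convolution h hl,
          ENNReal.ofReal_mul hl, ← mul_add]
        refine mul_le_mul' le_rfl ?_
        rw [cv_unitStep_wd, cv_unitStep_wd]
        rw [← Iio_union_Ico_eq_Iio htu]
        refine (lintegral_union_le _ _ _).trans (add_le_add le_rfl ?_)
        calc ∫⁻ r in Ico t u, cut (relaxation ρ l) r ≤ ∫⁻ r in Ico t u, 1 :=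
              lintegral_mono fun r => (cut_le_one (fun t => (relaxation_mem_Icc h hl t).2) r).trans
                (by unfold unitStep; exact Set.indicator_le_self' (by simp) r)
          _ = _ := by simp
    exact ((continuous_const (y := (1 : ℝ))).sub hE).congr fun t => by simp
  · have hk := integrable_div_of_lintegral_jump h hfin
    have hA : (∫ s, ρ s / s) + l ≠ 0 := by
      have := integral_div_pos h hk
      positivity
    have hc := (continuous_integral_mul_shift hk (antitone_relaxation h hl)
      (abs_relaxation_le h hl)).div_const ((∫ s, ρ s / s) + l)
    refine hc.continuousOn.congr fun t ht => ?_
    simp only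
    rw [← relaxation_eq_of_integrable h hk hl ht, mul_div_cancel_left₀ _ hA]

end

end

end NonlocalDiffusion

/-! ### Cosine transforms and Fourier inversion -/

namespace NonlocalDiffusion

noncomputable section


lemma integrable_cos_mul {f : ℝ → ℝ} (hf : Integrable f) (c θ : ℝ) :
    Integrable fun ξ => Real.cos (c * ξ + θ) * f ξ :=
  hf.bdd_mul (c := 1) (by fun_prop : Continuous _).aestronglyMeasurable
    (ae_of_all _ fun ξ => Real.abs_cos_le_one _)

lemma integrable_cos_mul' {f : ℝ → ℝ} (hf : Integrable f) (c : ℝ) :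
    Integrable fun ξ => Real.cos (c * ξ) * f ξ := by
  simpa using integrable_cos_mul hf c 0

lemma integrable_sin_mul {f : ℝ → ℝ} (hf : Integrable f) (c : ℝ) :
    Integrable fun ξ => Real.sin (c * ξ) * f ξ :=
  hf.bdd_mul (c := 1) (by fun_prop : Continuous _).aestronglyMeasurable
    (ae_of_all _ fun ξ => Real.abs_sin_le_one _)

lemma fourier_ofReal {f : ℝ → ℝ} (hf : Integrable f) (x : ℝ) :
    𝓕 (fun ξ => (f ξ : ℂ)) x = ((∫ ξ, Real.cos (2 * Real.pi * x * ξ) * f ξ : ℝ) : ℂ) -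
      ((∫ ξ, Real.sin (2 * Real.pi * x * ξ) * f ξ : ℝ) : ℂ) * Complex.I := by
  rw [Real.fourier_real_eq_integral_exp_smul, ← integral_complex_ofReal, ← integral_complex_ofReal,
    ← integral_mul_const, ← integral_sub (integrable_cos_mul' hf _).ofReal
      ((integrable_sin_mul hf _).ofReal.mul_const _)]
  refine integral_congr_ae (ae_of_all _ fun ξ => ?_)
  simp only [smul_eq_mul]
  rw [Complex.exp_mul_I, ← Complex.ofReal_cos, ← Complex.ofReal_sin,
    show -2 * Real.pi * ξ * x = -(2 * Real.pi * x * ξ) by ring, Real.cos_neg, Real.sin_neg]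
  push_cast
  ring

lemma fourierInv_ofReal {f : ℝ → ℝ} (hf : Integrable f) (x : ℝ) :
    𝓕⁻ (fun ξ => (f ξ : ℂ)) x = ((∫ ξ, Real.cos (2 * Real.pi * x * ξ) * f ξ : ℝ) : ℂ) +
      ((∫ ξ, Real.sin (2 * Real.pi * x * ξ) * f ξ : ℝ) : ℂ) * Complex.I := by
  rw [Real.fourierInv_eq_fourier_neg, fourier_ofReal hf]
  have h : ∀ ξ, 2 * Real.pi * (-x) * ξ = -(2 * Real.pi * x * ξ) := fun ξ => by ring
  simp only [h, Real.cos_neg, Real.sin_neg, neg_mul, integral_neg]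
  push_cast
  ring

lemma integral_sin_mul_even {f : ℝ → ℝ} (he : ∀ ξ, f (-ξ) = f ξ) (c : ℝ) :
    ∫ ξ, Real.sin (c * ξ) * f ξ = 0 := by
  have h := integral_neg_eq_self (fun ξ => Real.sin (c * ξ) * f ξ) volume
  simp only [he, mul_neg, Real.sin_neg, neg_mul, integral_neg] at h
  linarith

/-- Fourier inversion for an even function, in real form. -/
lemma cosine_inversion {f F : ℝ → ℝ} (hf : Integrable f) (hc : Continuous f)
    (he : ∀ ξ, f (-ξ) = f ξ) (hF : ∀ x, F x = ∫ ξ, Real.cos (2 * Real.pi * x * ξ) * f ξ)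
    (hFi : Integrable F) (ξ : ℝ) : ∫ x, Real.cos (2 * Real.pi * ξ * x) * F x = f ξ := by
  have h1 : 𝓕 (fun ξ => (f ξ : ℂ)) = fun x => (F x : ℂ) := by
    funext x
    rw [fourier_ofReal hf, integral_sin_mul_even he, hF]
    simp
  have h2 := congrFun (Continuous.fourierInv_fourier_eq
    (f := fun ξ => (f ξ : ℂ)) (by fun_prop) hf.ofReal (h1 ▸ hFi.ofReal)) ξ
  rw [h1, fourierInv_ofReal hFi] at h2
  simpa using congrArg Complex.re h2

/-- Fourier inversion for a function whose Fourier transform is real. -/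
lemma eq_of_cosine_transform {f F : ℝ → ℝ} (hF : Integrable F) (hc : Continuous F)
    (hf : Integrable f) (hcos : ∀ ξ, ∫ x, Real.cos (2 * Real.pi * ξ * x) * F x = f ξ)
    (hsin : ∀ ξ, ∫ x, Real.sin (2 * Real.pi * ξ * x) * F x = 0) (x : ℝ) :
    F x = ∫ ξ, Real.cos (2 * Real.pi * x * ξ) * f ξ := by
  have h1 : 𝓕 (fun x => (F x : ℂ)) = fun ξ => (f ξ : ℂ) := by
    funext ξ
    rw [fourier_ofReal hF, hcos, hsin]
    simp
  have h2 := congrFun (Continuous.fourierInv_fourier_eq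
    (f := fun x => (F x : ℂ)) (by fun_prop) hF.ofReal (h1 ▸ hf.ofReal)) x
  rw [h1, fourierInv_ofReal hf] at h2
  simpa using (congrArg Complex.re h2).symm

lemma integrable_gauss {b : ℝ} (hb : 0 < b) : Integrable fun x : ℝ => Real.exp (-(b * x ^ 2)) := by
  simpa [neg_mul] using integrable_exp_neg_mul_sq hb

/-- A nonnegative Fourier transform of a bounded integrable function is integrable. -/
lemma lintegral_cosine_transform_le {f F : ℝ → ℝ} (hf : Integrable f) {M : ℝ} (hM : ∀ ξ, |f ξ| ≤ M)
    (hF : ∀ x, F x = ∫ ξ, Real.cos (2 * Real.pi * x * ξ) * f ξ) (hF0 : ∀ x, 0 ≤ F x)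
    (hFm : Measurable F) : ∫⁻ x, ENNReal.ofReal (F x) ≤ ENNReal.ofReal M := by
  have hM0 : 0 ≤ M := (abs_nonneg _).trans (hM 0)
  -- Damped by a Gaussian, the integral of `F` is by Fubini an average of `f` against a Gaussian
  -- probability density, hence at most `M`. Positivity of `F` lets Fatou remove the damping.
  have key : ∀ b : ℝ, 0 < b →
      ∫⁻ x, ENNReal.ofReal (F x * Real.exp (-(b * x ^ 2))) ≤ ENNReal.ofReal M := by
    intro b hb
    have hFb : ∀ x, |F x| ≤ ∫ ξ, |f ξ| := by
      intro x
      rw [hF]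
      refine (abs_integral_le_integral_abs).trans (integral_mono (integrable_cos_mul' hf _).abs
        hf.abs fun ξ => ?_)
      simp only [abs_mul]
      exact mul_le_of_le_one_left (abs_nonneg _) (Real.abs_cos_le_one _)
    have hFi : Integrable fun x => F x * Real.exp (-(b * x ^ 2)) :=
      (integrable_gauss hb).bdd_mul hFm.aestronglyMeasurable (ae_of_all _ hFb)
    rw [← ofReal_integral_eq_lintegral_ofReal hFi
      (ae_of_all _ fun x => mul_nonneg (hF0 x) (Real.exp_pos _).le)]
    refine ENNReal.ofReal_le_ofReal ?_
    have hint : Integrable (Function.uncurry fun x ξ : ℝ =>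
        Real.cos (2 * Real.pi * x * ξ) * (Real.exp (-(b * x ^ 2)) * f ξ))
        (volume.prod volume) := by
      refine ((integrable_gauss hb).mul_prod hf).bdd_mul (c := 1)
        (f := fun p : ℝ × ℝ => Real.cos (2 * Real.pi * p.1 * p.2)) ?_
        (ae_of_all _ fun p => Real.abs_cos_le_one _)
      exact (by fun_prop : Continuous fun p : ℝ × ℝ =>
        Real.cos (2 * Real.pi * p.1 * p.2)).aestronglyMeasurable
    have h1 : ∫ x, F x * Real.exp (-(b * x ^ 2)) = ∫ ξ, (∫ x, Real.cos (2 * Real.pi * ξ * x) *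
        Real.exp (-(b * x ^ 2))) * f ξ := by
      have hs := integral_integral_swap hint
      have e1 : ∀ x, ∫ ξ, Real.cos (2 * Real.pi * x * ξ) * (Real.exp (-(b * x ^ 2)) * f ξ) =
          F x * Real.exp (-(b * x ^ 2)) := by
        intro x
        rw [hF, mul_comm (∫ ξ, _), ← integral_const_mul]
        exact integral_congr_ae (ae_of_all _ fun ξ => by simp only; ring)
      have e2 : ∀ ξ, ∫ x, Real.cos (2 * Real.pi * x * ξ) * (Real.exp (-(b * x ^ 2)) * f ξ) =
          (∫ x, Real.cos (2 * Real.pi * ξ * x) * Real.exp (-(b * x ^ 2))) * f ξ := by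
        intro ξ
        rw [← integral_mul_const]
        refine integral_congr_ae (ae_of_all _ fun x => ?_)
        simp only
        rw [mul_right_comm (2 * Real.pi) x ξ]
        ring
      simp only [e1, e2] at hs
      exact hs
    rw [h1]
    have hπ := Real.pi_pos
    have h2 : ∀ ξ : ℝ, ∫ x, Real.cos (2 * Real.pi * ξ * x) * Real.exp (-(b * x ^ 2)) =
        (Real.pi / b) ^ (1 / 2 : ℝ) * Real.exp (-((Real.pi ^ 2 / b) * ξ ^ 2)) := by
      intro ξ
      rw [integral_cos_mul_exp hb]
      congr 2
      field_simp
      ring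
    have hgi : Integrable fun ξ : ℝ => (Real.pi / b) ^ (1 / 2 : ℝ) *
        Real.exp (-((Real.pi ^ 2 / b) * ξ ^ 2)) :=
      (integrable_gauss (by positivity)).const_mul _
    simp only [h2]
    have h3 : ∫ ξ : ℝ, (Real.pi / b) ^ (1 / 2 : ℝ) * Real.exp (-((Real.pi ^ 2 / b) * ξ ^ 2)) = 1 := by
      rw [integral_const_mul]
      have := integral_gaussian (Real.pi ^ 2 / b)
      simp only [neg_mul] at this
      rw [this, ← Real.sqrt_eq_rpow, ← Real.sqrt_mul (by positivity)]
      rw [Real.sqrt_eq_one]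
      field_simp
    calc _ ≤ ∫ ξ, ((Real.pi / b) ^ (1 / 2 : ℝ) * Real.exp (-((Real.pi ^ 2 / b) * ξ ^ 2))) * M := by
          refine integral_mono (hf.bdd_mul (c := (Real.pi / b) ^ (1 / 2 : ℝ))
            (by fun_prop : Continuous _).aestronglyMeasurable (ae_of_all _ fun ξ => ?_))
            (hgi.mul_const _) fun ξ => ?_
          · rw [Real.norm_of_nonneg (by positivity)]
            refine mul_le_of_le_one_right (by positivity) (Real.exp_le_one_iff.2 ?_)
            have : 0 ≤ Real.pi ^ 2 / b * ξ ^ 2 := by positivity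
            linarith
          · exact mul_le_mul_of_nonneg_left ((le_abs_self _).trans (hM ξ)) (by positivity)
      _ = M := by rw [integral_mul_const, h3, one_mul]
  have hlim : ∀ x, Tendsto (fun n : ℕ => ENNReal.ofReal (F x *
      Real.exp (-((1 / ((n : ℝ) + 1)) * x ^ 2)))) atTop (𝓝 (ENNReal.ofReal (F x))) := by
    intro x
    refine (ENNReal.continuous_ofReal.tendsto _).comp ?_
    have h1 := (tendsto_one_div_add_atTop_nhds_zero_nat (𝕜 := ℝ)).mul_const (x ^ 2)
    have h2 := ((Real.continuous_exp.tendsto _).comp h1.neg).const_mul (F x)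
    simpa using h2
  calc ∫⁻ x, ENNReal.ofReal (F x) = ∫⁻ x, liminf (fun n : ℕ => ENNReal.ofReal (F x *
      Real.exp (-((1 / ((n : ℝ) + 1)) * x ^ 2)))) atTop :=
        lintegral_congr fun x => (hlim x).liminf_eq.symm
    _ ≤ liminf (fun n : ℕ => ∫⁻ x, ENNReal.ofReal (F x *
      Real.exp (-((1 / ((n : ℝ) + 1)) * x ^ 2)))) atTop :=
        lintegral_liminf_le fun n => (hFm.mul (by fun_prop)).ennreal_ofReal
    _ ≤ ENNReal.ofReal M := by
        refine liminf_le_of_le (by isBoundedDefault) fun c hc => ?_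
        obtain ⟨n, hn⟩ := hc.exists
        exact hn.trans (key _ (by positivity))

end

end NonlocalDiffusion

/-! ### The fundamental solution and its second moment -/

namespace NonlocalDiffusion

noncomputable section

/-- The inverse Fourier transform of the relaxation function. -/
def kern (ρ : ℝ → ℝ) (x t : ℝ) : ℝ :=
  ∫ ξ, Real.cos (2 * Real.pi * x * ξ) * relaxation ρ (symb ξ) t

/-- Half of the second moment of `kern`. -/
def halfMoment (ρ : ℝ → ℝ) (t : ℝ) : ℝ :=
  if 0 < t then (∫ x, x ^ 2 * kern ρ x t) / 2 else 0

lemma halfMoment_of_nonpos (ρ : ℝ → ℝ) {t : ℝ} (ht : t ≤ 0) : halfMoment ρ t = 0 :=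
  if_neg ht.not_gt

lemma symb_neg (ξ : ℝ) : symb (-ξ) = symb ξ := by unfold symb; ring

section

variable {δ : ℝ} {ρ : ℝ → ℝ} (h : IsKernel δ ρ)

include h

lemma relaxation_symb_le {ξ t : ℝ} (ht : 0 < t) :
    relaxation ρ (symb ξ) t ≤ (1 + 1 / t) * (1 + ξ ^ 2)⁻¹ := by
  rw [← div_eq_mul_inv, le_div_iff₀ (by positivity), mul_add, mul_one]
  have h1 := relaxation_le_div h (symb_nonneg ξ) ht
  have h0 := relaxation_mem_Icc h (symb_nonneg ξ) t
  refine add_le_add h0.2 ?_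
  rw [le_div_iff₀ ht]
  calc relaxation ρ (symb ξ) t * ξ ^ 2 * t = ξ ^ 2 * (t * relaxation ρ (symb ξ) t) := by ring
    _ ≤ symb ξ * (t * relaxation ρ (symb ξ) t) :=
      mul_le_mul_of_nonneg_right (sq_le_symb ξ) (mul_nonneg ht.le h0.1)
    _ ≤ 1 := by rwa [← mul_assoc]

lemma continuous_relaxation_symb (t : ℝ) : Continuous fun ξ => relaxation ρ (symb ξ) t :=
  (continuousOn_relaxation_param h t).comp_continuous continuous_symb symb_nonneg

lemma integrable_relaxation_symb {t : ℝ} (ht : 0 < t) :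
    Integrable fun ξ => relaxation ρ (symb ξ) t :=
  (integrable_inv_one_add_sq.const_mul (1 + 1 / t)).mono'
    (continuous_relaxation_symb h t).aestronglyMeasurable (ae_of_all _ fun ξ => by
      rw [Real.norm_of_nonneg (relaxation_mem_Icc h (symb_nonneg ξ) t).1]
      exact relaxation_symb_le h ht)

lemma kern_nonneg (x : ℝ) {t : ℝ} (ht : 0 < t) : 0 ≤ kern ρ x t := by
  have h1 : Tendsto (fun n => ∫ ξ : ℝ, Real.cos (2 * Real.pi * x * ξ) *
      relax (kap ρ n) (symb ξ) t) atTop (𝓝 (kern ρ x t)) := by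
    have hm : ∀ n, Measurable fun ξ => relax (kap ρ n) (symb ξ) t := fun n =>
      (measurable_relax_uncurry (measurable_kap h n)).comp
        (f := fun ξ => (symb ξ, t)) (continuous_symb.measurable.prodMk measurable_const)
    refine tendsto_integral_of_dominated_convergence (fun ξ => relaxation ρ (symb ξ) t)
      (fun n => (Measurable.mul (by fun_prop) (hm n)).aestronglyMeasurable)
      (integrable_relaxation_symb h ht) (fun n => ae_of_all _ fun ξ => ?_)
      (ae_of_all _ fun ξ => (tendsto_relax h (symb_nonneg ξ) t).const_mul _)
    have h0 := (relax_mem_Icc (isJumpKernel_kap h n) (symb_nonneg ξ) t).1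
    rw [norm_mul, Real.norm_of_nonneg h0]
    exact (mul_le_of_le_one_left h0 (Real.abs_cos_le_one _)).trans
      (relax_le_relaxation h (symb_nonneg ξ) n t)
  exact ge_of_tendsto' h1 fun n => integral_cos_mul_relax_nonneg (isJumpKernel_kap h n) x ht

lemma continuousOn_kern : ContinuousOn (fun p : ℝ × ℝ => kern ρ p.1 p.2) {p | 0 < p.2} := by
  intro p hp
  have hp' : 0 < p.2 := hp
  refine ContinuousAt.continuousWithinAt ?_
  have hnhds : ∀ᶠ q : ℝ × ℝ in 𝓝 p, p.2 / 2 < q.2 :=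
    continuous_snd.continuousAt.eventually (lt_mem_nhds (half_lt_self hp'))
  refine continuousAt_of_dominated (bound := fun ξ => (1 + 1 / (p.2 / 2)) * (1 + ξ ^ 2)⁻¹)
    (Eventually.of_forall fun q => (Continuous.mul (by fun_prop)
      (continuous_relaxation_symb h q.2)).aestronglyMeasurable) ?_
    (integrable_inv_one_add_sq.const_mul _) (ae_of_all _ fun ξ => ?_)
  · filter_upwards [hnhds] with q hq
    refine ae_of_all _ fun ξ => ?_
    have h0 := relaxation_mem_Icc h (symb_nonneg ξ) q.2
    rw [norm_mul, Real.norm_of_nonneg h0.1]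
    refine (mul_le_of_le_one_left h0.1 (Real.abs_cos_le_one _)).trans ?_
    exact (antitone_relaxation h (symb_nonneg ξ) hq.le).trans
      (relaxation_symb_le h (half_pos hp'))
  · refine ContinuousAt.mul (by fun_prop) ?_
    exact ((continuousOn_relaxation h (symb_nonneg ξ)).continuousAt (Ioi_mem_nhds hp')).comp
      continuous_snd.continuousAt

lemma continuous_kern {t : ℝ} (ht : 0 < t) : Continuous fun x => kern ρ x t :=
  (continuousOn_kern h).comp_continuous (f := fun x : ℝ => (x, t)) (by fun_prop) fun _ => ht

lemma lintegral_kern_le {t : ℝ} (ht : 0 < t) : ∫⁻ x, ENNReal.ofReal (kern ρ x t) ≤ 1 := by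
  rw [← ENNReal.ofReal_one]
  exact lintegral_cosine_transform_le (integrable_relaxation_symb h ht) (M := 1)
    (fun ξ => abs_relaxation_le h (symb_nonneg ξ) t) (fun x => rfl)
    (fun x => kern_nonneg h x ht) (continuous_kern h ht).measurable

lemma integrable_kern {t : ℝ} (ht : 0 < t) : Integrable fun x => kern ρ x t :=
  (lintegral_ofReal_ne_top_iff_integrable (continuous_kern h ht).aestronglyMeasurable
    (ae_of_all _ fun x => kern_nonneg h x ht)).1
    (ne_top_of_le_ne_top ENNReal.one_ne_top (lintegral_kern_le h ht))

lemma integral_cos_mul_kern {t : ℝ} (ht : 0 < t) (ξ : ℝ) :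
    ∫ x, Real.cos (2 * Real.pi * ξ * x) * kern ρ x t = relaxation ρ (symb ξ) t :=
  cosine_inversion (f := fun ξ => relaxation ρ (symb ξ) t) (integrable_relaxation_symb h ht)
    (continuous_relaxation_symb h t) (fun ξ => by rw [symb_neg]) (fun x => rfl)
    (integrable_kern h ht) ξ

lemma integral_kern {t : ℝ} (ht : 0 < t) : ∫ x, kern ρ x t = 1 := by
  have := integral_cos_mul_kern h ht 0
  simpa [symb, relaxation_zero h] using this

lemma integral_abs_kern {t : ℝ} (ht : 0 < t) : ∫ x, |kern ρ x t| = 1 := by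
  simp only [abs_of_nonneg (kern_nonneg h _ ht)]
  exact integral_kern h ht

/-- From `1 - cos 2θ = 2 sin² θ`: the difference quotient of the transform at frequency zero is the
integral of `kern` against a nonnegative approximation of `x²`. -/
lemma integral_sin_sq_mul_kern {t : ℝ} (ht : 0 < t) {ξ : ℝ} (hξ : 0 < ξ) :
    Integrable (fun x => (Real.sin (Real.pi * x * ξ) / (Real.pi * ξ)) ^ 2 * kern ρ x t) ∧
    ∫ x, (Real.sin (Real.pi * x * ξ) / (Real.pi * ξ)) ^ 2 * kern ρ x t =
      2 * ((1 - relaxation ρ (symb ξ) t) / symb ξ) := by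
  have hs : symb ξ ≠ 0 := by
    have := Real.pi_pos
    unfold symb
    positivity
  have e : ∀ x, (Real.sin (Real.pi * x * ξ) / (Real.pi * ξ)) ^ 2 * kern ρ x t =
      2 / symb ξ * (kern ρ x t - Real.cos (2 * Real.pi * ξ * x) * kern ρ x t) := by
    intro x
    have h1 := Real.cos_two_mul (Real.pi * x * ξ)
    have h2 := Real.sin_sq_add_cos_sq (Real.pi * x * ξ)
    rw [show 2 * Real.pi * ξ * x = 2 * (Real.pi * x * ξ) by ring, h1,
      div_pow, show Real.sin (Real.pi * x * ξ) ^ 2 = 1 - Real.cos (Real.pi * x * ξ) ^ 2 by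
        linarith]
    unfold symb
    have := Real.pi_pos
    field_simp
    ring
  have hi := integrable_kern h ht
  have hc := integrable_cos_mul' hi (2 * Real.pi * ξ)
  simp only [e]
  refine ⟨(hi.sub hc).const_mul _, ?_⟩
  rw [integral_const_mul, integral_sub hi hc, integral_kern h ht, integral_cos_mul_kern h ht]
  ring

lemma exists_relaxation_quotient_le : ∃ C > 0, ∀ l t : ℝ, 0 < l → 0 < t →
    (1 - relaxation ρ l t) / l ≤ C * (t + δ) := by
  obtain ⟨C, hC, hL⟩ := exists_relaxation_lipschitz h
  refine ⟨C, hC, fun l t hl ht => ?_⟩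
  have := hL l 0 t le_rfl hl.le ht
  rw [relaxation_zero h] at this
  rw [div_le_iff₀ hl]
  linarith

omit h in
lemma tendsto_sin_quotient (x : ℝ) {ξ : ℕ → ℝ} (hξ : ∀ i, 0 < ξ i)
    (hlim : Tendsto ξ atTop (𝓝 0)) :
    Tendsto (fun i => (Real.sin (Real.pi * x * ξ i) / (Real.pi * ξ i)) ^ 2) atTop
      (𝓝 (x ^ 2)) := by
  have h1 : HasDerivAt (fun y : ℝ => Real.sin (Real.pi * x * y)) (Real.pi * x) 0 := by
    have := ((hasDerivAt_id (0 : ℝ)).const_mul (Real.pi * x)).sin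
    simpa using this
  have h2 := h1.tendsto_slope_zero
  have h3 : Tendsto ξ atTop (𝓝[≠] 0) :=
    tendsto_nhdsWithin_iff.2 ⟨hlim, Eventually.of_forall fun i => (hξ i).ne'⟩
  have h4 := ((h2.comp h3).div_const Real.pi).pow 2
  have hπ := Real.pi_ne_zero
  rw [mul_div_cancel_left₀ _ hπ] at h4
  refine h4.congr fun i => ?_
  simp only [Function.comp_apply, zero_add, mul_zero, Real.sin_zero, sub_zero, smul_eq_mul]
  have := (hξ i).ne'
  field_simp

/-- Fatou as the frequency tends to zero: the approximate second moments are bounded uniformly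
because the relaxation function is Lipschitz in the rate. -/
lemma integrable_sq_mul_kern {t : ℝ} (ht : 0 < t) : Integrable fun x => x ^ 2 * kern ρ x t := by
  obtain ⟨C, hC, hq⟩ := exists_relaxation_quotient_le h
  have hm : Measurable fun x => x ^ 2 * kern ρ x t :=
    Measurable.mul (by fun_prop) (continuous_kern h ht).measurable
  have h0 : ∀ x, 0 ≤ x ^ 2 * kern ρ x t := fun x => mul_nonneg (sq_nonneg x) (kern_nonneg h x ht)
  set ξ : ℕ → ℝ := fun i => 1 / ((i : ℝ) + 1) with hξdef
  have hξ : ∀ i, 0 < ξ i := fun i => by positivity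
  have hlim : Tendsto ξ atTop (𝓝 0) := tendsto_one_div_add_atTop_nhds_zero_nat
  have hsp : ∀ i, 0 < symb (ξ i) := fun i => by
    have := Real.pi_pos
    have := hξ i
    unfold symb
    positivity
  refine (lintegral_ofReal_ne_top_iff_integrable hm.aestronglyMeasurable (ae_of_all _ h0)).1
    (ne_top_of_le_ne_top (b := ENNReal.ofReal (2 * (C * (t + δ)))) ENNReal.ofReal_ne_top ?_)
  have hF : ∀ x, Tendsto (fun i => ENNReal.ofReal
      ((Real.sin (Real.pi * x * ξ i) / (Real.pi * ξ i)) ^ 2 * kern ρ x t)) atTop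
      (𝓝 (ENNReal.ofReal (x ^ 2 * kern ρ x t))) := fun x =>
    (ENNReal.continuous_ofReal.tendsto _).comp ((tendsto_sin_quotient x hξ hlim).mul_const _)
  calc ∫⁻ x, ENNReal.ofReal (x ^ 2 * kern ρ x t) = ∫⁻ x, liminf (fun i => ENNReal.ofReal
      ((Real.sin (Real.pi * x * ξ i) / (Real.pi * ξ i)) ^ 2 * kern ρ x t)) atTop :=
        lintegral_congr fun x => (hF x).liminf_eq.symm
    _ ≤ liminf (fun i => ∫⁻ x, ENNReal.ofReal
      ((Real.sin (Real.pi * x * ξ i) / (Real.pi * ξ i)) ^ 2 * kern ρ x t)) atTop :=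
        lintegral_liminf_le fun i => (Measurable.mul (by fun_prop)
          (continuous_kern h ht).measurable).ennreal_ofReal
    _ ≤ ENNReal.ofReal (2 * (C * (t + δ))) := by
        refine liminf_le_of_le (by isBoundedDefault) fun c hc => ?_
        obtain ⟨i, hi⟩ := hc.exists
        refine hi.trans ?_
        obtain ⟨h1, h2⟩ := integral_sin_sq_mul_kern h ht (hξ i)
        rw [← ofReal_integral_eq_lintegral_ofReal h1 (ae_of_all _ fun x =>
          mul_nonneg (sq_nonneg _) (kern_nonneg h x ht)), h2]
        exact ENNReal.ofReal_le_ofReal (mul_le_mul_of_nonneg_left (hq _ _ (hsp i) ht) two_pos.le)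

/-- The half second moment is the derivative of the relaxation function at frequency zero. -/
lemma exists_tendsto_halfMoment : ∃ l : ℕ → ℝ, (∀ i, 0 < l i) ∧ Tendsto l atTop (𝓝 0) ∧
    ∀ t, Tendsto (fun i => (1 - relaxation ρ (l i) t) / l i) atTop (𝓝 (halfMoment ρ t)) := by
  set ξ : ℕ → ℝ := fun i => 1 / ((i : ℝ) + 1) with hξdef
  have hξ : ∀ i, 0 < ξ i := fun i => by positivity
  have hlim : Tendsto ξ atTop (𝓝 0) := tendsto_one_div_add_atTop_nhds_zero_nat
  have hsp : ∀ i, 0 < symb (ξ i) := fun i => by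
    have := Real.pi_pos
    have := hξ i
    unfold symb
    positivity
  refine ⟨fun i => symb (ξ i), hsp, ?_, fun t => ?_⟩
  · have := (continuous_symb.tendsto 0).comp hlim
    simpa [symb, Function.comp_def] using this
  · rcases le_or_gt t 0 with ht | ht
    · simp [halfMoment_of_nonpos _ ht, relaxation_of_nonpos _ ht]
    -- Finiteness of the second moment is now known, so `|sin θ| ≤ |θ|` provides the integrable
    -- majorant `x² kern`.
    · have h1 : Tendsto (fun i => ∫ x, (Real.sin (Real.pi * x * ξ i) / (Real.pi * ξ i)) ^ 2 *
          kern ρ x t) atTop (𝓝 (∫ x, x ^ 2 * kern ρ x t)) := by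
        refine tendsto_integral_of_dominated_convergence (fun x => x ^ 2 * kern ρ x t)
          (fun i => (integral_sin_sq_mul_kern h ht (hξ i)).1.aestronglyMeasurable)
          (integrable_sq_mul_kern h ht) (fun i => ae_of_all _ fun x => ?_)
          (ae_of_all _ fun x => (tendsto_sin_quotient x hξ hlim).mul_const _)
        rw [Real.norm_of_nonneg (mul_nonneg (sq_nonneg _) (kern_nonneg h x ht))]
        refine mul_le_mul_of_nonneg_right ?_ (kern_nonneg h x ht)
        rw [sq_le_sq, abs_div, div_le_iff₀ (abs_pos.2 (by have := hξ i; positivity))]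
        refine Real.abs_sin_le_abs.trans (le_of_eq ?_)
        rw [← abs_mul]
        congr 1
        ring
      have h2 := h1.div_const 2
      rw [halfMoment, if_pos ht]
      refine h2.congr fun i => ?_
      rw [(integral_sin_sq_mul_kern h ht (hξ i)).2]
      ring

lemma monotone_halfMoment : Monotone (halfMoment ρ) := by
  obtain ⟨l, hl, -, hV⟩ := exists_tendsto_halfMoment h
  intro t u htu
  refine le_of_tendsto_of_tendsto' (hV t) (hV u) fun i => ?_
  exact div_le_div_of_nonneg_right
    (sub_le_sub_left (antitone_relaxation h (hl i).le htu) 1) (hl i).le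

lemma halfMoment_nonneg (t : ℝ) : 0 ≤ halfMoment ρ t := by
  obtain ⟨l, hl, -, hV⟩ := exists_tendsto_halfMoment h
  refine ge_of_tendsto' (hV t) fun i => div_nonneg ?_ (hl i).le
  exact sub_nonneg.2 (relaxation_mem_Icc h (hl i).le t).2

lemma tendsto_relaxation_one {l : ℕ → ℝ} (hl : ∀ i, 0 < l i) (hlim : Tendsto l atTop (𝓝 0))
    (t : ℝ) : Tendsto (fun i => relaxation ρ (l i) t) atTop (𝓝 1) := by
  have h1 := (continuousOn_relaxation_param h t 0 (mem_Ici.2 le_rfl)).tendsto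
  rw [relaxation_zero h] at h1
  exact h1.comp (tendsto_nhdsWithin_iff.2 ⟨hlim, Eventually.of_forall fun i => (hl i).le⟩)

lemma cv_tail_quotient {l : ℝ} (hl : 0 < l) (t : ℝ) :
    cv (tail (jump ρ)) (wd (cut fun r => (1 - relaxation ρ l r) / l)) t =
      cv unitStep (wd (cut (relaxation ρ l))) t := by
  have hE : Measurable (cut fun r => 1 - relaxation ρ l r) :=
    measurable_cut ((measurable_relaxation h l).const_sub 1)
  have hq : Measurable (cut fun r => (1 - relaxation ρ l r) / l) :=
    measurable_cut (((measurable_relaxation h l).const_sub 1).div_const l)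
  have h1 := relaxation_compl_convolution h hl.le t
  have h2 : (cut fun r => 1 - relaxation ρ l r) =
      fun r => ENNReal.ofReal l * cut (fun r => (1 - relaxation ρ l r) / l) r := by
    funext r
    rcases le_or_gt r 0 with hr | hr
    · simp [cut_of_nonpos _ hr]
    · rw [cut_of_pos _ hr, cut_of_pos _ hr, ← ENNReal.ofReal_mul hl.le, mul_div_cancel₀ _ hl.ne']
  rw [cv_swap (measurable_tail _) hE, h2, cv_const_mul hq, ← cv_swap (measurable_tail _) hq] at h1
  exact (ENNReal.mul_right_inj (by simpa using hl) ENNReal.ofReal_ne_top).1 h1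

/-- Divide the relaxation identity by the rate and let the rate tend to zero: the quotients tend to
the half moment and `W` tends to one. The Lipschitz bound dominates the quotients, and the tail has
mass one. -/
lemma halfMoment_convolution (t : ℝ) :
    cv (tail (jump ρ)) (wd (cut (halfMoment ρ))) t = ENNReal.ofReal t := by
  obtain ⟨l, hl, hlim, hV⟩ := exists_tendsto_halfMoment h
  obtain ⟨C, hC, hq⟩ := exists_relaxation_quotient_le h
  have hδ := h.delta_pos
  have hqm : ∀ i, Measurable (cut fun r => (1 - relaxation ρ (l i) r) / l i) := fun i =>
    measurable_cut (((measurable_relaxation h _).const_sub 1).div_const _)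
  have hTm : Measurable fun r => tail (jump ρ) (t - r) := (measurable_tail _).comp (by fun_prop)
  have h1 : Tendsto (fun i => cv (tail (jump ρ))
      (wd (cut fun r => (1 - relaxation ρ (l i) r) / l i)) t) atTop
      (𝓝 (cv (tail (jump ρ)) (wd (cut (halfMoment ρ))) t)) := by
    simp only [cv_wd (measurable_tail _) (hqm _),
      cv_wd (measurable_tail _) (measurable_cut (monotone_halfMoment h).measurable)]
    refine tendsto_lintegral_of_dominated_convergence
      (fun r => ENNReal.ofReal (C * (t + δ)) * tail (jump ρ) (t - r))
      (fun i => (hqm i).mul hTm) (fun i => ae_of_all _ fun r => ?_) ?_ (ae_of_all _ fun r => ?_)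
    · rcases le_or_gt r 0 with hr | hr
      · simp [cut_of_nonpos _ hr]
      rcases le_or_gt t r with htr | htr
      · simp [tail_of_nonpos _ (sub_nonpos.2 htr)]
      · simp only
        rw [cut_of_pos _ hr]
        refine mul_le_mul' (ENNReal.ofReal_le_ofReal ((hq _ _ (hl i) hr).trans ?_)) le_rfl
        exact mul_le_mul_of_nonneg_left (by linarith) hC.le
    · rw [lintegral_const_mul _ hTm, lintegral_sub_left_eq_self (fun r => tail (jump ρ) r),
        lintegral_tail h, mul_one]
      exact ENNReal.ofReal_ne_top
    · refine ENNReal.Tendsto.mul_const ?_ (Or.inr (tail_jump_ne_top h _))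
      rcases le_or_gt r 0 with hr | hr
      · simp [cut_of_nonpos _ hr]
      · simp only [cut_of_pos _ hr]
        exact (ENNReal.continuous_ofReal.tendsto _).comp (hV r)
  have h2 : Tendsto (fun i => cv unitStep (wd (cut (relaxation ρ (l i)))) t) atTop
      (𝓝 (cv unitStep (wd unitStep) t)) := by
    simp only [cv_unitStep_wd]
    refine tendsto_lintegral_of_dominated_convergence unitStep
      (fun i => measurable_cut (measurable_relaxation h _)) (fun i => ae_of_all _
        (cut_le_one fun t => (relaxation_mem_Icc h (hl i).le t).2)) ?_ (ae_of_all _ fun r => ?_)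
    · rw [← cv_unitStep_wd, cv_unitStep_unitStep]
      exact ENNReal.ofReal_ne_top
    · rcases le_or_gt r 0 with hr | hr
      · simp [cut_of_nonpos _ hr, unitStep_of_nonpos hr]
      · simp only [cut_of_pos _ hr, unitStep_of_pos hr]
        rw [← ENNReal.ofReal_one]
        exact (ENNReal.continuous_ofReal.tendsto _).comp
          (tendsto_relaxation_one h hl hlim r)
  rw [cv_unitStep_unitStep] at h2
  exact tendsto_nhds_unique h1 (h2.congr fun i => (cv_tail_quotient h (hl i) t).symm)

/-- `t` is an average of the values `V(t - r)`, `r > 0`, against the probability density `T`, and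
`V` increases. -/
lemma le_halfMoment (t : ℝ) : t ≤ halfMoment ρ t := by
  have h1 := halfMoment_convolution h t
  have hVm := measurable_cut (monotone_halfMoment h).measurable
  rw [cv_swap (measurable_tail _) hVm, cv_wd hVm (measurable_tail _)] at h1
  have h2 : ENNReal.ofReal t ≤ ENNReal.ofReal (halfMoment ρ t) := by
    rw [← h1]
    calc _ ≤ ∫⁻ r, tail (jump ρ) r * ENNReal.ofReal (halfMoment ρ t) := by
          refine lintegral_mono fun r => ?_
          rcases le_or_gt r 0 with hr | hr
          · simp [tail_of_nonpos _ hr]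
          · refine mul_le_mul' le_rfl ((Set.indicator_le_self' (by simp) _).trans ?_)
            exact ENNReal.ofReal_le_ofReal (monotone_halfMoment h (by linarith))
      _ = _ := by rw [lintegral_mul_const _ (measurable_tail _), lintegral_tail h, one_mul]
  exact (ENNReal.ofReal_le_ofReal_iff (halfMoment_nonneg h t)).1 h2

lemma tail_eq_zero {r : ℝ} (hr : δ ≤ r) : tail (jump ρ) r = 0 := by
  have := h.delta_pos
  rw [tail_of_pos _ (by linarith), setLIntegral_congr_fun (g := fun _ => 0) measurableSet_Ioi]
  · simp
  · intro s hs
    simp only [mem_Ioi] at hs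
    simp [jump, h.eq_zero s (by simp; intro; linarith)]

/-- The same average taken at time `t + δ`: the tail lives on `(0, δ)`, so all values of `V`
entering it are at least `V(t)`. -/
lemma halfMoment_le {t : ℝ} (ht : 0 < t) : halfMoment ρ t ≤ t + δ := by
  have hδ := h.delta_pos
  have h1 := halfMoment_convolution h (t + δ)
  have hVm := measurable_cut (monotone_halfMoment h).measurable
  rw [cv_swap (measurable_tail _) hVm, cv_wd hVm (measurable_tail _)] at h1
  have h2 : ENNReal.ofReal (halfMoment ρ t) ≤ ENNReal.ofReal (t + δ) := by
    rw [← h1]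
    calc _ = ∫⁻ r, tail (jump ρ) r * ENNReal.ofReal (halfMoment ρ t) := by
          rw [lintegral_mul_const _ (measurable_tail _), lintegral_tail h, one_mul]
      _ ≤ _ := by
          refine lintegral_mono fun r => ?_
          rcases le_or_gt δ r with hr | hr
          · simp [tail_eq_zero h hr]
          · refine mul_le_mul' le_rfl ?_
            rw [cut_of_pos _ (by linarith)]
            exact ENNReal.ofReal_le_ofReal (monotone_halfMoment h (by linarith))
  exact (ENNReal.ofReal_le_ofReal_iff (by linarith)).1 h2

end

end

end NonlocalDiffusion

/-! ### Renewal theory: the moment equation at every positive time -/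

namespace NonlocalDiffusion

noncomputable section

lemma cv_add_measure (g : ℝ → ℝ≥0∞) (μ ν : Measure ℝ) (t : ℝ) :
    cv g (μ + ν) t = cv g μ t + cv g ν t := lintegral_add_measure _ _ _

lemma cv_restrict_add (g : ℝ → ℝ≥0∞) (μ : Measure ℝ) (s t : ℝ) :
    cv g μ t = cv g (μ.restrict (Iic s)) t + cv g (μ.restrict (Ioi s)) t := by
  rw [← cv_add_measure, ← compl_Iic, Measure.restrict_add_restrict_compl measurableSet_Iic]

lemma cv_restrict_Iic_eq {g : ℝ → ℝ≥0∞} (hg : ∀ r ≤ 0, g r = 0) (μ : Measure ℝ) {s t : ℝ}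
    (hts : t ≤ s) : cv g (μ.restrict (Iic s)) t = cv g μ t := by
  rw [cv_restrict_add g μ s t]
  have : cv g (μ.restrict (Ioi s)) t = 0 := by
    unfold cv
    rw [setLIntegral_congr_fun (g := fun _ => 0) measurableSet_Ioi]
    · simp
    · intro r hr
      simp only [mem_Ioi] at hr
      exact hg _ (by linarith)
  rw [this, add_zero]

lemma setLIntegral_shift (k : ℝ → ℝ≥0∞) (a b r : ℝ) :
    ∫⁻ y in Ioo a b, k (y - r) = ∫⁻ y in Ioo (a - r) (b - r), k y := by
  rw [← lintegral_indicator measurableSet_Ioo, ← lintegral_indicator measurableSet_Ioo,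
    ← lintegral_sub_right_eq_self ((Ioo (a - r) (b - r)).indicator fun y => k y) r]
  refine lintegral_congr fun y => ?_
  simp [Set.indicator]

lemma tail_add_setLIntegral (k : ℝ → ℝ≥0∞) {a b : ℝ} (ha : 0 < a) (hab : a < b) :
    tail k b + ∫⁻ y in Ioo a b, k y = tail k a := by
  rw [tail_of_pos _ ha, tail_of_pos _ (ha.trans hab), add_comm,
    setLIntegral_congr Ioo_ae_eq_Ioc, ← lintegral_union measurableSet_Ioi, Ioc_union_Ioi_eq_Ioi hab.le]
  rw [Set.disjoint_left]
  intro x hx hx'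
  exact absurd hx.2 (not_le.2 hx')

/-- Regeneration at a level that is almost surely jumped over. -/
lemma cv_tail_eq_one {k : ℝ → ℝ≥0∞} (hk : Measurable k) (U : Measure ℝ) [SFinite U] [NullSingletonClass U]
    (hfin : ∀ t, cv unitStep (wd (cv unitStep U)) t < ⊤) (hfin' : ∀ t, cv unitStep U t < ⊤)
    (hQ : cv (tail k) U =ᵐ[volume] unitStep) {t : ℝ} (ht : 0 < t) : cv (tail k) U t = 1 := by
  have hT := measurable_tail k
  have hd : Dense {s | cv (tail k) U s = unitStep s} := Measure.dense_of_ae hQ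
  -- The identity holds almost everywhere, so there is a good level `s` before `t`; the part of `U`
  -- beyond `s` is reconstructed from it.
  obtain ⟨s, hs, hst⟩ := hd.inter_open_nonempty (Ioo 0 t) isOpen_Ioo (nonempty_Ioo.2 ht)
  replace hst : cv (tail k) U s = unitStep s := hst
  rw [unitStep_of_pos hs.1] at hst
  set U1 := U.restrict (Iic s) with hU1
  set U2 := U.restrict (Ioi s) with hU2
  -- In renewal terms, `f` is the density of the first point beyond the level `s`.
  set f : ℝ → ℝ≥0∞ := (Ioi s).indicator (cv k U1) with hf
  have hfm : Measurable f := (measurable_cv hk U1).indicator measurableSet_Ioi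
  have hsU1 : ∀ᵐ r ∂U1, r < s := by
    rw [hU1, ae_restrict_iff' measurableSet_Iic]
    filter_upwards [Measure.ae_ne U s] with r hr hrs
    exact lt_of_le_of_ne hrs hr
  -- Conservation of mass: `T(z - r) + ∫_s^z k(y - r) dy = T(s - r)` for `r < s`, integrated over
  -- `U1`. Since `U` has no atom at `s`, the right side integrates to the value one at the good
  -- level.
  have hd1 : ∀ z, s < z → cv (tail k) U1 z + cv unitStep (wd f) z = 1 := by
    intro z hz
    rw [← hst, ← cv_restrict_Iic_eq (fun r hr => tail_of_nonpos k hr) U le_rfl, cv_unitStep_wd,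
      hf, setLIntegral_indicator measurableSet_Ioi, Ioi_inter_Iio]
    have h1 : ∫⁻ y in Ioo s z, cv k U1 y = ∫⁻ r, (∫⁻ y in Ioo s z, k (y - r)) ∂U1 := by
      unfold cv
      rw [lintegral_lintegral_swap]
      exact (hk.comp (by fun_prop : Measurable fun p : ℝ × ℝ => p.1 - p.2)).aemeasurable
    rw [h1]
    unfold cv
    have hTz : Measurable fun r => tail k (z - r) := hT.comp (by fun_prop)
    rw [← lintegral_add_left hTz]
    refine lintegral_congr_ae ?_
    filter_upwards [hsU1] with r hr
    rw [setLIntegral_shift, tail_add_setLIntegral k (by linarith) (by linarith)]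
  have hQs : ∀ z, cv (tail k) U z = cv (tail k) U1 z + cv (tail k) U2 z := cv_restrict_add _ _ _
  have he : ∀ᵐ z, cv (tail k) U2 z = cv unitStep (wd f) z := by
    filter_upwards [hQ, Measure.ae_ne volume s] with z hz hzs
    have hle : cv (tail k) U1 z ≠ ⊤ := by
      refine ne_top_of_le_ne_top (b := 1) ENNReal.one_ne_top ?_
      refine (le_add_right le_rfl).trans ((hQs z).ge.trans ?_)
      rw [hz]
      exact Set.indicator_le_self' (by simp) z
    rcases lt_or_gt_of_ne hzs with hlt | hlt
    · have h1 : cv unitStep (wd f) z = 0 := by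
        rw [cv_unitStep_wd, hf, setLIntegral_indicator measurableSet_Ioi, Ioi_inter_Iio,
          Ioo_eq_empty (by linarith)]
        simp
      rw [h1]
      have h2 := hQs z
      rw [cv_restrict_Iic_eq (fun r hr => tail_of_nonpos k hr) U hlt.le] at h2
      rw [cv_restrict_Iic_eq (fun r hr => tail_of_nonpos k hr) U hlt.le] at hle
      exact (ENNReal.add_right_inj hle).1 (by rw [add_zero]; exact h2.symm)
    · have h1 := hd1 z hlt
      rw [← unitStep_of_pos (hs.1.trans hlt), ← hz, hQs z] at h1
      exact ((ENNReal.add_right_inj hle).1 h1).symm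
  -- Restarting the renewal process at the overshoot gives the candidate density of `U2`: `T * g`
  -- equals `1 * f` everywhere, whereas `T * U2 = 1 * f` is so far known only almost everywhere.
  set g := cv f U with hg
  have hgm : Measurable g := measurable_cv hfm U
  have hgc : cv (tail k) (wd g) = cv unitStep (wd f) := by
    rw [← cv_congr_ae hQ f, cv_comm hT, cv_swap hT hfm, cv_comm hfm, ← cv_swap hT hgm]
  -- Convolution with `1 * U` inverts convolution with the tail up to two integrations, so `T * μ`
  -- determines `μ` even when known only almost everywhere.
  have hV : ∀ (μ : Measure ℝ) [SFinite μ], cv (cv (tail k) μ) (wd (cv unitStep U)) =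
      cv unitStep (wd (cv unitStep μ)) := by
    intro μ _
    have h1 : cv (tail k) (wd (cv unitStep U)) = cv unitStep (wd unitStep) := by
      rw [cv_swap hT (measurable_cv measurable_unitStep U), cv_comm measurable_unitStep,
        cv_swap measurable_unitStep hT, cv_comm hT, cv_congr_ae hQ]
    rw [cv_comm hT, h1, cv_comm measurable_unitStep,
      cv_swap (measurable_cv measurable_unitStep μ) measurable_unitStep]
  -- This equality of measures replaces the almost everywhere identity for `T * U2` by one valid at
  -- each point, in particular at `t`.
  have hU2g : U2 = wd g := by
    have hmono : ∀ z, cv unitStep U2 z ≤ cv unitStep U z := fun z =>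
      lintegral_mono' Measure.restrict_le_self le_rfl
    refine measure_eq_of_cv_unitStep_ae ?_ fun z => (hmono z).trans_lt (hfin' z)
    refine ae_eq_of_cv_unitStep_ae (measurable_cv measurable_unitStep _)
      (measurable_cv measurable_unitStep _) (ae_of_all _ fun z => ?_) fun z => ?_
    · rw [← hV, ← hV]
      have : cv (tail k) U2 =ᵐ[volume] cv (tail k) (wd g) := by rw [hgc]; exact he
      rw [cv_congr_ae this]
    · refine lt_of_le_of_lt ?_ (hfin z)
      rw [cv_unitStep_wd, cv_unitStep_wd]
      exact lintegral_mono hmono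
  rw [hQs, hU2g, hgc]
  exact hd1 t hs.2

section

variable {δ : ℝ} {ρ : ℝ → ℝ} (h : IsKernel δ ρ)

include h

lemma continuous_halfMoment (hinf : ∫⁻ s, jump ρ s = ⊤) : Continuous (halfMoment ρ) := by
  refine continuous_of_convolution_lipschitz h hinf (monotone_halfMoment h)
    (fun t ht => halfMoment_of_nonpos ρ ht) (L := 1) (fun t => ?_) fun t u htu => ?_
  · rw [halfMoment_convolution h]
    exact ENNReal.ofReal_ne_top
  · rw [halfMoment_convolution h, halfMoment_convolution h, one_mul]
    refine le_trans (ENNReal.ofReal_le_ofReal ?_) (ENNReal.ofReal_add_le (p := t) (q := u - t))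
    linarith

/-- The renewal measure, with distribution function `halfMoment`. -/
lemma exists_renewal_measure (hinf : ∫⁻ s, jump ρ s = ⊤) : ∃ U : Measure ℝ, SFinite U ∧ NullSingletonClass U ∧
    (∀ a b, U (Ioc a b) = ENNReal.ofReal (halfMoment ρ b - halfMoment ρ a)) ∧
    cv unitStep U = cut (halfMoment ρ) ∧ cv (tail (jump ρ)) U =ᵐ[volume] unitStep ∧
    ∀ t, 0 < t → cv (tail (jump ρ)) U t = 1 := by
  have hc := continuous_halfMoment h hinf
  have hm := monotone_halfMoment h
  set F : StieltjesFunction ℝ := ⟨halfMoment ρ, hm, fun x => hc.continuousAt.continuousWithinAt⟩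
    with hF
  have hIoc : ∀ a b, F.measure (Ioc a b) = ENNReal.ofReal (halfMoment ρ b - halfMoment ρ a) :=
    fun a b => F.measure_Ioc a b
  have hna : NullSingletonClass F.measure := ⟨fun a => by
    rw [F.measure_singleton]
    have : Function.leftLim F a = F a := (hc.continuousAt.continuousWithinAt).leftLim_eq
    rw [this, sub_self, ENNReal.ofReal_zero]⟩
  have h1 : cv unitStep F.measure = cut (halfMoment ρ) := by
    funext t
    have hlim : Tendsto F atBot (𝓝 0) := by
      refine tendsto_const_nhds.congr' ?_
      filter_upwards [eventually_le_atBot 0] with t ht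
      exact (halfMoment_of_nonpos ρ ht).symm
    rw [cv_unitStep, measure_congr Iio_ae_eq_Iic, F.measure_Iic hlim, sub_zero]
    rcases le_or_gt t 0 with ht | ht
    · rw [cut_of_nonpos _ ht, show F t = 0 from halfMoment_of_nonpos ρ ht, ENNReal.ofReal_zero]
    · rw [cut_of_pos _ ht]
  have hT := measurable_tail (jump ρ)
  have hVm := measurable_cut hm.measurable
  have hV0 : ∀ t, cv unitStep F.measure t < ⊤ := by
    intro t
    rw [h1]
    exact (Set.indicator_le_self' (by simp) t).trans_lt ENNReal.ofReal_lt_top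
  -- `T * V = t` is the primitive of this relation, since `V` is the primitive of the measure.
  have hQ : cv (tail (jump ρ)) F.measure =ᵐ[volume] unitStep := by
    have h2 : ∀ t, cv unitStep (wd unitStep) t =
        cv unitStep (wd (cv (tail (jump ρ)) F.measure)) t := by
      intro t
      rw [cv_swap measurable_unitStep (measurable_cv hT _), cv_comm hT,
        cv_swap hT measurable_unitStep, cv_comm measurable_unitStep, h1, cv_swap hVm hT,
        halfMoment_convolution h, cv_unitStep_unitStep]
    refine (ae_eq_of_cv_unitStep_ae measurable_unitStep (measurable_cv hT _)
      (ae_of_all _ h2) fun t => ?_).symm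
    rw [cv_unitStep_unitStep]
    exact ENNReal.ofReal_lt_top
  refine ⟨F.measure, inferInstance, hna, hIoc, h1, hQ, fun t ht =>
    cv_tail_eq_one (measurable_jump h) F.measure (fun t => ?_) hV0 hQ ht⟩
  rw [h1]
  rw [cv_unitStep_wd]
  calc _ ≤ ∫⁻ r in Iio t, (Ioi (0 : ℝ)).indicator (fun _ => ENNReal.ofReal (halfMoment ρ t)) r := by
        refine setLIntegral_mono' measurableSet_Iio fun r hr => ?_
        refine Set.indicator_le_indicator ?_
        exact ENNReal.ofReal_le_ofReal (hm (le_of_lt hr))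
    _ < ⊤ := by
        rw [setLIntegral_indicator measurableSet_Ioi, setLIntegral_const, Ioi_inter_Iio]
        exact ENNReal.mul_lt_top ENNReal.ofReal_lt_top (by simp)

/-- The increment of `V` over a jump is the renewal mass of `(t - s, t]`; exchanging the integrals
turns the jump integral into `T * U` at `t`, which is one at every positive time. -/
lemma lintegral_jump_mul_increment_of_infinite (hinf : ∫⁻ s, jump ρ s = ⊤) {t : ℝ} (ht : 0 < t) :
    ∫⁻ s, jump ρ s * ENNReal.ofReal (halfMoment ρ t - halfMoment ρ (t - s)) = 1 := by
  obtain ⟨U, _, _, hIoc, -, -, hQ⟩ := exists_renewal_measure h hinf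
  rw [← hQ t ht]
  have hkm := measurable_jump h
  simp only [← hIoc]
  have h1 : ∀ s, jump ρ s * U (Ioc (t - s) t) =
      ∫⁻ r, (Ioc (t - s) t).indicator (fun _ => jump ρ s) r ∂U := by
    intro s
    rw [lintegral_indicator measurableSet_Ioc, setLIntegral_const]
  simp only [h1]
  rw [lintegral_lintegral_swap]
  · unfold cv
    refine lintegral_congr_ae ?_
    filter_upwards [Measure.ae_ne U t] with r hr
    rcases lt_or_gt_of_ne hr with hlt | hlt
    · rw [tail_of_pos _ (by linarith), ← lintegral_indicator measurableSet_Ioi]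
      refine lintegral_congr fun s => ?_
      by_cases hs : t - r < s
      · simp [Set.indicator, hs, hlt.le, show t - s < r by linarith]
      · simp [Set.indicator, hs, show ¬ t - s < r by linarith]
    · rw [tail_of_nonpos _ (by linarith)]
      simp [hlt.not_ge]
  · have : (Function.uncurry fun s r : ℝ => (Ioc (t - s) t).indicator (fun _ => jump ρ s) r) =
        {p : ℝ × ℝ | t - p.1 < p.2 ∧ p.2 ≤ t}.indicator fun p => jump ρ p.1 := by
      ext p
      simp [Function.uncurry, Set.indicator]
    rw [this]
    refine ((hkm.comp measurable_fst).indicator ?_).aemeasurable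
    exact (measurableSet_lt (by fun_prop) measurable_snd).inter
      (measurableSet_le measurable_snd measurable_const)

lemma increment_mem {t s : ℝ} (hs : 0 ≤ s) {l C : ℝ} (hl : 0 < l)
    (hC : (1 - relaxation ρ l t) / l ≤ C) :
    |(1 - relaxation ρ l t) / l - (1 - relaxation ρ l (t - s)) / l| ≤ C := by
  have h1 : 0 ≤ (1 - relaxation ρ l (t - s)) / l :=
    div_nonneg (sub_nonneg.2 (relaxation_mem_Icc h hl.le _).2) hl.le
  have h2 : (1 - relaxation ρ l (t - s)) / l ≤ (1 - relaxation ρ l t) / l :=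
    div_le_div_of_nonneg_right (sub_le_sub_left (antitone_relaxation h hl.le (by linarith)) 1) hl.le
  rw [abs_of_nonneg (by linarith)]
  linarith

/-- With finite jump mass `V` jumps at time zero, so the atomless renewal measure is not available.
The relaxation equation holds pointwise instead: divided by the rate `l` it says that the quotient
integral equals `W_l(t)`, which tends to one. -/
lemma integral_jump_mul_increment_of_finite (hk : Integrable fun s => ρ s / s) {t : ℝ}
    (ht : 0 < t) :
    ∫ s, ρ s / s * (halfMoment ρ t - halfMoment ρ (t - s)) = 1 := by
  obtain ⟨l, hl, hlim, hV⟩ := exists_tendsto_halfMoment h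
  obtain ⟨C, hC, hq⟩ := exists_relaxation_quotient_le h
  have h1 : Tendsto (fun i => ∫ s, ρ s / s * ((1 - relaxation ρ (l i) t) / l i -
      (1 - relaxation ρ (l i) (t - s)) / l i)) atTop
      (𝓝 (∫ s, ρ s / s * (halfMoment ρ t - halfMoment ρ (t - s)))) := by
    refine tendsto_integral_of_dominated_convergence (fun s => ρ s / s * (C * (t + δ)))
      (fun i => hk.aestronglyMeasurable.mul ?_) (hk.mul_const _)
      (fun i => ae_of_all _ fun s => ?_)
      (ae_of_all _ fun s => ((hV t).sub (hV (t - s))).const_mul _)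
    · have := measurable_relaxation h (l i)
      exact (by fun_prop : Measurable fun s => (1 - relaxation ρ (l i) t) / l i -
        (1 - relaxation ρ (l i) (t - s)) / l i).aestronglyMeasurable
    · rcases h.pos_or s with h0 | ⟨h0, -⟩
      · simp [h0]
      · rw [norm_mul, Real.norm_of_nonneg (div_self_nonneg h s)]
        exact mul_le_mul_of_nonneg_left (increment_mem h h0.le (hl i) (hq _ _ (hl i) ht))
          (div_self_nonneg h s)
  refine tendsto_nhds_unique h1 ((tendsto_relaxation_one h hl hlim t).congr fun i => ?_)
  have hli := (hl i).ne'
  have h2 := relaxation_eq_of_integrable h hk (hl i).le ht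
  have h3 : Integrable fun s => ρ s / s * relaxation ρ (l i) (t - s) :=
    hk.mul_bdd (c := 1) ((measurable_relaxation h (l i)).comp
      (by fun_prop : Measurable fun s : ℝ => t - s)).aestronglyMeasurable
      (ae_of_all _ fun s => abs_relaxation_le h (hl i).le _)
  have h4 : ∀ s, ρ s / s * ((1 - relaxation ρ (l i) t) / l i -
      (1 - relaxation ρ (l i) (t - s)) / l i) =
      (l i)⁻¹ * (ρ s / s * relaxation ρ (l i) (t - s) - ρ s / s * relaxation ρ (l i) t) := by
    intro s
    field_simp
    ring
  simp only [h4]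
  rw [integral_const_mul, integral_sub h3 (hk.mul_const _), ← h2, integral_mul_const]
  field_simp
  ring

lemma integral_jump_mul_increment {t : ℝ} (ht : 0 < t) :
    Integrable (fun s => ρ s / s * (halfMoment ρ t - halfMoment ρ (t - s))) ∧
    ∫ s, ρ s / s * (halfMoment ρ t - halfMoment ρ (t - s)) = 1 := by
  have hm : Measurable fun s => ρ s / s * (halfMoment ρ t - halfMoment ρ (t - s)) := by
    have h1 := h.measurable
    have h2 := (monotone_halfMoment h).measurable
    fun_prop
  have h0 : ∀ s, 0 ≤ ρ s / s * (halfMoment ρ t - halfMoment ρ (t - s)) := by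
    intro s
    rcases h.pos_or s with h0 | ⟨h0, -⟩
    · simp [h0]
    · exact mul_nonneg (div_self_nonneg h s)
        (sub_nonneg.2 (monotone_halfMoment h (by linarith)))
  by_cases hinf : ∫⁻ s, jump ρ s = ⊤
  · have h1 : ∫⁻ s, ENNReal.ofReal (ρ s / s * (halfMoment ρ t - halfMoment ρ (t - s))) = 1 := by
      rw [← lintegral_jump_mul_increment_of_infinite h hinf ht]
      exact lintegral_congr fun s => ENNReal.ofReal_mul (div_self_nonneg h s)
    have hi := (lintegral_ofReal_ne_top_iff_integrable hm.aestronglyMeasurable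
      (ae_of_all _ h0)).1 (h1 ▸ ENNReal.one_ne_top)
    refine ⟨hi, ?_⟩
    rw [integral_eq_lintegral_of_nonneg_ae (ae_of_all _ h0) hm.aestronglyMeasurable, h1]
    simp
  · have h1 := integral_jump_mul_increment_of_finite h
      (integrable_div_of_lintegral_jump h hinf) ht
    refine ⟨?_, h1⟩
    by_contra hcon
    rw [integral_undef hcon] at h1
    exact zero_ne_one h1

lemma hasNonlocalDeriv_halfMoment {t : ℝ} (ht : 0 < t) :
    HasNonlocalDeriv δ ρ (fun t => 2 * halfMoment ρ t) t 2 := by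
  obtain ⟨hi, h1⟩ := integral_jump_mul_increment h ht
  have e : ∀ s, (2 * halfMoment ρ t - 2 * halfMoment ρ (t - s)) / s * ρ s =
      2 * (ρ s / s * (halfMoment ρ t - halfMoment ρ (t - s))) := fun s => by ring
  unfold HasNonlocalDeriv
  simp only [e]
  refine ⟨fun ε _ => (hi.const_mul 2).integrableOn, ?_⟩
  have h2 : ∫ s in Ioo 0 δ, 2 * (ρ s / s * (halfMoment ρ t - halfMoment ρ (t - s))) = 2 := by
    rw [integral_const_mul, setIntegral_eq_integral_of_forall_compl_eq_zero, h1, mul_one]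
    intro s hs
    rw [h.eq_zero s hs]
    simp
  have h3 : 𝓝 (2 : ℝ) = 𝓝 (∫ s in Ioo 0 δ, 2 * (ρ s / s *
      (halfMoment ρ t - halfMoment ρ (t - s)))) := by rw [h2]
  rw [h3]
  simp only [← integral_indicator measurableSet_Ioo]
  refine tendsto_integral_filter_of_dominated_convergence
    (fun s => ‖2 * (ρ s / s * (halfMoment ρ t - halfMoment ρ (t - s)))‖)
    (Eventually.of_forall fun ε => (hi.const_mul 2).aestronglyMeasurable.indicator
      measurableSet_Ioo) (Eventually.of_forall fun ε => ae_of_all _ fun s =>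
      norm_indicator_le_norm_self _ _) (hi.const_mul 2).norm (ae_of_all _ fun s => ?_)
  refine tendsto_const_nhds.congr' ?_
  by_cases hs : s ∈ Ioo 0 δ
  · filter_upwards [Ioo_mem_nhdsGT hs.1] with ε hε
    rw [Set.indicator_of_mem hs, Set.indicator_of_mem (show s ∈ Ioo ε δ from ⟨hε.2, hs.2⟩)]
  · filter_upwards [self_mem_nhdsWithin] with ε hε
    rw [Set.indicator_of_notMem hs, Set.indicator_of_notMem fun hs' =>
      hs ⟨lt_trans hε hs'.1, hs'.2⟩]

lemma halfMoment_isEquivalent :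
    Asymptotics.IsEquivalent atTop (fun t => 2 * halfMoment ρ t) (fun t => 2 * t) := by
  rw [Asymptotics.IsEquivalent, Asymptotics.isLittleO_iff_tendsto']
  · have h1 : Tendsto (fun t : ℝ => δ / t) atTop (𝓝 0) := tendsto_const_nhds.div_atTop tendsto_id
    refine squeeze_zero' ?_ ?_ h1
    · filter_upwards [eventually_gt_atTop 0] with t ht
      have := le_halfMoment h t
      simp only [Pi.sub_apply]
      exact div_nonneg (by linarith) (by linarith)
    · filter_upwards [eventually_gt_atTop 0] with t ht
      have := halfMoment_le h ht
      simp only [Pi.sub_apply]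
      rw [div_le_div_iff₀ (by linarith) ht]
      nlinarith
  · filter_upwards [eventually_gt_atTop 0] with t ht h0
    linarith

end

end

end NonlocalDiffusion

/-! ### The truncated fractional kernel and short-time asymptotics -/

namespace NonlocalDiffusion

noncomputable section

lemma lintegral_Ioo_rpow {a b β : ℝ} (ha : 0 ≤ a) (hab : a ≤ b)
    (hβ : -1 < β ∨ β ≠ -1 ∧ 0 < a) :
    ∫⁻ x in Ioo a b, ENNReal.ofReal (x ^ β) =
      ENNReal.ofReal ((b ^ (β + 1) - a ^ (β + 1)) / (β + 1)) := by
  have h0 : ∀ c : ℝ, 0 < a → (0 : ℝ) ∉ uIcc a b := fun _ h => by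
    rw [uIcc_of_le hab]
    exact fun hx => absurd hx.1 (not_le.2 h)
  have hi : IntegrableOn (fun x : ℝ => x ^ β) (Ioo a b) := by
    have : IntervalIntegrable (fun x : ℝ => x ^ β) volume a b := by
      rcases hβ with h | ⟨-, h⟩
      · exact intervalIntegral.intervalIntegrable_rpow' h
      · exact intervalIntegral.intervalIntegrable_rpow (Or.inr (h0 a h))
    exact ((intervalIntegrable_iff_integrableOn_Ioc_of_le hab).1 this).mono_set Ioo_subset_Ioc_self
  rw [← ofReal_integral_eq_lintegral_ofReal hi
    ((ae_restrict_iff' measurableSet_Ioo).2 (ae_of_all _ fun x hx =>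
      Real.rpow_nonneg (ha.trans hx.1.le) _)), ← integral_Ioc_eq_integral_Ioo,
    ← intervalIntegral.integral_of_le hab, integral_rpow]
  rcases hβ with h | ⟨h1, h2⟩
  · exact Or.inl h
  · exact Or.inr ⟨h1, h0 a h2⟩

/-- The Beta integral with exponents summing to one does not depend on `t`, and the reflection
formula evaluates it. -/
lemma lintegral_Ioo_beta {α t : ℝ} (hα : α ∈ Ioo (0 : ℝ) 1) (ht : 0 < t) :
    ∫⁻ r in Ioo 0 t, ENNReal.ofReal (r ^ (α - 1) * (t - r) ^ (-α)) =
      ENNReal.ofReal (Real.pi / Real.sin (Real.pi * α)) := by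
  have hsin : 0 < Real.sin (Real.pi * α) := Real.sin_pos_of_pos_of_lt_pi
    (mul_pos Real.pi_pos hα.1) (by nlinarith [Real.pi_pos, hα.2])
  have h1 : ∫ r in Ioo 0 t, r ^ (α - 1) * (t - r) ^ (-α) = Real.pi / Real.sin (Real.pi * α) := by
    have h2 := Complex.betaIntegral_scaled (α : ℂ) ((1 - α : ℝ) : ℂ) ht
    have h3 := Complex.Gamma_mul_Gamma_eq_betaIntegral (s := (α : ℂ)) (t := ((1 - α : ℝ) : ℂ))
      (by simpa using hα.1) (by simpa using hα.2)
    have h4 : (α : ℂ) + ((1 - α : ℝ) : ℂ) = 1 := by push_cast; ring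
    have h5 := Complex.Gamma_mul_Gamma_one_sub (α : ℂ)
    rw [h4, Complex.Gamma_one, one_mul] at h3
    rw [show (1 : ℂ) - α = ((1 - α : ℝ) : ℂ) by push_cast; ring] at h5
    rw [← h3, h5, h4, sub_self, Complex.cpow_zero, one_mul, intervalIntegral.integral_of_le ht.le,
      integral_Ioc_eq_integral_Ioo] at h2
    have h6 : ∫ x in Ioo 0 t, (x : ℂ) ^ ((α : ℂ) - 1) * ((t : ℂ) - x) ^ (((1 - α : ℝ) : ℂ) - 1) =
        ∫ x in Ioo 0 t, ((x ^ (α - 1) * (t - x) ^ (-α) : ℝ) : ℂ) := by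
      refine setIntegral_congr_fun measurableSet_Ioo fun x hx => ?_
      rw [Complex.ofReal_mul, Complex.ofReal_cpow hx.1.le,
        Complex.ofReal_cpow (sub_nonneg.2 hx.2.le)]
      push_cast
      congr 2
      ring
    rw [h6, integral_complex_ofReal] at h2
    exact_mod_cast h2
  have hi : IntegrableOn (fun r : ℝ => r ^ (α - 1) * (t - r) ^ (-α)) (Ioo 0 t) := by
    -- A Bochner integral that fails to converge has the value zero, whereas the value just computed
    -- is positive.
    by_contra hcon
    rw [integral_undef hcon] at h1
    exact (div_pos Real.pi_pos hsin).ne h1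
  rw [← h1, ofReal_integral_eq_lintegral_ofReal hi]
  exact (ae_restrict_iff' measurableSet_Ioo).2 (ae_of_all _ fun x hx =>
    mul_nonneg (Real.rpow_nonneg hx.1.le _) (Real.rpow_nonneg (sub_nonneg.2 hx.2.le) _))

/-- The power function on the positive half-line. -/
def powerStep (β : ℝ) : ℝ → ℝ≥0∞ := cut fun t => t ^ β

lemma measurable_powerStep (β : ℝ) : Measurable (powerStep β) := measurable_cut (by fun_prop)

lemma cv_powerStep {α : ℝ} (hα : α ∈ Ioo (0 : ℝ) 1) :
    cv (powerStep (-α)) (wd (powerStep (α - 1))) =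
      fun t => ENNReal.ofReal (Real.pi / Real.sin (Real.pi * α)) * unitStep t := by
  funext t
  rcases le_or_gt t 0 with ht | ht
  · rw [unitStep_of_nonpos ht, mul_zero]
    exact cv_eq_zero_of_nonpos (measurable_powerStep _) (measurable_powerStep _)
      (fun t ht => cut_of_nonpos _ ht) (fun t ht => cut_of_nonpos _ ht) ht
  · rw [unitStep_of_pos ht, mul_one, ← lintegral_Ioo_beta hα ht,
      cv_wd (measurable_powerStep _) (measurable_powerStep _), ← lintegral_indicator measurableSet_Ioo]
    refine lintegral_congr fun r => ?_
    rcases le_or_gt r 0 with hr | hr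
    · rw [powerStep, cut_of_nonpos _ hr, zero_mul, Set.indicator_of_notMem fun h => hr.not_gt h.1]
    rcases le_or_gt t r with htr | htr
    · rw [powerStep, powerStep, cut_of_nonpos _ (sub_nonpos.2 htr), mul_zero,
        Set.indicator_of_notMem fun h => htr.not_gt h.2]
    · rw [powerStep, powerStep, cut_of_pos _ hr, cut_of_pos _ (sub_pos.2 htr),
        Set.indicator_of_mem (show r ∈ Ioo 0 t from ⟨hr, htr⟩),
        ENNReal.ofReal_mul (Real.rpow_nonneg hr.le _)]

lemma cv_unitStep_powerStep {α t : ℝ} (hα : 0 < α) (ht : 0 < t) :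
    cv unitStep (wd (powerStep (α - 1))) t = ENNReal.ofReal (t ^ α / α) := by
  rw [cv_unitStep_wd, powerStep, cut, setLIntegral_indicator measurableSet_Ioi, Ioi_inter_Iio,
    lintegral_Ioo_rpow le_rfl ht.le (Or.inl (by linarith)), sub_add_cancel,
    Real.zero_rpow hα.ne', sub_zero]

section

variable {α δ : ℝ} (hα : α ∈ Ioo (0 : ℝ) 1) (hδ : 0 < δ)

include hα hδ

lemma isKernel_fractionalKernel : IsKernel δ (fractionalKernel α δ) := by
  have h0 : ∀ s, 0 ≤ fractionalKernel α δ s := by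
    intro s
    refine Set.indicator_nonneg (fun s hs => ?_) s
    have := hα.2
    have := hs.1
    have : 0 ≤ 1 - α := by linarith
    positivity
  have hm : Measurable (fractionalKernel α δ) := by
    unfold fractionalKernel
    exact Measurable.indicator (by fun_prop) measurableSet_Ioo
  have h1 : ∫⁻ s, ENNReal.ofReal (fractionalKernel α δ s) = 1 := by
    have hC : 0 ≤ (1 - α) * δ ^ (α - 1) := mul_nonneg (by linarith [hα.2]) (by positivity)
    have e : ∀ s, ENNReal.ofReal (fractionalKernel α δ s) = (Ioo 0 δ).indicator
        (fun s => ENNReal.ofReal ((1 - α) * δ ^ (α - 1)) * ENNReal.ofReal (s ^ (-α))) s := by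
      intro s
      unfold fractionalKernel
      by_cases hs : s ∈ Ioo 0 δ
      · rw [Set.indicator_of_mem hs, Set.indicator_of_mem hs, ENNReal.ofReal_mul hC]
      · rw [Set.indicator_of_notMem hs, Set.indicator_of_notMem hs, ENNReal.ofReal_zero]
    simp only [e]
    rw [lintegral_indicator measurableSet_Ioo, lintegral_const_mul _ (by fun_prop),
      lintegral_Ioo_rpow le_rfl hδ.le (Or.inl (by linarith [hα.2])),
      Real.zero_rpow (by linarith [hα.2]), sub_zero, ← ENNReal.ofReal_mul hC,
      ENNReal.ofReal_eq_one]
    have h2 : δ ^ (α - 1) * δ ^ (-α + 1) = 1 := by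
      rw [← Real.rpow_add hδ]
      norm_num
    have h3 : (1 - α) ≠ 0 := by linarith [hα.2]
    rw [show -α + 1 = 1 - α by ring] at h2 ⊢
    field_simp
    linarith
  have hi : Integrable (fractionalKernel α δ) :=
    (lintegral_ofReal_ne_top_iff_integrable hm.aestronglyMeasurable (ae_of_all _ h0)).1
      (h1 ▸ ENNReal.one_ne_top)
  refine ⟨hδ, hm, h0, fun s hs => Set.indicator_of_notMem hs _, hi, ?_⟩
  rw [integral_eq_lintegral_of_nonneg_ae (ae_of_all _ h0) hm.aestronglyMeasurable, h1]
  simp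

lemma tail_fractional {r : ℝ} (hr : 0 < r) (hrδ : r ≤ δ) :
    tail (jump (fractionalKernel α δ)) r =
      ENNReal.ofReal ((1 - α) * δ ^ (α - 1) / α * (r ^ (-α) - δ ^ (-α))) := by
  have hC : 0 ≤ (1 - α) * δ ^ (α - 1) := mul_nonneg (by linarith [hα.2]) (by positivity)
  have e : ∀ s, (Ioi r).indicator (jump (fractionalKernel α δ)) s = (Ioo r δ).indicator
      (fun s => ENNReal.ofReal ((1 - α) * δ ^ (α - 1)) * ENNReal.ofReal (s ^ (-α - 1))) s := by
    intro s
    by_cases hs : s ∈ Ioo r δ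
    · have hs0 : 0 < s := hr.trans hs.1
      rw [Set.indicator_of_mem hs, Set.indicator_of_mem (show s ∈ Ioi r from hs.1),
        ← ENNReal.ofReal_mul hC, jump, fractionalKernel,
        Set.indicator_of_mem (show s ∈ Ioo 0 δ from ⟨hs0, hs.2⟩), Real.rpow_sub_one hs0.ne',
        mul_div_assoc]
    · rw [Set.indicator_of_notMem hs]
      by_cases hs' : s ∈ Ioi r
      · rw [Set.indicator_of_mem hs', jump, fractionalKernel, Set.indicator_of_notMem
          fun h => hs ⟨hs', h.2⟩]
        simp
      · rw [Set.indicator_of_notMem hs']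
  rw [tail_of_pos _ hr, ← lintegral_indicator measurableSet_Ioi]
  simp only [e]
  rw [lintegral_indicator measurableSet_Ioo, lintegral_const_mul _ (by fun_prop),
    lintegral_Ioo_rpow hr.le hrδ (Or.inr ⟨by linarith [hα.1], hr⟩), ← ENNReal.ofReal_mul hC,
    sub_add_cancel]
  congr 1
  have := hα.1.ne'
  field_simp
  ring

lemma tail_fractional_le (r : ℝ) :
    tail (jump (fractionalKernel α δ)) r ≤
      ENNReal.ofReal ((1 - α) * δ ^ (α - 1) / α) * powerStep (-α) r := by
  have hC : 0 ≤ (1 - α) * δ ^ (α - 1) / α :=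
    div_nonneg (mul_nonneg (by linarith [hα.2]) (by positivity)) hα.1.le
  rcases le_or_gt r 0 with hr | hr
  · simp [tail_of_nonpos _ hr]
  rcases le_or_gt r δ with hrδ | hrδ
  · rw [tail_fractional hα hδ hr hrδ, powerStep, cut_of_pos _ hr, ← ENNReal.ofReal_mul hC]
    refine ENNReal.ofReal_le_ofReal (mul_le_mul_of_nonneg_left ?_ hC)
    have : 0 ≤ δ ^ (-α) := by positivity
    linarith
  · rw [tail_eq_zero (isKernel_fractionalKernel hα hδ) hrδ.le]
    exact zero_le

/-- The constant subtracted in the tail is `δ^(-α) = (r/δ)^α r^(-α)`, hence at most the fraction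
`(t/δ)^α` of the singular term when `r ≤ t`. -/
lemma le_tail_fractional {r t : ℝ} (hr : 0 < r) (hrt : r ≤ t) (htδ : t ≤ δ) :
    ENNReal.ofReal ((1 - α) * δ ^ (α - 1) / α * (1 - (t / δ) ^ α)) * powerStep (-α) r ≤
      tail (jump (fractionalKernel α δ)) r := by
  have hC : 0 ≤ (1 - α) * δ ^ (α - 1) / α :=
    div_nonneg (mul_nonneg (by linarith [hα.2]) (by positivity)) hα.1.le
  rw [tail_fractional hα hδ hr (hrt.trans htδ), powerStep, cut_of_pos _ hr,
    ← ENNReal.ofReal_mul' (by positivity)]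
  refine ENNReal.ofReal_le_ofReal ?_
  rw [mul_assoc]
  refine mul_le_mul_of_nonneg_left ?_ hC
  have h1 : δ ^ (-α) = (r / δ) ^ α * r ^ (-α) := by
    rw [Real.div_rpow hr.le hδ.le, Real.rpow_neg hδ.le, Real.rpow_neg hr.le]
    have := (Real.rpow_pos_of_pos hr α).ne'
    field_simp
  have h2 : (r / δ) ^ α ≤ (t / δ) ^ α :=
    Real.rpow_le_rpow (by positivity) (div_le_div_of_nonneg_right hrt hδ.le) hα.1.le
  rw [h1, sub_mul, one_mul]
  have := mul_le_mul_of_nonneg_right h2 (show 0 ≤ r ^ (-α) by positivity)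
  linarith

lemma lintegral_jump_fractional : ∫⁻ s, jump (fractionalKernel α δ) s = ⊤ := by
  have h0 := isKernel_fractionalKernel hα hδ
  have hC : 0 < (1 - α) * δ ^ (α - 1) / α :=
    div_pos (mul_pos (by linarith [hα.2]) (by positivity)) hα.1
  have h1 : Tendsto (fun r : ℝ => (1 - α) * δ ^ (α - 1) / α * (r ^ (-α) - δ ^ (-α)))
      (𝓝[>] 0) atTop := by
    refine Tendsto.const_mul_atTop hC (tendsto_atTop_add_const_right _ _ ?_)
    exact tendsto_rpow_neg_nhdsGT_zero (by linarith [hα.1])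
  refine ENNReal.eq_top_of_forall_nnreal_le fun c => ?_
  obtain ⟨r, hr1, hr2⟩ := ((h1.eventually (eventually_ge_atTop (c : ℝ))).and
    (Ioo_mem_nhdsGT hδ)).exists
  calc (c : ℝ≥0∞) = ENNReal.ofReal c := by simp
    _ ≤ tail (jump (fractionalKernel α δ)) r := by
        rw [tail_fractional hα hδ hr2.1 hr2.2.le]
        exact ENNReal.ofReal_le_ofReal hr1
    _ ≤ _ := by
        rw [tail_of_pos _ hr2.1]
        exact setLIntegral_le_lintegral _ _

/-- Two-sided bounds for the half second moment of the truncated fractional kernel. -/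
lemma fractional_bounds {t : ℝ} (ht : 0 < t) (htδ : t ≤ δ) :
    t ^ α / α ≤ (1 - α) * δ ^ (α - 1) / α * (Real.pi / Real.sin (Real.pi * α)) *
      halfMoment (fractionalKernel α δ) t ∧
    (1 - α) * δ ^ (α - 1) / α * (1 - (t / δ) ^ α) * (Real.pi / Real.sin (Real.pi * α)) *
      halfMoment (fractionalKernel α δ) t ≤ t ^ α / α := by
  have h := isKernel_fractionalKernel hα hδ
  obtain ⟨U, _, _, -, hU, hQ, -⟩ := exists_renewal_measure h (lintegral_jump_fractional hα hδ)
  set T := tail (jump (fractionalKernel α δ)) with hT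
  have hTm : Measurable T := measurable_tail _
  have hp := measurable_powerStep (-α)
  have hp' := measurable_powerStep (α - 1)
  have hsin : 0 < Real.sin (Real.pi * α) := Real.sin_pos_of_pos_of_lt_pi
    (mul_pos Real.pi_pos hα.1) (by nlinarith [Real.pi_pos, hα.2])
  have hb : 0 < Real.pi / Real.sin (Real.pi * α) := div_pos Real.pi_pos hsin
  have hC : 0 < (1 - α) * δ ^ (α - 1) / α :=
    div_pos (mul_pos (by linarith [hα.2]) (by positivity)) hα.1
  have hV0 := halfMoment_nonneg h t
  -- Abel inversion: if `T` were exactly `r^(-α)`, convolving with the conjugate power would return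
  -- a multiple of the distribution function of `U`. The two bounds measure the error of that
  -- replacement.
  have key : cv (cv (powerStep (-α)) U) (wd (powerStep (α - 1))) t =
      ENNReal.ofReal (Real.pi / Real.sin (Real.pi * α) * halfMoment (fractionalKernel α δ) t) := by
    rw [cv_comm hp, cv_powerStep hα, cv_const_mul measurable_unitStep, hU, cut_of_pos _ ht,
      ENNReal.ofReal_mul hb.le]
  have h1 : cv (cv T U) (wd (powerStep (α - 1))) t = ENNReal.ofReal (t ^ α / α) := by
    rw [cv_congr_ae hQ, cv_unitStep_powerStep hα.1 ht]
  constructor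
  · have h2 : cv (cv T U) (wd (powerStep (α - 1))) t ≤
        ENNReal.ofReal ((1 - α) * δ ^ (α - 1) / α) *
          cv (cv (powerStep (-α)) U) (wd (powerStep (α - 1))) t := by
      rw [← cv_const_mul (measurable_cv hp U)]
      refine cv_mono (fun z => ?_) _ _
      rw [← cv_const_mul hp]
      exact cv_mono (tail_fractional_le hα hδ) _ _
    rw [h1, key, ← ENNReal.ofReal_mul hC.le, ENNReal.ofReal_le_ofReal_iff (by positivity)] at h2
    rw [mul_assoc]
    exact h2
  -- The lower bound for the tail needs its argument `t - z - r` to be at most `t`, so `U` must not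
  -- charge negative times.
  · have hU0 : ∀ᵐ r ∂U, 0 ≤ r := by
      have : U (Iio 0) = 0 := by
        rw [← cv_unitStep, hU, cut_of_nonpos _ le_rfl]
      have e : {a : ℝ | ¬ 0 ≤ a} = Iio 0 := by ext; simp
      rw [ae_iff, e]
      exact this
    have hD : 0 ≤ 1 - (t / δ) ^ α := by
      rw [sub_nonneg]
      exact Real.rpow_le_one (by positivity) ((div_le_one hδ).2 htδ) hα.1.le
    have h2 : ENNReal.ofReal ((1 - α) * δ ^ (α - 1) / α * (1 - (t / δ) ^ α)) *
          cv (cv (powerStep (-α)) U) (wd (powerStep (α - 1))) t ≤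
        cv (cv T U) (wd (powerStep (α - 1))) t := by
      rw [← cv_const_mul (measurable_cv hp U),
        cv_wd ((measurable_cv hp U).const_mul _) hp', cv_wd (measurable_cv hTm U) hp']
      refine lintegral_mono fun z => ?_
      rcases le_or_gt z 0 with hz | hz
      · simp [powerStep, cut_of_nonpos _ hz]
      · refine mul_le_mul' le_rfl ?_
        rw [← cv_const_mul hp]
        refine lintegral_mono_ae ?_
        filter_upwards [hU0] with r hr
        rcases le_or_gt (t - z - r) 0 with hr' | hr'
        · simp [powerStep, cut_of_nonpos _ hr']
        · exact le_tail_fractional hα hδ hr' (by linarith) htδ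
    rw [h1, key, ← ENNReal.ofReal_mul (mul_nonneg hC.le hD),
      ENNReal.ofReal_le_ofReal_iff (div_nonneg (by positivity) hα.1.le)] at h2
    rw [mul_assoc _ (Real.pi / _)]
    exact h2

lemma halfMoment_fractional_isEquivalent :
    Asymptotics.IsEquivalent (𝓝[>] (0 : ℝ)) (fun t => 2 * halfMoment (fractionalKernel α δ) t)
      (fun t => 2 * Real.sin (α * Real.pi) * δ ^ (1 - α) / ((1 - α) * Real.pi) * t ^ α) := by
  have hsin : 0 < Real.sin (Real.pi * α) := Real.sin_pos_of_pos_of_lt_pi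
    (mul_pos Real.pi_pos hα.1) (by nlinarith [Real.pi_pos, hα.2])
  have hπ := Real.pi_pos
  have h1α : 0 < 1 - α := by linarith [hα.2]
  have hα0 := hα.1
  set K := (1 - α) * δ ^ (α - 1) / α * (Real.pi / Real.sin (Real.pi * α)) with hK
  have hKpos : 0 < K := by positivity
  have hconst : 2 * Real.sin (α * Real.pi) * δ ^ (1 - α) / ((1 - α) * Real.pi) = 2 / (K * α) := by
    have h2 : δ ^ (1 - α) = (δ ^ (α - 1))⁻¹ := by
      rw [← Real.rpow_neg hδ.le]
      congr 1
      ring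
    have h3 : 0 < δ ^ (α - 1) := by positivity
    rw [hK, h2, mul_comm α Real.pi]
    field_simp
  rw [hconst]
  refine Asymptotics.isEquivalent_of_tendsto_one ?_
  have hlim : Tendsto (fun t : ℝ => (1 - (t / δ) ^ α)⁻¹) (𝓝[>] 0) (𝓝 1) := by
    have h1 : ContinuousAt (fun t : ℝ => (1 - (t / δ) ^ α)⁻¹) 0 := by
      refine ContinuousAt.inv₀ (continuousAt_const.sub
        (ContinuousAt.rpow_const (by fun_prop) (Or.inr hα0.le))) ?_
      simp [Real.zero_rpow hα0.ne']
    have h2 := h1.tendsto.mono_left (nhdsWithin_le_nhds (s := Ioi (0 : ℝ)))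
    simpa [Real.zero_rpow hα0.ne'] using h2
  refine tendsto_of_tendsto_of_tendsto_of_le_of_le' tendsto_const_nhds hlim ?_ ?_
  · filter_upwards [Ioo_mem_nhdsGT hδ] with t ht
    have hb := (fractional_bounds hα hδ ht.1 ht.2.le).1
    have htα : 0 < t ^ α := Real.rpow_pos_of_pos ht.1 _
    rw [Pi.div_apply, one_le_div (by positivity)]
    rw [div_le_iff₀ hα0] at hb
    rw [div_mul_eq_mul_div, div_le_iff₀ (by positivity)]
    linarith
  · filter_upwards [Ioo_mem_nhdsGT hδ] with t ht
    have hb := (fractional_bounds hα hδ ht.1 ht.2.le).2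
    have htα : 0 < t ^ α := Real.rpow_pos_of_pos ht.1 _
    have hD : 0 < 1 - (t / δ) ^ α := by
      rw [sub_pos]
      exact Real.rpow_lt_one (by have := ht.1; positivity) ((div_lt_one hδ).2 ht.2) hα0
    rw [Pi.div_apply, div_le_iff₀ (by positivity), inv_mul_eq_div, le_div_iff₀ hD,
      div_mul_eq_mul_div, le_div_iff₀ (by positivity)]
    rw [le_div_iff₀ hα0] at hb
    have e : (1 - α) * δ ^ (α - 1) / α * (1 - (t / δ) ^ α) * (Real.pi / Real.sin (Real.pi * α)) =
        K * (1 - (t / δ) ^ α) := by rw [hK]; ring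
    rw [e] at hb
    linarith

end

end

end NonlocalDiffusion

/-! ### The adjoint operator as a convolution of the derivative with the memory function -/

namespace NonlocalDiffusion

noncomputable section

/-- The memory function `r ↦ ∫_r^δ ρ(s) / s ds` for `r > 0`, extended by zero. -/
def memory (ρ : ℝ → ℝ) (r : ℝ) : ℝ := (tail (jump ρ) r).toReal

lemma measurable_memory (ρ : ℝ → ℝ) : Measurable (memory ρ) := (measurable_tail _).ennreal_toReal

lemma memory_nonneg (ρ : ℝ → ℝ) (r : ℝ) : 0 ≤ memory ρ r := ENNReal.toReal_nonneg

lemma memory_of_nonpos (ρ : ℝ → ℝ) {r : ℝ} (hr : r ≤ 0) : memory ρ r = 0 := by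
  simp [memory, tail_of_nonpos _ hr]

lemma integral_jump_section (ρ : ℝ → ℝ) {s : ℝ} (g : ℝ → ℝ) :
    ∫ r, {p : ℝ × ℝ | 0 < p.2 ∧ p.2 < p.1}.indicator (fun p => ρ p.1 / p.1) (s, r) * g r =
      ρ s / s * ∫ r in Ioo 0 s, g r := by
  rw [← integral_const_mul, ← integral_indicator measurableSet_Ioo]
  refine integral_congr_ae (ae_of_all _ fun r => ?_)
  simp only [indicator_apply, mem_ofPred_eq, mem_Ioo]
  split_ifs <;> simp

section

variable {δ : ℝ} {ρ : ℝ → ℝ} (h : IsKernel δ ρ)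

include h

lemma ofReal_memory (r : ℝ) : ENNReal.ofReal (memory ρ r) = tail (jump ρ) r :=
  ENNReal.ofReal_toReal (tail_jump_ne_top h r)

lemma integrable_memory : Integrable (memory ρ) := by
  refine integrable_toReal_of_lintegral_ne_top (measurable_tail _).aemeasurable ?_
  rw [lintegral_tail h]
  exact ENNReal.one_ne_top

/-- On the wedge `0 < r < s` the singularity of `ρ(s)/s` is compensated by the length `s` of the
section, so only the integrability of `ρ` is needed. -/
lemma integrable_jump_indicator : Integrable (fun p : ℝ × ℝ =>
    {p : ℝ × ℝ | 0 < p.2 ∧ p.2 < p.1}.indicator (fun p => ρ p.1 / p.1) p) := by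
  have hm : Measurable (fun p : ℝ × ℝ =>
      {p : ℝ × ℝ | 0 < p.2 ∧ p.2 < p.1}.indicator (fun p => ρ p.1 / p.1) p) := by
    refine Measurable.indicator ((h.measurable.comp measurable_fst).div measurable_fst) ?_
    exact (measurableSet_lt measurable_const measurable_snd).inter
      (measurableSet_lt measurable_snd measurable_fst)
  have h0 : ∀ p : ℝ × ℝ, 0 ≤ {p : ℝ × ℝ | 0 < p.2 ∧ p.2 < p.1}.indicator
      (fun p => ρ p.1 / p.1) p := fun p =>
    indicator_nonneg (fun q _ => div_self_nonneg h q.1) p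
  rw [Measure.volume_eq_prod, integrable_prod_iff hm.aestronglyMeasurable]
  have h1 : ∀ s, ∫ r, ‖{p : ℝ × ℝ | 0 < p.2 ∧ p.2 < p.1}.indicator
      (fun p => ρ p.1 / p.1) (s, r)‖ = ρ s := fun s => by
    have h2 := integral_jump_section ρ (s := s) fun _ => 1
    simp only [mul_one] at h2
    simp_rw [Real.norm_of_nonneg (h0 _)]
    rw [h2]
    by_cases hs : s ∈ Ioo 0 δ
    · have : 0 < s := hs.1
      simp [this.le, this.ne']
    · simp [h.eq_zero s hs]
  constructor
  · refine ae_of_all _ fun s => ?_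
    have : Integrable ((Ioo 0 s).indicator fun _ => ρ s / s) :=
      (integrable_indicator_iff measurableSet_Ioo).2 (by simp)
    refine this.congr (ae_of_all _ fun r => ?_)
    simp [indicator_apply]
  · simp_rw [h1]
    exact h.integrable

lemma integral_jump_indicator (r : ℝ) :
    ∫ s, {p : ℝ × ℝ | 0 < p.2 ∧ p.2 < p.1}.indicator (fun p => ρ p.1 / p.1) (s, r) =
      memory ρ r := by
  rcases le_or_gt r 0 with hr | hr
  · rw [memory_of_nonpos _ hr]
    simp [hr.not_gt]
  · have e : (fun s => {p : ℝ × ℝ | 0 < p.2 ∧ p.2 < p.1}.indicator (fun p => ρ p.1 / p.1) (s, r))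
        = (Ioi r).indicator fun s => ρ s / s := by
      funext s
      simp [indicator_apply, hr]
    rw [e, integral_indicator measurableSet_Ioi, integral_eq_lintegral_of_nonneg_ae
      (ae_of_all _ fun s => div_self_nonneg h s)
      (h.measurable.div measurable_id).aestronglyMeasurable, memory, tail_of_pos _ hr]
    rfl

/-- Write `Ψ(t + s) - Ψ(t)` as the integral of the derivative over `(0, s)` and exchange the
integrals: the singular difference becomes an integral against the integrable memory function. -/
lemma adjointNonlocal_eq {Ψ : ℝ → ℝ} (hΨ : ContDiff ℝ 1 Ψ) (hc : HasCompactSupport Ψ) (t : ℝ) :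
    adjointNonlocal δ ρ Ψ t = -∫ r, memory ρ r * deriv Ψ (t + r) := by
  have hd : Continuous (deriv Ψ) := hΨ.continuous_deriv le_rfl
  obtain ⟨C, hC⟩ := hc.deriv.exists_bound_of_continuous hd
  have hI : Integrable (fun p : ℝ × ℝ => {p : ℝ × ℝ | 0 < p.2 ∧ p.2 < p.1}.indicator
      (fun p => ρ p.1 / p.1) p * deriv Ψ (t + p.2)) (volume.prod volume) :=
    (integrable_jump_indicator h).mul_bdd (c := C)
      (by fun_prop : Continuous fun p : ℝ × ℝ => deriv Ψ (t + p.2)).aestronglyMeasurable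
      (ae_of_all _ fun p => hC _)
  have h1 := integral_integral_swap (f := fun s r => {p : ℝ × ℝ | 0 < p.2 ∧ p.2 < p.1}.indicator
      (fun p => ρ p.1 / p.1) (s, r) * deriv Ψ (t + r)) hI
  simp only [integral_jump_section, integral_mul_const, integral_jump_indicator h] at h1
  rw [← h1, adjointNonlocal, ← integral_neg, setIntegral_eq_integral_of_forall_compl_eq_zero]
  · refine integral_congr_ae (ae_of_all _ fun s => ?_)
    by_cases hs : s ∈ Ioo 0 δ
    · have h3 : ∫ r in Ioo 0 s, deriv Ψ (t + r) = Ψ (t + s) - Ψ t := by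
        rw [← integral_Ioc_eq_integral_Ioo, ← intervalIntegral.integral_of_le hs.1.le,
          intervalIntegral.integral_comp_add_left (fun r => deriv Ψ r), add_zero,
          intervalIntegral.integral_deriv_eq_sub
            (fun x _ => (hΨ.differentiable one_ne_zero).differentiableAt)
            (hd.intervalIntegrable _ _)]
      simp only [h3]
      ring
    · simp [h.eq_zero s hs]
  · intro s hs
    simp [h.eq_zero s hs]

lemma adjointNonlocal_eq_zero_of_le {Ψ : ℝ → ℝ} {a b : ℝ} (hΨ : tsupport Ψ ⊆ Icc a b) {t : ℝ}
    (ht : t ∉ Icc (a - δ) b) : adjointNonlocal δ ρ Ψ t = 0 := by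
  have h0 : ∀ x, x ∉ Icc a b → Ψ x = 0 := fun x hx =>
    image_eq_zero_of_notMem_tsupport fun hx' => hx (hΨ hx')
  rw [adjointNonlocal, setIntegral_congr_fun (g := fun _ => 0) measurableSet_Ioo]
  · simp
  · intro s hs
    have hδ := h.delta_pos
    have h1 : Ψ t = 0 := h0 t fun hx => ht ⟨by linarith [hx.1], hx.2⟩
    have h2 : Ψ (t + s) = 0 := h0 _ fun hx => ht ⟨by linarith [hx.1, hs.2], by linarith [hx.2, hs.1]⟩
    simp [h1, h2]

end

/-- Pairing a locally bounded causal signal with the adjoint of a causal convolution. -/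
lemma integral_mul_causal {L e D : ℝ → ℝ} {C T : ℝ} (hL : Integrable L) (hL0 : ∀ r ≤ 0, L r = 0)
    (he : Measurable e) (heC : ∀ t ≤ T, |e t| ≤ C)
    (hD : Integrable D) (hDT : ∀ t, T < t → D t = 0) :
    ∫ t, e t * ∫ r, L r * D (t + r) = ∫ y, D y * ∫ r, L r * e (y - r) := by
  -- The bound on `e` is needed only up to `T`: the integrand vanishes unless `t < y` (causality of
  -- `L`) and `y ≤ T` (support of `D`).
  have hI : Integrable (Function.uncurry fun t y => e t * (L (y - t) * D y))
      (volume.prod volume) := by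
    have h1 := hD.convolution_integrand (ContinuousLinearMap.mul ℝ ℝ) hL.comp_neg
    refine (h1.const_mul C).mono ?_ ?_
    · have : AEStronglyMeasurable (fun p : ℝ × ℝ => e p.1) (volume.prod volume) :=
        (he.comp measurable_fst).aestronglyMeasurable
      refine (this.mul h1.aestronglyMeasurable).congr (ae_of_all _ fun p => ?_)
      simp only [Pi.mul_apply, ContinuousLinearMap.mul_apply', neg_sub, Function.uncurry]
      ring
    · refine ae_of_all _ fun p => ?_
      simp only [Function.uncurry, ContinuousLinearMap.mul_apply', neg_sub]
      rcases lt_or_ge T p.2 with hT | hT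
      · simp [hDT _ hT]
      rcases le_or_gt (p.2 - p.1) 0 with hp | hp
      · simp [hL0 _ hp]
      have h2 := heC p.1 (by linarith)
      have h3 := (abs_nonneg _).trans h2
      simp only [Real.norm_eq_abs, abs_mul, abs_of_nonneg h3]
      calc |e p.1| * (|L (p.2 - p.1)| * |D p.2|) ≤ C * (|L (p.2 - p.1)| * |D p.2|) := by gcongr
        _ = C * (|D p.2| * |L (p.2 - p.1)|) := by ring
  have h1 := integral_integral_swap hI
  simp only [integral_const_mul] at h1
  have h2 : ∀ t, ∫ r, L r * D (t + r) = ∫ y, L (y - t) * D y := fun t => by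
    rw [← integral_sub_right_eq_self (fun r => L r * D (t + r)) t]
    simp
  simp only [h2, h1]
  refine integral_congr_ae (ae_of_all _ fun y => ?_)
  simp only
  rw [← integral_sub_left_eq_self (fun r => L r * e (y - r)) volume y, ← integral_const_mul]
  refine integral_congr_ae (ae_of_all _ fun t => ?_)
  simp only [sub_sub_cancel]
  ring

end

end NonlocalDiffusion

/-! ### Distributional calculus in time -/

namespace NonlocalDiffusion

noncomputable section

lemma notMem_tsupport_deriv {Ψ : ℝ → ℝ} {s : Set ℝ} (hs : tsupport Ψ ⊆ s) {t : ℝ} (ht : t ∉ s) :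
    deriv Ψ t = 0 :=
  image_eq_zero_of_notMem_tsupport fun h => ht (hs (tsupport_deriv_subset h))

lemma exists_tsupport_subset_Icc {Ψ : ℝ → ℝ} (hc : HasCompactSupport Ψ)
    (ht : tsupport Ψ ⊆ Ioi 0) : ∃ a T : ℝ, 0 < a ∧ tsupport Ψ ⊆ Icc a T := by
  rcases (tsupport Ψ).eq_empty_or_nonempty with he | hne
  · exact ⟨1, 1, one_pos, by simp [he]⟩
  · obtain ⟨m, hm, hm'⟩ := hc.exists_isMinOn hne continuousOn_id
    obtain ⟨B, hB⟩ := hc.bddAbove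
    exact ⟨m, B, ht hm, fun y hy => ⟨hm' hy, hB hy⟩⟩

lemma integral_deriv_eq_zero_of_compactSupport {Ψ : ℝ → ℝ} (hΨ : ContDiff ℝ 1 Ψ)
    (hc : HasCompactSupport Ψ) : ∫ y, deriv Ψ y = 0 := by
  have h1 : ∀ x, HasDerivAt Ψ (deriv Ψ x) x := fun x =>
    (hΨ.differentiable one_ne_zero x).hasDerivAt
  exact integral_eq_zero_of_hasDerivAt_of_integrable h1
    ((hΨ.continuous_deriv le_rfl).integrable_of_hasCompactSupport hc.deriv)
    (hΨ.continuous.integrable_of_hasCompactSupport hc)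

/-- Integration by parts against the primitive of a locally bounded function. -/
lemma setIntegral_mul_eq_neg_primitive {Ψ v : ℝ → ℝ} {a T C : ℝ} (ha : 0 < a)
    (hΨ : ContDiff ℝ 1 Ψ) (hc : tsupport Ψ ⊆ Icc a T) (hv : Measurable v)
    (hC : ∀ t ≤ T, |v t| ≤ C) :
    ∫ t in Ioi 0, v t * Ψ t = -∫ y, deriv Ψ y * ∫ t in Ioo 0 y, v t := by
  have hcs : HasCompactSupport Ψ := isCompact_Icc.of_isClosed_subset (isClosed_tsupport _) hc
  have hd : Continuous (deriv Ψ) := hΨ.continuous_deriv le_rfl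
  have h0 : ∀ x, x ∉ Icc a T → Ψ x = 0 := fun x hx =>
    image_eq_zero_of_notMem_tsupport fun hx' => hx (hc hx')
  -- With `L` the indicator of `(0, T)`, the inner integral is `Ψ(t + T) - Ψ(t) = -Ψ(t)` for `t >
  -- 0`, so the causal pairing becomes integration by parts.
  have h1 := integral_mul_causal (L := (Ioo 0 T).indicator fun _ => 1)
    (e := (Ioi (0 : ℝ)).indicator v) (D := deriv Ψ) (C := C) (T := T)
    ((integrable_indicator_iff measurableSet_Ioo).2 (by simp))
    (fun r hr => by simp [hr.not_gt]) (hv.indicator measurableSet_Ioi)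
    (fun t ht => by
      by_cases h : t ∈ Ioi (0 : ℝ)
      · rw [indicator_of_mem h]; exact hC t ht
      · rw [indicator_of_notMem h, abs_zero]; exact (abs_nonneg _).trans (hC t ht))
    (hd.integrable_of_hasCompactSupport hcs.deriv)
    (fun t ht => notMem_tsupport_deriv hc fun h => ht.not_ge h.2)
  have h2 : ∀ t, (Ioi (0 : ℝ)).indicator v t *
      ∫ r, (Ioo 0 T).indicator (fun _ => 1) r * deriv Ψ (t + r) =
        -(Ioi (0 : ℝ)).indicator (fun t => v t * Ψ t) t := fun t => by
    by_cases h : t ∈ Ioi (0 : ℝ)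
    · rw [indicator_of_mem h, indicator_of_mem h]
      rcases le_or_gt T 0 with hT | hT
      · rw [h0 t fun h' => (hT.trans_lt ha).not_ge (h'.1.trans h'.2), Ioo_eq_empty hT.not_gt]
        simp
      · have h3 : (fun r => (Ioo 0 T).indicator (fun _ => (1 : ℝ)) r * deriv Ψ (t + r)) =
            (Ioo 0 T).indicator fun r => deriv Ψ (t + r) := by
          funext r; simp [indicator_apply]
        rw [h3, integral_indicator measurableSet_Ioo, ← integral_Ioc_eq_integral_Ioo,
          ← intervalIntegral.integral_of_le hT.le,
          intervalIntegral.integral_comp_add_left (fun r => deriv Ψ r), add_zero,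
          intervalIntegral.integral_deriv_eq_sub
            (fun x _ => (hΨ.differentiable one_ne_zero).differentiableAt)
            (hd.intervalIntegrable _ _),
          h0 (t + T) fun h' => by linarith [h'.2, mem_Ioi.1 h]]
        ring
    · rw [indicator_of_notMem h, indicator_of_notMem h]
      simp
  simp only [h2, integral_neg, integral_indicator measurableSet_Ioi] at h1
  rw [← neg_eq_iff_eq_neg, h1]
  refine integral_congr_ae (ae_of_all _ fun y => ?_)
  by_cases hy : y ∈ Icc a T
  · simp only
    congr 1
    rw [← integral_indicator measurableSet_Ioo,
      ← integral_sub_left_eq_self (fun t => (Ioo 0 y).indicator v t) volume y]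
    refine integral_congr_ae (ae_of_all _ fun r => ?_)
    simp only
    by_cases hr : r ∈ Ioo 0 y
    · rw [indicator_of_mem (show r ∈ Ioo 0 T from ⟨hr.1, hr.2.trans_le hy.2⟩), one_mul,
        indicator_of_mem (show y - r ∈ Ioi 0 from sub_pos.2 hr.2),
        indicator_of_mem (show y - r ∈ Ioo 0 y from ⟨sub_pos.2 hr.2, sub_lt_self _ hr.1⟩)]
    · have h4 : y - r ∉ Ioo 0 y := fun h' => hr ⟨by linarith [h'.2], by linarith [h'.1]⟩
      rw [indicator_of_notMem h4]
      by_cases h5 : y - r ∈ Ioi 0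
      · have h6 : r ∉ Ioo 0 T := fun h' => hr ⟨h'.1, by linarith [mem_Ioi.1 h5]⟩
        rw [indicator_of_notMem h6, zero_mul]
      · rw [indicator_of_notMem h5, mul_zero]
  · simp only [notMem_tsupport_deriv hc hy, zero_mul]

/-- A locally integrable function on the half-line whose distributional derivative vanishes is
almost everywhere constant. -/
lemma exists_ae_eq_const {Q : ℝ → ℝ} (hQ : LocallyIntegrable Q)
    (h : ∀ Ψ : ℝ → ℝ, ContDiff ℝ ∞ Ψ → HasCompactSupport Ψ → tsupport Ψ ⊆ Ioi 0 →
      ∫ y, deriv Ψ y * Q y = 0) : ∃ c, ∀ᵐ y, 0 < y → Q y = c := by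
  -- Any normalised bump supported in the open half-line would do; this one lives on `[1, 3]`.
  let b : ContDiffBump (2 : ℝ) := ⟨1 / 2, 1, by norm_num, by norm_num⟩
  set η : ℝ → ℝ := b.normed volume with hη
  have hηs : ContDiff ℝ ∞ η := b.contDiff_normed
  have hηc : HasCompactSupport η := b.hasCompactSupport_normed
  have hηt : tsupport η ⊆ Icc 1 3 := by
    rw [hη, b.tsupport_normed_eq, Real.closedBall_eq_Icc]
    refine Icc_subset_Icc ?_ ?_ <;> norm_num
  have hη1 : ∫ y, η y = 1 := b.integral_normed
  refine ⟨∫ y, η y * Q y, ?_⟩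
  have hQη : Integrable fun y => η y * Q y := hQ.integrable_smul_left_of_hasCompactSupport
    hηs.continuous hηc
  have key := isOpen_Ioi.ae_eq_zero_of_integral_contDiff_smul_eq_zero (U := Ioi (0 : ℝ))
    (f := fun y => Q y - ∫ z, η z * Q z) (μ := volume)
    ((hQ.sub (locallyIntegrable_const _)).locallyIntegrableOn _) ?_
  · filter_upwards [key] with y hy hy0
    exact sub_eq_zero.1 (hy hy0)
  intro ψ hψ hψc hψt
  have hQψ : Integrable fun y => ψ y * Q y := hQ.integrable_smul_left_of_hasCompactSupport
    hψ.continuous hψc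
  have hψi := hψ.continuous.integrable_of_hasCompactSupport (μ := volume) hψc
  have hηi := hηs.continuous.integrable_of_hasCompactSupport (μ := volume) hηc
  set I := ∫ y, ψ y with hI
  -- Subtracting the right multiple of the bump makes the mean zero, so that the primitive is again
  -- compactly supported in the half-line and is an admissible test function.
  set θ : ℝ → ℝ := fun y => ψ y - I * η y with hθ
  have hθs : ContDiff ℝ ∞ θ := hψ.sub (contDiff_const.mul hηs)
  have hθ0 : ∫ y, θ y = 0 := by
    rw [hθ, integral_sub hψi (hηi.const_mul _), integral_const_mul, hη1, mul_one, sub_self]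
  obtain ⟨a, B, ha, haB, hab⟩ : ∃ a B : ℝ, 0 < a ∧ a ≤ B ∧ ∀ y, y ∉ Icc a B → θ y = 0 := by
    obtain ⟨a, B, ha, hB⟩ := exists_tsupport_subset_Icc hψc hψt
    refine ⟨min a 1, max B 3, by positivity, ?_, fun y hy => ?_⟩
    · exact (min_le_right _ _).trans ((by norm_num : (1 : ℝ) ≤ 3).trans (le_max_right _ _))
    · have h1 : ψ y = 0 := image_eq_zero_of_notMem_tsupport fun h' => hy
        ⟨(min_le_left _ _).trans (hB h').1, le_max_of_le_left (hB h').2⟩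
      have h2 : η y = 0 := image_eq_zero_of_notMem_tsupport fun h' => hy
        ⟨(min_le_right _ _).trans (hηt h').1, le_max_of_le_right (hηt h').2⟩
      simp [hθ, h1, h2]
  set Ψ : ℝ → ℝ := fun y => ∫ r in (0 : ℝ)..y, θ r with hΨ
  have hd : ∀ y, HasDerivAt Ψ (θ y) y := fun y =>
    intervalIntegral.integral_hasDerivAt_right (hθs.continuous.intervalIntegrable _ _)
      (hθs.continuous.stronglyMeasurableAtFilter _ _) hθs.continuous.continuousAt
  have hder : deriv Ψ = θ := funext fun y => (hd y).deriv
  have hΨs : ContDiff ℝ ∞ Ψ := contDiff_infty_iff_deriv.2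
    ⟨fun y => (hd y).differentiableAt, by rwa [hder]⟩
  have hΨt : tsupport Ψ ⊆ Icc a B := by
    refine closure_minimal (fun y hy => ?_) isClosed_Icc
    by_contra hy'
    refine hy ?_
    rcases lt_or_ge y a with h1 | h1
    · rw [hΨ]
      simp only
      rw [intervalIntegral.integral_congr (g := fun _ => 0)]
      · simp
      · intro r hr
        refine hab r fun h' => ?_
        rw [uIcc, mem_Icc] at hr
        exact (max_lt ha h1).not_ge (h'.1.trans hr.2)
    · have h2 : B < y := lt_of_not_ge fun h' => hy' ⟨h1, h'⟩
      rw [hΨ]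
      simp only
      rw [intervalIntegral.integral_of_le (by linarith)]
      refine Eq.trans ?_ hθ0
      refine setIntegral_eq_integral_of_forall_compl_eq_zero fun r hr => hab r fun h' => hr ?_
      exact ⟨ha.trans_le h'.1, h'.2.trans h2.le⟩
  have h3 := h Ψ hΨs (isCompact_Icc.of_isClosed_subset (isClosed_tsupport _) hΨt)
    (hΨt.trans fun y hy => ha.trans_le hy.1)
  rw [hder] at h3
  simp only [smul_eq_mul, mul_sub]
  rw [integral_sub hQψ (hψi.mul_const _), integral_mul_const]
  simp only [hθ, sub_mul, mul_assoc] at h3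
  rwa [integral_sub hQψ (hQη.const_mul _), integral_const_mul] at h3

end

end NonlocalDiffusion

/-! ### The scalar equation in the sense of distributions, and its uniqueness -/

namespace NonlocalDiffusion

noncomputable section

lemma integrable_deriv_mul {Ψ g : ℝ → ℝ} {a T C : ℝ} (hΨ : ContDiff ℝ 1 Ψ)
    (hc : tsupport Ψ ⊆ Icc a T) (hg : Measurable g) (hC : ∀ y ≤ T, |g y| ≤ C) :
    Integrable fun y => deriv Ψ y * g y := by
  have hcs : HasCompactSupport Ψ := isCompact_Icc.of_isClosed_subset (isClosed_tsupport _) hc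
  have hd := (hΨ.continuous_deriv le_rfl).integrable_of_hasCompactSupport (μ := volume) hcs.deriv
  refine (hd.norm.mul_const C).mono' (hd.aestronglyMeasurable.mul hg.aestronglyMeasurable)
    (ae_of_all _ fun y => ?_)
  rcases le_or_gt y T with hy | hy
  · rw [norm_mul]
    exact mul_le_mul_of_nonneg_left (hC y hy) (norm_nonneg _)
  · simp [notMem_tsupport_deriv hc (t := y) fun h' => hy.not_ge h'.2]

lemma toReal_cv_unitStep {f : ℝ → ℝ} (hf : Measurable f) (hf0 : ∀ t, 0 ≤ f t) (t : ℝ) :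
    (cv unitStep (wd (cut f)) t).toReal = ∫ r in Ioo 0 t, f r := by
  rw [cv_unitStep_wd, cut, setLIntegral_indicator measurableSet_Ioi, Ioi_inter_Iio,
    integral_eq_lintegral_of_nonneg_ae (ae_of_all _ hf0) hf.aestronglyMeasurable]

lemma cv_unitStep_cut_ne_top {f : ℝ → ℝ} {C t : ℝ} (hC : ∀ r ≤ t, |f r| ≤ C) :
    cv unitStep (wd (cut f)) t ≠ ⊤ := by
  rw [cv_unitStep_wd, cut, setLIntegral_indicator measurableSet_Ioi, Ioi_inter_Iio]
  refine ne_top_of_le_ne_top (b := ENNReal.ofReal C * ENNReal.ofReal (t - 0)) (by finiteness) ?_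
  rw [← Real.volume_Ioo, ← setLIntegral_const]
  exact setLIntegral_mono' measurableSet_Ioo fun r hr =>
    ENNReal.ofReal_le_ofReal ((le_abs_self _).trans (hC r hr.2.le))

lemma abs_setIntegral_Ioo_le {f : ℝ → ℝ} {C y T : ℝ} (hC : ∀ t ≤ T, |f t| ≤ C) (hy : y ≤ T) :
    |∫ t in Ioo 0 y, f t| ≤ C * max y 0 := by
  have := norm_setIntegral_le_of_norm_le_const (μ := volume) (s := Ioo 0 y) (f := f) (C := C)
    (by simp) fun t ht => hC t (ht.2.le.trans hy)
  simpa [Measure.real, ENNReal.toReal_ofReal'] using this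

lemma measurable_integral_memory_mul (ρ : ℝ → ℝ) {v : ℝ → ℝ} (hv : Measurable v) :
    Measurable fun y => ∫ r, memory ρ r * v (y - r) := by
  have : Measurable fun p : ℝ × ℝ => memory ρ p.2 * v (p.1 - p.2) :=
    ((measurable_memory ρ).comp measurable_snd).mul
      (hv.comp (measurable_fst.sub measurable_snd))
  exact this.stronglyMeasurable.integral_prod_right'.measurable

lemma measurable_setIntegral_Ioo {v : ℝ → ℝ} (hv : Measurable v) :
    Measurable fun y => ∫ t in Ioo 0 y, v t := by
  have : Measurable fun p : ℝ × ℝ => {p : ℝ × ℝ | 0 < p.2 ∧ p.2 < p.1}.indicator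
      (fun p => v p.2) p :=
    (hv.comp measurable_snd).indicator ((measurableSet_lt measurable_const measurable_snd).inter
      (measurableSet_lt measurable_snd measurable_fst))
  have e : (fun y => ∫ t in Ioo 0 y, v t) = fun y => ∫ t,
      {p : ℝ × ℝ | 0 < p.2 ∧ p.2 < p.1}.indicator (fun p => v p.2) (y, t) := by
    funext y
    rw [← integral_indicator measurableSet_Ioo]
    rfl
  rw [e]
  exact this.stronglyMeasurable.integral_prod_right'.measurable

section

variable {δ : ℝ} {ρ : ℝ → ℝ} (h : IsKernel δ ρ)

include h

lemma integral_memory : ∫ r, memory ρ r = 1 := by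
  have h1 : ∫⁻ r, tail (jump ρ) r ≠ ⊤ := by
    rw [lintegral_tail h]
    exact ENNReal.one_ne_top
  unfold memory
  rw [integral_toReal (measurable_tail _).aemeasurable
    (ae_lt_top (measurable_tail _) h1), lintegral_tail h, ENNReal.toReal_one]

/-- Shows that in the weak sense the nonlocal operator is the time derivative of the convolution
with the memory function, the past of `v` included. -/
lemma integral_mul_adjoint {Ψ v : ℝ → ℝ} {a T C : ℝ} (hΨ : ContDiff ℝ 1 Ψ)
    (hc : tsupport Ψ ⊆ Icc a T) (hv : Measurable v) (hC : ∀ t ≤ T, |v t| ≤ C) :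
    ∫ t, v t * adjointNonlocal δ ρ Ψ t = -∫ y, deriv Ψ y * ∫ r, memory ρ r * v (y - r) := by
  have hcs : HasCompactSupport Ψ := isCompact_Icc.of_isClosed_subset (isClosed_tsupport _) hc
  rw [← integral_mul_causal (integrable_memory h) (fun r => memory_of_nonpos ρ) hv hC
    ((hΨ.continuous_deriv le_rfl).integrable_of_hasCompactSupport hcs.deriv)
    (fun t ht => notMem_tsupport_deriv hc fun h => ht.not_ge h.2), ← integral_neg]
  refine integral_congr_ae (ae_of_all _ fun t => ?_)
  simp only [adjointNonlocal_eq h hΨ hcs]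
  ring

lemma integrable_memory_mul {v : ℝ → ℝ} {C y : ℝ} (hv : Measurable v)
    (hC : ∀ t ≤ y, |v t| ≤ C) : Integrable fun r => memory ρ r * v (y - r) := by
  refine ((integrable_memory h).mul_const C).mono' ?_ (ae_of_all _ fun r => ?_)
  · exact ((measurable_memory ρ).mul (hv.comp (by fun_prop))).aestronglyMeasurable
  · rcases le_or_gt r 0 with hr | hr
    · simp [memory_of_nonpos ρ hr]
    · rw [norm_mul, Real.norm_of_nonneg (memory_nonneg ρ r)]
      exact mul_le_mul_of_nonneg_left (hC _ (by linarith)) (memory_nonneg ρ r)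

lemma abs_integral_memory_mul_le {v : ℝ → ℝ} {C y : ℝ} (hC : ∀ t ≤ y, |v t| ≤ C) :
    |∫ r, memory ρ r * v (y - r)| ≤ C := by
  have h1 := norm_integral_le_of_norm_le (μ := volume) (f := fun r => memory ρ r * v (y - r))
    ((integrable_memory h).mul_const C) (ae_of_all _ fun r => by
      rcases le_or_gt r 0 with hr | hr
      · simp [memory_of_nonpos ρ hr]
      · rw [norm_mul, Real.norm_of_nonneg (memory_nonneg ρ r)]
        exact mul_le_mul_of_nonneg_left (hC _ (by linarith)) (memory_nonneg ρ r))
  rwa [integral_mul_const, integral_memory h, one_mul] at h1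

lemma toReal_cv_tail {f : ℝ → ℝ} (hf : Measurable f) (hf0 : ∀ t, 0 ≤ f t) (t : ℝ) :
    (cv (tail (jump ρ)) (wd (cut f)) t).toReal =
      ∫ r, memory ρ r * (Ioi (0 : ℝ)).indicator f (t - r) := by
  have hi : Measurable fun r => (Ioi (0 : ℝ)).indicator f (t - r) :=
    (hf.indicator measurableSet_Ioi).comp (by fun_prop)
  rw [cv_swap (measurable_tail _) (measurable_cut hf), cv_wd (measurable_cut hf) (measurable_tail _),
    integral_eq_lintegral_of_nonneg_ae
    (ae_of_all _ fun r => mul_nonneg (memory_nonneg ρ r) (indicator_nonneg (fun t _ => hf0 t) _))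
    ((measurable_memory ρ).mul hi).aestronglyMeasurable]
  congr 1
  refine lintegral_congr fun r => ?_
  rw [ENNReal.ofReal_mul (memory_nonneg ρ r), ofReal_memory h]
  by_cases ht : t - r ∈ Ioi (0 : ℝ)
  · rw [indicator_of_mem ht, cut, indicator_of_mem ht]
  · rw [indicator_of_notMem ht, cut, indicator_of_notMem ht, ENNReal.ofReal_zero]

lemma cv_tail_cut_ne_top {f : ℝ → ℝ} (hf : Measurable f) {C t : ℝ} (hC : ∀ r ≤ t, |f r| ≤ C) :
    cv (tail (jump ρ)) (wd (cut f)) t ≠ ⊤ := by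
  rw [cv_swap (measurable_tail _) (measurable_cut hf), cv_wd (measurable_cut hf) (measurable_tail _)]
  refine ne_top_of_le_ne_top (b := (∫⁻ r, tail (jump ρ) r) * ENNReal.ofReal C) ?_ ?_
  · rw [lintegral_tail h]
    finiteness
  rw [← lintegral_mul_const _ (measurable_tail _)]
  refine lintegral_mono fun r => ?_
  rcases le_or_gt r 0 with hr | hr
  · simp [tail_of_nonpos _ hr]
  · refine mul_le_mul' le_rfl ?_
    rcases le_or_gt (t - r) 0 with ht | ht
    · simp [cut_of_nonpos _ ht]
    · rw [cut_of_pos _ ht]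
      exact ENNReal.ofReal_le_ofReal ((le_abs_self _).trans (hC _ (by linarith)))

/-- The memory has mass one, so subtracting `T * (1 - W) = l (1 * W)` from the convolution of the
memory with the constant one gives this. The integral on the left includes the past, where `W = 1`.
-/
lemma integral_memory_mul_relaxation {l : ℝ} (hl : 0 ≤ l) (y : ℝ) :
    ∫ r, memory ρ r * relaxation ρ l (y - r) = 1 - l * ∫ t in Ioo 0 y, relaxation ρ l t := by
  have hm := measurable_relaxation h l
  have h1 := congrArg ENNReal.toReal (relaxation_compl_convolution h hl y)
  rw [ENNReal.toReal_mul, ENNReal.toReal_ofReal hl,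
    toReal_cv_unitStep hm (fun t => (relaxation_mem_Icc h hl t).1),
    toReal_cv_tail h (hm.const_sub 1) (fun t => sub_nonneg.2 (relaxation_mem_Icc h hl t).2)] at h1
  rw [← h1, eq_sub_iff_add_eq]
  refine (integral_add (integrable_memory_mul h hm fun t _ => abs_relaxation_le h hl t) ?_).symm.trans
    (Eq.trans ?_ (integral_memory h))
  rotate_left
  · refine integral_congr_ae (ae_of_all _ fun r => ?_)
    simp only
    rcases le_or_gt (y - r) 0 with hr | hr
    · rw [indicator_of_notMem (by simpa using hr), relaxation_of_nonpos l hr]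
      ring
    · rw [indicator_of_mem (by simpa using hr)]
      ring
  · refine integrable_memory_mul h (v := (Ioi (0 : ℝ)).indicator fun t => 1 - relaxation ρ l t)
      ((hm.const_sub 1).indicator measurableSet_Ioi) (C := 1) fun t _ => ?_
    have := relaxation_mem_Icc h hl t
    rw [indicator_apply]
    split_ifs
    · rw [abs_of_nonneg (by linarith [this.2])]
      linarith [this.1]
    · simp

/-- The relaxation function solves the scalar nonlocal equation in the sense of distributions. -/
lemma relaxation_pairing {l : ℝ} (hl : 0 ≤ l) {Ψ : ℝ → ℝ} {a T : ℝ} (ha : 0 < a)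
    (hΨ : ContDiff ℝ 1 Ψ) (hc : tsupport Ψ ⊆ Icc a T) :
    (∫ t, relaxation ρ l t * adjointNonlocal δ ρ Ψ t) +
      l * ∫ t in Ioi 0, relaxation ρ l t * Ψ t = 0 := by
  have hcs : HasCompactSupport Ψ := isCompact_Icc.of_isClosed_subset (isClosed_tsupport _) hc
  have hm := measurable_relaxation h l
  have hC : ∀ t ≤ T, |relaxation ρ l t| ≤ 1 := fun t _ => abs_relaxation_le h hl t
  have hd := (hΨ.continuous_deriv le_rfl).integrable_of_hasCompactSupport (μ := volume) hcs.deriv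
  have hB : Integrable fun y => deriv Ψ y * ∫ t in Ioo 0 y, relaxation ρ l t :=
    integrable_deriv_mul hΨ hc (C := 1 * max T 0) (measurable_setIntegral_Ioo hm) fun y hy =>
      (abs_setIntegral_Ioo_le hC hy).trans
        (mul_le_mul_of_nonneg_left (max_le_max hy le_rfl) zero_le_one)
  rw [integral_mul_adjoint h hΨ hc hm hC, setIntegral_mul_eq_neg_primitive ha hΨ hc hm hC]
  simp_rw [integral_memory_mul_relaxation h hl, mul_sub, mul_one, mul_left_comm _ l]
  rw [integral_sub hd (hB.const_mul l), integral_deriv_eq_zero_of_compactSupport hΨ hcs,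
    integral_const_mul]
  ring

/-- A locally bounded causal solution of the homogeneous Volterra equation vanishes. -/
lemma ae_eq_zero_of_volterra {l : ℝ} (hl : 0 ≤ l) {e : ℝ → ℝ} (he : Measurable e)
    (heb : ∀ T, ∃ C, ∀ t ≤ T, |e t| ≤ C) (he0 : ∀ t ≤ 0, e t = 0)
    (hE : ∀ᵐ y, 0 < y → (∫ r, memory ρ r * e (y - r)) + l * ∫ t in Ioo 0 y, e t = 0) :
    e =ᵐ[volume] 0 := by
  have hcut : ∀ f : ℝ → ℝ, cut (fun t => max (f t) 0) = cut f := fun f => by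
    funext t
    simp [cut, indicator_apply]
  set M : ℝ → ℝ≥0∞ := fun r => ENNReal.ofReal l * unitStep r + tail (jump ρ) r with hM
  have hMm : Measurable M := (measurable_unitStep.const_mul _).add (measurable_tail _)
  have hMcv : ∀ f t, cv M (wd f) t =
      ENNReal.ofReal l * cv unitStep (wd f) t + cv (tail (jump ρ)) (wd f) t := fun f t => by
    rw [hM, cv_add (measurable_unitStep.const_mul _), cv_const_mul measurable_unitStep]
  -- The resolvent is already at hand: for `l > 0` take `V = (1 - W)/l`, since `T * V = 1 * W` and
  -- `l (1 * V) = 1 * (1 - W)` add up to `1 * 1`. At `l = 0` its limit, the half moment, takes over.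
  obtain ⟨V, hV⟩ : ∃ V, cv M (wd V) = cv unitStep (wd unitStep) := by
    rcases hl.eq_or_lt with rfl | hl
    · refine ⟨cut (halfMoment ρ), funext fun t => ?_⟩
      rw [hMcv, halfMoment_convolution h, cv_unitStep_unitStep]
      simp
    · have hm := measurable_relaxation h l
      have hq : Measurable (cut fun r => (1 - relaxation ρ l r) / l) :=
        measurable_cut ((hm.const_sub 1).div_const l)
      refine ⟨cut fun r => (1 - relaxation ρ l r) / l, funext fun t => ?_⟩
      have hsum : (fun r => ENNReal.ofReal l * cut (fun r => (1 - relaxation ρ l r) / l) r +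
          cut (relaxation ρ l) r) = unitStep := by
        funext r
        rcases le_or_gt r 0 with hr | hr
        · simp [cut_of_nonpos _ hr, unitStep_of_nonpos hr]
        · have hw := relaxation_mem_Icc h hl.le r
          rw [cut_of_pos _ hr, cut_of_pos _ hr, unitStep_of_pos hr, ← ENNReal.ofReal_mul hl.le,
            mul_div_cancel₀ _ hl.ne', ← ENNReal.ofReal_add (sub_nonneg.2 hw.2) hw.1,
            sub_add_cancel, ENNReal.ofReal_one]
      rw [hMcv, cv_tail_quotient h hl, cv_swap measurable_unitStep hq,
        cv_swap measurable_unitStep (measurable_cut hm), ← cv_const_mul hq,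
        ← cv_add (hq.const_mul _), hsum]
  have hsplit : ∀ f : ℝ → ℝ, Measurable f → (∀ T, ∃ C, ∀ t ≤ T, |f t| ≤ C) → ∀ y,
      cv M (wd (cut f)) y ≠ ⊤ ∧ (cv M (wd (cut f)) y).toReal =
        l * (∫ t in Ioo 0 y, max (f t) 0) +
          ∫ r, memory ρ r * (Ioi (0 : ℝ)).indicator (fun t => max (f t) 0) (y - r) := by
    intro f hf hfb y
    obtain ⟨C, hC⟩ := hfb y
    have h1 := cv_unitStep_cut_ne_top hC
    have h2 := cv_tail_cut_ne_top h hf hC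
    rw [hMcv]
    refine ⟨by finiteness, ?_⟩
    rw [ENNReal.toReal_add (by finiteness) h2, ENNReal.toReal_mul, ENNReal.toReal_ofReal hl,
      ← hcut, toReal_cv_unitStep (hf.max measurable_const) (fun _ => le_max_right _ _),
      toReal_cv_tail h (hf.max measurable_const) (fun _ => le_max_right _ _)]
  have hnb : ∀ T, ∃ C, ∀ t ≤ T, |(-e) t| ≤ C := by simpa using heb
  -- The uniqueness lemma concerns `[0, ∞]`-valued functions, so the signed equation is read as
  -- saying that the positive and negative parts of `e` have equal convolutions with `M`.
  have hmain : cut e =ᵐ[volume] cut (-e) := by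
    refine volterra_unique hMm (measurable_cut he) (measurable_cut he.neg) hV
      (fun r => cut_of_nonpos e) (fun t => ?_) ?_
    · obtain ⟨C, hC⟩ := heb t
      exact (cv_unitStep_cut_ne_top hC).lt_top
    · filter_upwards [hE] with y hy
      rcases le_or_gt y 0 with hy0 | hy0
      · have hM0 : ∀ t ≤ 0, M t = 0 := fun t ht => by
          simp [hM, unitStep_of_nonpos ht, tail_of_nonpos _ ht]
        rw [cv_eq_zero_of_nonpos hMm (measurable_cut he) hM0 (fun r => cut_of_nonpos e) hy0,
          cv_eq_zero_of_nonpos hMm (measurable_cut he.neg) hM0 (fun r => cut_of_nonpos (-e)) hy0]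
      · obtain ⟨h1, h2⟩ := hsplit e he heb y
        obtain ⟨h3, h4⟩ := hsplit (-e) he.neg hnb y
        rw [← ENNReal.toReal_eq_toReal_iff' h1 h3, h2, h4]
        have hy1 := hy hy0
        obtain ⟨C, hC⟩ := heb y
        have hmax : ∀ a : ℝ, |max a 0| ≤ |a| := fun a => by
          rw [abs_of_nonneg (le_max_right _ _)]
          exact max_le (le_abs_self a) (abs_nonneg a)
        have hind : ∀ f : ℝ → ℝ, (∀ t ≤ y, |f t| ≤ C) →
            ∀ t ≤ y, |(Ioi (0 : ℝ)).indicator (fun t => max (f t) 0) t| ≤ C := fun f hf t ht => by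
          rw [indicator_apply]
          split_ifs
          · exact (hmax _).trans (hf t ht)
          · rw [abs_zero]
            exact (abs_nonneg _).trans (hf t ht)
        have hint : ∀ f : ℝ → ℝ, Measurable f → (∀ t ≤ y, |f t| ≤ C) →
            IntegrableOn (fun t => max (f t) 0) (Ioo 0 y) := fun f hf hfC =>
          Measure.integrableOn_of_bounded (M := C) (by simp)
            (hf.max measurable_const).aestronglyMeasurable
            ((ae_restrict_iff' measurableSet_Ioo).2 (ae_of_all _ fun t ht =>
              (hmax _).trans (hfC t ht.2.le)))
        have hCn : ∀ t ≤ y, |(-e) t| ≤ C := by simpa using hC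
        have hA : ∫ t in Ioo 0 y, e t =
            (∫ t in Ioo 0 y, max (e t) 0) - ∫ t in Ioo 0 y, max ((-e) t) 0 := by
          rw [← integral_sub (hint e he hC) (hint (-e) he.neg hCn)]
          simp only [Pi.neg_apply, max_zero_sub_max_neg_zero_eq_self]
        have hB : ∫ r, memory ρ r * e (y - r) =
            (∫ r, memory ρ r * (Ioi (0 : ℝ)).indicator (fun t => max (e t) 0) (y - r)) -
              ∫ r, memory ρ r * (Ioi (0 : ℝ)).indicator (fun t => max ((-e) t) 0) (y - r) := by
          rw [← integral_sub
            (integrable_memory_mul h ((he.max measurable_const).indicator measurableSet_Ioi)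
              (hind e hC))
            (integrable_memory_mul h ((he.neg.max measurable_const).indicator measurableSet_Ioi)
              (hind (-e) hCn))]
          refine integral_congr_ae (ae_of_all _ fun r => ?_)
          simp only [← mul_sub]
          congr 1
          rcases le_or_gt (y - r) 0 with hr | hr
          · rw [indicator_of_notMem (by simpa using hr), indicator_of_notMem (by simpa using hr),
              he0 _ hr, sub_zero]
          · rw [indicator_of_mem (by simpa using hr), indicator_of_mem (by simpa using hr),
              Pi.neg_apply, max_zero_sub_max_neg_zero_eq_self]
        rw [hA, hB] at hy1
        linarith
  filter_upwards [hmain] with t ht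
  rcases le_or_gt t 0 with h0 | h0
  · exact he0 t h0
  · rw [cut_of_pos _ h0, cut_of_pos _ h0, Pi.neg_apply] at ht
    rcases le_total (e t) 0 with h1 | h1
    · rw [ENNReal.ofReal_of_nonpos h1, eq_comm, ENNReal.ofReal_eq_zero] at ht
      exact le_antisymm h1 (neg_nonpos.1 ht)
    · rw [ENNReal.ofReal_of_nonpos (p := -e t) (by linarith), ENNReal.ofReal_eq_zero] at ht
      exact le_antisymm ht h1

/-- The weak equation says that `memory * v + l ∫₀ v` has zero derivative on the half-line, hence is
constant. Its limit at time zero identifies the constant as the past value `c`, and `v - c W` then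
solves the homogeneous Volterra equation with zero past. -/
lemma ae_eq_relaxation_of_pairing {l : ℝ} (hl : 0 ≤ l) {v : ℝ → ℝ} {c : ℝ} (hv : Measurable v)
    (hvb : ∀ T, ∃ C, ∀ t ≤ T, |v t| ≤ C) (hv0 : ∀ t ≤ 0, v t = c)
    (hp : ∀ Ψ : ℝ → ℝ, ContDiff ℝ ∞ Ψ → HasCompactSupport Ψ → tsupport Ψ ⊆ Ioi 0 →
      (∫ t, v t * adjointNonlocal δ ρ Ψ t) + l * ∫ t in Ioi 0, v t * Ψ t = 0) :
    ∀ᵐ t, v t = c * relaxation ρ l t := by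
  set A : ℝ → ℝ := fun y => ∫ r, memory ρ r * v (y - r) with hA
  set B : ℝ → ℝ := fun y => ∫ t in Ioo 0 y, v t with hB
  have hAm : Measurable A := measurable_integral_memory_mul ρ hv
  have hBm : Measurable B := measurable_setIntegral_Ioo hv
  have hQb : ∀ T, ∃ C, 0 ≤ C ∧ (∀ y ≤ T, |A y| ≤ C) ∧ ∀ y ≤ T, |B y| ≤ C * max T 0 := fun T => by
    obtain ⟨C, hC⟩ := hvb T
    have hC0 := (abs_nonneg _).trans (hC T le_rfl)
    exact ⟨C, hC0, fun y hy => abs_integral_memory_mul_le h fun t ht => hC t (ht.trans hy),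
      fun y hy => (abs_setIntegral_Ioo_le hC hy).trans
        (mul_le_mul_of_nonneg_left (max_le_max hy le_rfl) hC0)⟩
  have hQ : LocallyIntegrable fun y => A y + l * B y := by
    refine locallyIntegrable_iff.2 fun k hk => ?_
    obtain ⟨T, hT⟩ := hk.bddAbove
    obtain ⟨C, hC0, hCA, hCB⟩ := hQb T
    refine Measure.integrableOn_of_bounded (M := C + l * (C * max T 0)) hk.measure_lt_top.ne
      (hAm.add (hBm.const_mul l)).aestronglyMeasurable
      ((ae_restrict_iff' hk.measurableSet).2 (ae_of_all _ fun y hy => ?_))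
    refine (norm_add_le _ _).trans (add_le_add (hCA y (hT hy)) ?_)
    rw [norm_mul, Real.norm_of_nonneg hl]
    exact mul_le_mul_of_nonneg_left (hCB y (hT hy)) hl
  obtain ⟨d, hd⟩ := exists_ae_eq_const hQ fun Ψ hΨ hΨc hΨt => by
    obtain ⟨a, T, ha, hs⟩ := exists_tsupport_subset_Icc hΨc hΨt
    obtain ⟨C, hC⟩ := hvb T
    obtain ⟨C', hC0, hCA, hCB⟩ := hQb T
    have h1 : ContDiff ℝ 1 Ψ := hΨ.of_le (by norm_cast)
    have h2 := hp Ψ hΨ hΨc hΨt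
    rw [integral_mul_adjoint h h1 hs hv hC, setIntegral_mul_eq_neg_primitive ha h1 hs hv hC] at h2
    have h3 := integrable_deriv_mul h1 hs hAm hCA
    have h4 := integrable_deriv_mul h1 hs hBm hCB
    simp_rw [mul_add, mul_left_comm _ l]
    rw [integral_add h3 (h4.const_mul l), integral_const_mul]
    linarith
  -- As `y` decreases to zero, each fixed lag `r > 0` eventually sees only the past value `c`;
  -- integrability of the memory allows the passage to the limit.
  have hlim : Tendsto (fun y => A y + l * B y) (𝓝[>] 0) (𝓝 (c + l * 0)) := by
    obtain ⟨C, hC⟩ := hvb 1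
    have hle : ∀ᶠ y : ℝ in 𝓝[>] 0, y ≤ 1 :=
      mem_nhdsWithin_of_mem_nhds (Iic_mem_nhds one_pos)
    refine Tendsto.add ?_ (Tendsto.const_mul l ?_)
    · have h1 : ∫ r, memory ρ r * c = c := by
        rw [integral_mul_const, integral_memory h, one_mul]
      rw [← h1]
      refine tendsto_integral_filter_of_dominated_convergence (fun r => memory ρ r * C) ?_ ?_
        ((integrable_memory h).mul_const C) (ae_of_all _ fun r => ?_)
      · exact Eventually.of_forall fun y =>
          ((measurable_memory ρ).mul (hv.comp (by fun_prop))).aestronglyMeasurable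
      · filter_upwards [hle] with y hy
        refine ae_of_all _ fun r => ?_
        rcases le_or_gt r 0 with hr | hr
        · simp [memory_of_nonpos ρ hr]
        · rw [norm_mul, Real.norm_of_nonneg (memory_nonneg ρ r)]
          exact mul_le_mul_of_nonneg_left (hC _ (by linarith)) (memory_nonneg ρ r)
      · rcases le_or_gt r 0 with hr | hr
        · simp [memory_of_nonpos ρ hr]
        · refine tendsto_const_nhds.congr' ?_
          have : ∀ᶠ y : ℝ in 𝓝[>] 0, y ≤ r := mem_nhdsWithin_of_mem_nhds (Iic_mem_nhds hr)
          filter_upwards [this] with y hy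
          rw [hv0 (y - r) (by linarith)]
    · refine squeeze_zero_norm' (a := fun y => C * y) ?_ ?_
      · filter_upwards [hle, self_mem_nhdsWithin] with y hy hy0
        have := abs_setIntegral_Ioo_le hC hy
        rwa [max_eq_left (le_of_lt hy0)] at this
      · have : Tendsto (fun y : ℝ => C * y) (𝓝 0) (𝓝 (C * 0)) :=
          (continuous_const.mul continuous_id).tendsto 0
        rw [mul_zero] at this
        exact this.mono_left nhdsWithin_le_nhds
  have hdc : d = c := by
    by_contra hne
    have h1 : ∀ᶠ y in 𝓝[>] (0 : ℝ), A y + l * B y ≠ d :=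
      hlim.eventually_ne (by simpa using Ne.symm hne)
    obtain ⟨ε, hε, hεs⟩ := mem_nhdsGT_iff_exists_Ioo_subset.1 h1
    have h2 : volume (Ioo 0 ε) = 0 := by
      refine measure_mono_null (fun y hy => ?_) (ae_iff.1 hd)
      simp only [mem_ofPred_eq, not_forall]
      exact ⟨hy.1, hεs hy⟩
    simp only [Real.volume_Ioo, sub_zero, ENNReal.ofReal_eq_zero] at h2
    exact hε.not_ge h2
  have hm := measurable_relaxation h l
  have key := ae_eq_zero_of_volterra h hl (e := fun t => v t - c * relaxation ρ l t)
    (hv.sub (hm.const_mul c)) (fun T => ?_) (fun t ht => ?_) ?_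
  · filter_upwards [key] with t ht
    exact sub_eq_zero.1 ht
  · obtain ⟨C, hC⟩ := hvb T
    refine ⟨C + |c| * 1, fun t ht => (abs_sub _ _).trans (add_le_add (hC t ht) ?_)⟩
    rw [abs_mul]
    exact mul_le_mul_of_nonneg_left (abs_relaxation_le h hl t) (abs_nonneg c)
  · rw [hv0 t ht, relaxation_of_nonpos l ht, mul_one, sub_self]
  · filter_upwards [hd] with y hy hy0
    obtain ⟨C, hC⟩ := hvb y
    have h1 := integrable_memory_mul h hv hC
    have h2 := integrable_memory_mul h (y := y) hm fun t _ => abs_relaxation_le h hl t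
    have h3 : IntegrableOn v (Ioo 0 y) := Measure.integrableOn_of_bounded (M := C) (by simp)
      hv.aestronglyMeasurable ((ae_restrict_iff' measurableSet_Ioo).2
        (ae_of_all _ fun t ht => hC t ht.2.le))
    have h4 : IntegrableOn (relaxation ρ l) (Ioo 0 y) :=
      Measure.integrableOn_of_bounded (M := 1) (by simp) hm.aestronglyMeasurable
        (ae_of_all _ fun t => abs_relaxation_le h hl t)
    have h5 := hy hy0
    simp_rw [mul_sub, mul_left_comm _ c]
    rw [integral_sub h1 (h2.const_mul c), integral_sub h3 (h4.const_mul c), integral_const_mul,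
      integral_const_mul, integral_memory_mul_relaxation h hl]
    rw [hdc] at h5
    simp only [hA, hB] at h5
    linear_combination h5

end

end

end NonlocalDiffusion

/-! ### Test functions on the plane and their spatial cosine transform -/

namespace NonlocalDiffusion

noncomputable section

/-- The derivative of a function on the plane in the direction `v`. -/
def dirDeriv (v : ℝ × ℝ) (f : ℝ × ℝ → ℝ) (p : ℝ × ℝ) : ℝ := fderiv ℝ f p v

lemma contDiff_dirDeriv (v : ℝ × ℝ) {f : ℝ × ℝ → ℝ} (hf : ContDiff ℝ ∞ f) :
    ContDiff ℝ ∞ (dirDeriv v f) :=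
  (hf.fderiv_right (m := ∞) (by norm_cast)).clm_apply contDiff_const

lemma tsupport_dirDeriv_subset (v : ℝ × ℝ) (f : ℝ × ℝ → ℝ) :
    tsupport (dirDeriv v f) ⊆ tsupport f := by
  refine (closure_mono fun p hp => ?_).trans (tsupport_fderiv_subset ℝ)
  rw [Function.mem_support] at hp ⊢
  intro h
  simp [dirDeriv, h] at hp

lemma hasDerivAt_fst {f : ℝ × ℝ → ℝ} (hf : ContDiff ℝ ∞ f) (x t : ℝ) :
    HasDerivAt (fun y => f (y, t)) (dirDeriv (1, 0) f (x, t)) x := by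
  have h1 : HasFDerivAt f (fderiv ℝ f (x, t)) (x, t) :=
    (hf.differentiable (by simp) (x, t)).hasFDerivAt
  exact h1.comp_hasDerivAt x ((hasDerivAt_id x).prodMk (hasDerivAt_const x t))

lemma hasDerivAt_snd {f : ℝ × ℝ → ℝ} (hf : ContDiff ℝ ∞ f) (x t : ℝ) :
    HasDerivAt (fun r => f (x, r)) (dirDeriv (0, 1) f (x, t)) t := by
  have h1 : HasFDerivAt f (fderiv ℝ f (x, t)) (x, t) :=
    (hf.differentiable (by simp) (x, t)).hasFDerivAt
  exact h1.comp_hasDerivAt t ((hasDerivAt_const t x).prodMk (hasDerivAt_id t))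

lemma iteratedDeriv_two_fst {f : ℝ × ℝ → ℝ} (hf : ContDiff ℝ ∞ f) (x t : ℝ) :
    iteratedDeriv 2 (fun y => f (y, t)) x = dirDeriv (1, 0) (dirDeriv (1, 0) f) (x, t) := by
  have h1 : deriv (fun y => f (y, t)) = fun y => dirDeriv (1, 0) f (y, t) :=
    funext fun y => (hasDerivAt_fst hf y t).deriv
  rw [iteratedDeriv_succ, iteratedDeriv_one, h1]
  exact (hasDerivAt_fst (contDiff_dirDeriv _ hf) x t).deriv

lemma exists_tsupport_subset_box {φ : ℝ × ℝ → ℝ} (hc : HasCompactSupport φ)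
    (ht : tsupport φ ⊆ {p | 0 < p.2}) :
    ∃ R a T : ℝ, 0 < a ∧ tsupport φ ⊆ Icc (-R) R ×ˢ Icc a T := by
  rcases (tsupport φ).eq_empty_or_nonempty with he | hne
  · exact ⟨1, 1, 1, one_pos, by simp [he]⟩
  · obtain ⟨m, hm, hm'⟩ := hc.exists_isMinOn hne continuous_snd.continuousOn
    obtain ⟨B, hB⟩ := (IsCompact.isBounded hc).subset_closedBall (0 : ℝ × ℝ)
    refine ⟨B, m.2, B, ht hm, fun p hp => ?_⟩
    have h1 := hB hp
    rw [mem_closedBall_zero_iff, Prod.norm_def, max_le_iff, Real.norm_eq_abs, Real.norm_eq_abs,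
      abs_le, abs_le] at h1
    exact ⟨h1.1, hm' hp, h1.2.2⟩

/-- A bounded measurable function supported in a bounded interval is integrable. -/
lemma integrable_of_box {f : ℝ → ℝ} {R C : ℝ} (hf : Measurable f) (h0 : ∀ x ∉ Icc (-R) R, f x = 0)
    (hC : ∀ x, |f x| ≤ C) : Integrable f := by
  have h1 : IntegrableOn f (Icc (-R) R) := Measure.integrableOn_of_bounded (M := C) (by simp)
    hf.aestronglyMeasurable (ae_of_all _ hC)
  exact (integrableOn_iff_integrable_of_support_subset fun x hx => by
    by_contra h; exact hx (h0 x h)).1 h1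

section

variable {f : ℝ × ℝ → ℝ} {R a T : ℝ}

/-- The cosine transform in space of a test function. -/
def cosTransform (f : ℝ × ℝ → ℝ) (ξ t : ℝ) : ℝ := ∫ x, Real.cos (2 * Real.pi * ξ * x) * f (x, t)

variable (hf : ContDiff ℝ ∞ f) (hb : tsupport f ⊆ Icc (-R) R ×ˢ Icc a T)

include hb

lemma eq_zero_of_notMem_box {p : ℝ × ℝ} (hp : p ∉ Icc (-R) R ×ˢ Icc a T) : f p = 0 :=
  image_eq_zero_of_notMem_tsupport fun h => hp (hb h)

lemma hasCompactSupport_of_box : HasCompactSupport f :=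
  (isCompact_Icc.prod isCompact_Icc).of_isClosed_subset (isClosed_tsupport _) hb

lemma tsupport_snd_subset (x : ℝ) : tsupport (fun r => f (x, r)) ⊆ Icc a T := by
  refine closure_minimal (fun r hr => ?_) isClosed_Icc
  by_contra h
  exact hr (eq_zero_of_notMem_box hb fun h' => h h'.2)

lemma tsupport_cosTransform_subset (ξ : ℝ) : tsupport (cosTransform f ξ) ⊆ Icc a T := by
  refine closure_minimal (fun r hr => ?_) isClosed_Icc
  by_contra h
  refine hr ?_
  unfold cosTransform
  rw [integral_congr_ae (g := fun _ => 0) (ae_of_all _ fun x => ?_), integral_zero]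
  simp only
  rw [eq_zero_of_notMem_box hb fun h' => h h'.2, mul_zero]

include hf

lemma exists_abs_le_of_box : ∃ C, 0 ≤ C ∧ ∀ p, |f p| ≤ C := by
  obtain ⟨C, hC⟩ := (hasCompactSupport_of_box hb).exists_bound_of_continuous hf.continuous
  exact ⟨C, (norm_nonneg _).trans (hC 0), hC⟩

lemma integrable_fst (t : ℝ) : Integrable fun x => f (x, t) := by
  obtain ⟨C, -, hC⟩ := exists_abs_le_of_box hf hb
  exact integrable_of_box (hf.continuous.comp (by fun_prop)).measurable
    (fun x hx => eq_zero_of_notMem_box hb fun h => hx h.1) fun x => hC _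

lemma hasDerivAt_cosTransform (ξ t : ℝ) :
    HasDerivAt (cosTransform f ξ) (cosTransform (dirDeriv (0, 1) f) ξ t) t := by
  have hb' := (tsupport_dirDeriv_subset (0, 1) f).trans hb
  have hf' := contDiff_dirDeriv (0, 1) hf
  obtain ⟨C, hC0, hC⟩ := exists_abs_le_of_box hf' hb'
  have hbound : Integrable ((Icc (-R) R).indicator fun _ => C) :=
    (integrable_indicator_iff measurableSet_Icc).2 (by simp)
  refine (hasDerivAt_integral_of_dominated_loc_of_deriv_le (s := univ)
    (F := fun t x => Real.cos (2 * Real.pi * ξ * x) * f (x, t))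
    (F' := fun t x => Real.cos (2 * Real.pi * ξ * x) * dirDeriv (0, 1) f (x, t)) univ_mem
    (Eventually.of_forall fun t => ?_) (integrable_cos_mul' (integrable_fst hf hb t) _) ?_
    (ae_of_all _ fun x t _ => ?_) hbound (ae_of_all _ fun x t _ => ?_)).2
  · exact (integrable_cos_mul' (integrable_fst hf hb t) _).aestronglyMeasurable
  · exact (integrable_cos_mul' (integrable_fst hf' hb' t) _).aestronglyMeasurable
  · by_cases hx : x ∈ Icc (-R) R
    · rw [indicator_of_mem hx, norm_mul]
      calc _ ≤ 1 * C := mul_le_mul (Real.abs_cos_le_one _) (hC _) (abs_nonneg _) zero_le_one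
        _ = C := one_mul C
    · rw [eq_zero_of_notMem_box hb' fun h => hx h.1]
      simp [hx]
  · exact (hasDerivAt_snd hf x t).const_mul _

lemma cosTransform_dirDeriv_fst (ξ t : ℝ) :
    cosTransform (dirDeriv (1, 0) (dirDeriv (1, 0) f)) ξ t = -(symb ξ * cosTransform f ξ t) := by
  have hb1 := (tsupport_dirDeriv_subset (1, 0) f).trans hb
  have hf1 := contDiff_dirDeriv (1, 0) hf
  have hb2 := (tsupport_dirDeriv_subset (1, 0) (dirDeriv (1, 0) f)).trans hb1
  have hf2 := contDiff_dirDeriv (1, 0) hf1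
  set c := 2 * Real.pi * ξ with hc
  have hcos : ∀ x, HasDerivAt (fun x => Real.cos (c * x)) (-(c * Real.sin (c * x))) x := fun x =>
    (((hasDerivAt_id' x).const_mul c).cos).congr_deriv (by ring)
  have hsin : ∀ x, HasDerivAt (fun x => Real.sin (c * x)) (c * Real.cos (c * x)) x := fun x =>
    (((hasDerivAt_id' x).const_mul c).sin).congr_deriv (by ring)
  have i0 := integrable_fst hf hb t
  have i1 := integrable_fst hf1 hb1 t
  have i2 := integrable_fst hf2 hb2 t
  have h1 := integral_mul_deriv_eq_deriv_mul_of_integrable (u := fun x => Real.cos (c * x))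
    (v := fun x => dirDeriv (1, 0) f (x, t)) (fun x _ => hcos x)
    (fun x _ => hasDerivAt_fst hf1 x t) (integrable_cos_mul' i2 c)
    (((integrable_sin_mul i1 c).const_mul c).neg.congr (ae_of_all _ fun x => by
      simp only [Pi.neg_apply, Pi.mul_apply]; ring)) (integrable_cos_mul' i1 c)
  have h2 := integral_mul_deriv_eq_deriv_mul_of_integrable (u := fun x => Real.sin (c * x))
    (v := fun x => f (x, t)) (fun x _ => hsin x)
    (fun x _ => hasDerivAt_fst hf x t) (integrable_sin_mul i1 c)
    (((integrable_cos_mul' i0 c).const_mul c).congr (ae_of_all _ fun x => by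
      simp only [Pi.mul_apply]; ring)) (integrable_sin_mul i0 c)
  unfold cosTransform
  simp only [← hc]
  rw [h1]
  simp only [neg_mul, mul_assoc, integral_neg, integral_const_mul, neg_neg] at h2 ⊢
  rw [h2, symb, ← hc]
  ring

lemma contDiff_cosTransform (ξ : ℝ) : ContDiff ℝ 1 (cosTransform f ξ) := by
  have hb' := (tsupport_dirDeriv_subset (0, 1) f).trans hb
  have hf' := contDiff_dirDeriv (0, 1) hf
  refine contDiff_one_iff_deriv.2
    ⟨fun t => (hasDerivAt_cosTransform hf hb ξ t).differentiableAt, ?_⟩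
  rw [funext fun t => (hasDerivAt_cosTransform hf hb ξ t).deriv]
  exact continuous_iff_continuousAt.2 fun t =>
    (hasDerivAt_cosTransform hf' hb' ξ t).continuousAt

end

end

end NonlocalDiffusion

/-! ### Fourier duality and integrability for the weak equation -/

namespace NonlocalDiffusion

noncomputable section

lemma prod_restrict_right (s : Set ℝ) : (volume : Measure ℝ).prod (volume.restrict s) =
    (volume.prod volume).restrict (univ ×ˢ s) := by
  rw [← Measure.prod_restrict, Measure.restrict_univ]

/-- Fourier inversion at the origin for the cosine transform. -/
lemma integral_cosine_transform {g : ℝ → ℝ} (hg : Integrable g) (hc : Continuous g)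
    (hi : Integrable fun ξ => ∫ x, Real.cos (2 * Real.pi * ξ * x) * g x) :
    ∫ ξ, ∫ x, Real.cos (2 * Real.pi * ξ * x) * g x = g 0 := by
  -- The cosine transform sees only the even part of `g`, and at the origin the even part has the
  -- same value.
  set F : ℝ → ℝ := fun x => (g x + g (-x)) / 2 with hF
  have hFi : Integrable F := (hg.add hg.comp_neg).div_const 2
  have hFc : Continuous F := by fun_prop
  have hneg : ∀ ξ, ∫ x, Real.cos (2 * Real.pi * ξ * x) * g (-x) =
      ∫ x, Real.cos (2 * Real.pi * ξ * x) * g x := fun ξ => by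
    rw [← integral_neg_eq_self]
    simp
  have hcos : ∀ ξ, ∫ x, Real.cos (2 * Real.pi * ξ * x) * F x =
      ∫ x, Real.cos (2 * Real.pi * ξ * x) * g x := fun ξ => by
    simp only [hF, mul_div_assoc', mul_add]
    rw [integral_div, integral_add (integrable_cos_mul' hg _) (integrable_cos_mul' hg.comp_neg _),
      hneg]
    ring
  have h1 := eq_of_cosine_transform hFi hFc hi hcos
    (fun ξ => integral_sin_mul_even (fun x => by simp [hF, add_comm]) _) 0
  simp only [mul_zero, zero_mul, Real.cos_zero, one_mul] at h1
  rw [← h1]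
  simp [hF]

/-- The multiplication formula for the cosine transform. -/
lemma integral_mul_cosine_transform {w B : ℝ → ℝ} (hw : Integrable w) (hB : Integrable B) :
    ∫ ξ, w ξ * ∫ x, Real.cos (2 * Real.pi * ξ * x) * B x =
      ∫ x, B x * ∫ ξ, Real.cos (2 * Real.pi * x * ξ) * w ξ := by
  have hI : Integrable (Function.uncurry fun ξ x => w ξ * (Real.cos (2 * Real.pi * ξ * x) * B x))
      (volume.prod volume) := by
    refine ((hw.mul_prod hB).bdd_mul (c := 1) (f := fun p : ℝ × ℝ =>
      Real.cos (2 * Real.pi * p.1 * p.2)) (by fun_prop : Continuous _).aestronglyMeasurable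
      (ae_of_all _ fun p => Real.abs_cos_le_one _)).congr (ae_of_all _ fun p => ?_)
    simp only [Function.uncurry]
    ring
  have h1 := integral_integral_swap hI
  simp only [integral_const_mul] at h1
  rw [h1]
  refine integral_congr_ae (ae_of_all _ fun x => ?_)
  simp only [← integral_const_mul]
  refine integral_congr_ae (ae_of_all _ fun ξ => ?_)
  simp only
  rw [mul_right_comm (2 * Real.pi) ξ x]
  ring

section

variable {δ : ℝ} {ρ : ℝ → ℝ} (h : IsKernel δ ρ)

include h

lemma continuous_adjointNonlocal {Ψ : ℝ → ℝ} (hΨ : ContDiff ℝ 1 Ψ) (hc : HasCompactSupport Ψ) :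
    Continuous (adjointNonlocal δ ρ Ψ) := by
  have hd : Continuous (deriv Ψ) := hΨ.continuous_deriv le_rfl
  obtain ⟨C, hC⟩ := hc.deriv.exists_bound_of_continuous hd
  rw [funext (adjointNonlocal_eq h hΨ hc)]
  refine (continuous_of_dominated (bound := fun r => memory ρ r * C) (fun t => ?_) (fun t => ?_)
    ((integrable_memory h).mul_const C) (ae_of_all _ fun r => by fun_prop)).neg
  · exact ((measurable_memory ρ).mul (by fun_prop : Continuous _).measurable).aestronglyMeasurable
  · refine ae_of_all _ fun r => ?_
    rw [norm_mul, Real.norm_of_nonneg (memory_nonneg ρ r)]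
    exact mul_le_mul_of_nonneg_left (hC _) (memory_nonneg ρ r)

lemma integrable_adjointNonlocal {Ψ : ℝ → ℝ} {a T : ℝ} (hΨ : ContDiff ℝ 1 Ψ)
    (hc : tsupport Ψ ⊆ Icc a T) : Integrable (adjointNonlocal δ ρ Ψ) := by
  have hcs : HasCompactSupport Ψ := isCompact_Icc.of_isClosed_subset (isClosed_tsupport _) hc
  exact (continuous_adjointNonlocal h hΨ hcs).integrable_of_hasCompactSupport
    (HasCompactSupport.intro isCompact_Icc fun t ht => adjointNonlocal_eq_zero_of_le h hc ht)

lemma integral_adjointNonlocal {Ψ : ℝ → ℝ} {a T : ℝ} (hΨ : ContDiff ℝ 1 Ψ)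
    (hc : tsupport Ψ ⊆ Icc a T) : ∫ t, adjointNonlocal δ ρ Ψ t = 0 := by
  have hcs : HasCompactSupport Ψ := isCompact_Icc.of_isClosed_subset (isClosed_tsupport _) hc
  have h1 := integral_mul_adjoint h hΨ hc (v := fun _ => 1) (C := 1) measurable_const (by simp)
  simpa [integral_memory h, integral_deriv_eq_zero_of_compactSupport hΨ hcs] using h1

lemma setIntegral_relaxation_le {l : ℝ} (hl : 0 ≤ l) {T : ℝ} (hT : 0 ≤ T) :
    (∫ t in Ioo 0 T, relaxation ρ l t) ≤ T ∧ l * (∫ t in Ioo 0 T, relaxation ρ l t) ≤ 1 := by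
  have hi : IntegrableOn (relaxation ρ l) (Ioo 0 T) :=
    Measure.integrableOn_of_bounded (M := 1) (by simp)
      (measurable_relaxation h l).aestronglyMeasurable
      (ae_of_all _ fun t => abs_relaxation_le h hl t)
  constructor
  · have := (le_abs_self _).trans (abs_setIntegral_Ioo_le (f := relaxation ρ l) (C := 1) (y := T)
      (fun t _ => abs_relaxation_le h hl t) le_rfl)
    rwa [max_eq_left hT, one_mul] at this
  · have h1 := mul_lintegral_relaxation_le h hl T
    rw [← ofReal_integral_eq_lintegral_ofReal hi
      (ae_of_all _ fun t => (relaxation_mem_Icc h hl t).1), ← ENNReal.ofReal_mul hl,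
      ← ENNReal.ofReal_one, ENNReal.ofReal_le_ofReal_iff zero_le_one] at h1
    exact h1

/-- Integrated over `(0, T)` the relaxation function is at most both `T` and `1 / symb ξ`, which is
integrable in `ξ`. This justifies Fubini down to time zero, where the bound on `W` at fixed `t`
degenerates. -/
lemma integrable_relaxation_prod {T : ℝ} (hT : 0 ≤ T) : Integrable (fun p : ℝ × ℝ =>
    (Ioo 0 T).indicator (relaxation ρ (symb p.1)) p.2) (volume.prod volume) := by
  have hm : Measurable fun p : ℝ × ℝ => (Ioo 0 T).indicator (relaxation ρ (symb p.1)) p.2 := by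
    have h1 : Measurable fun p : ℝ × ℝ => relaxation ρ (symb p.1) p.2 :=
      (measurable_relaxation_uncurry h).comp (f := fun p : ℝ × ℝ => (symb p.1, p.2))
        ((continuous_symb.measurable.comp measurable_fst).prodMk measurable_snd)
    have e : (fun p : ℝ × ℝ => (Ioo 0 T).indicator (relaxation ρ (symb p.1)) p.2) =
        (Prod.snd ⁻¹' Ioo 0 T).indicator fun p : ℝ × ℝ => relaxation ρ (symb p.1) p.2 := by
      funext p
      by_cases hp : p.2 ∈ Ioo 0 T
      · rw [indicator_of_mem hp, indicator_of_mem (s := Prod.snd ⁻¹' Ioo 0 T) hp]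
      · rw [indicator_of_notMem hp, indicator_of_notMem (s := Prod.snd ⁻¹' Ioo 0 T) hp]
    rw [e]
    exact h1.indicator (measurable_snd measurableSet_Ioo)
  have hn : ∀ ξ, ∫ t, ‖(Ioo 0 T).indicator (relaxation ρ (symb ξ)) t‖ =
      ∫ t in Ioo 0 T, relaxation ρ (symb ξ) t := fun ξ => by
    rw [← integral_indicator measurableSet_Ioo]
    refine integral_congr_ae (ae_of_all _ fun t => Real.norm_of_nonneg ?_)
    exact indicator_nonneg (fun t _ => (relaxation_mem_Icc h (symb_nonneg ξ) t).1) t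
  rw [integrable_prod_iff hm.aestronglyMeasurable]
  refine ⟨ae_of_all _ fun ξ => ?_, ?_⟩
  · refine (integrable_indicator_iff (f := relaxation ρ (symb ξ)) measurableSet_Ioo).2 ?_
    exact Measure.integrableOn_of_bounded (M := 1) (by simp)
      (measurable_relaxation h _).aestronglyMeasurable
      (ae_of_all _ fun t => abs_relaxation_le h (symb_nonneg ξ) t)
  · refine (integrable_inv_one_add_sq.const_mul (T + 1)).mono'
      hm.norm.stronglyMeasurable.integral_prod_right'.aestronglyMeasurable
      (ae_of_all _ fun ξ => ?_)
    simp only [hn]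
    have h0 : 0 ≤ ∫ t in Ioo 0 T, relaxation ρ (symb ξ) t :=
      integral_nonneg fun t => (relaxation_mem_Icc h (symb_nonneg ξ) t).1
    obtain ⟨h1, h2⟩ := setIntegral_relaxation_le h (symb_nonneg ξ) hT
    rw [Real.norm_of_nonneg h0, ← div_eq_mul_inv, le_div_iff₀ (by positivity)]
    nlinarith [mul_le_mul_of_nonneg_right (sq_le_symb ξ) h0]

variable {f : ℝ × ℝ → ℝ} {R a T : ℝ}
variable (hf : ContDiff ℝ ∞ f) (hb : tsupport f ⊆ Icc (-R) R ×ˢ Icc a T)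

include hf hb

omit h hb in
lemma contDiff_slice (x : ℝ) : ContDiff ℝ 1 fun r => f (x, r) :=
  (hf.of_le (by norm_cast)).comp (contDiff_const.prodMk contDiff_id)

omit h hf in
lemma hasCompactSupport_snd (x : ℝ) : HasCompactSupport fun r => f (x, r) :=
  isCompact_Icc.of_isClosed_subset (isClosed_tsupport _) (tsupport_snd_subset hb x)

lemma adjointNonlocal_snd_eq (x t : ℝ) : adjointNonlocal δ ρ (fun r => f (x, r)) t =
    -∫ r, memory ρ r * dirDeriv (0, 1) f (x, t + r) := by
  rw [adjointNonlocal_eq h (contDiff_slice hf x) (hasCompactSupport_snd hb x),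
    funext fun t => (hasDerivAt_snd hf x t).deriv]

lemma continuous_adjointNonlocal_snd :
    Continuous fun p : ℝ × ℝ => adjointNonlocal δ ρ (fun r => f (p.1, r)) p.2 := by
  obtain ⟨C, hC0, hC⟩ := exists_abs_le_of_box (contDiff_dirDeriv (0, 1) hf)
    ((tsupport_dirDeriv_subset (0, 1) f).trans hb)
  have hd := (contDiff_dirDeriv (0, 1) hf).continuous
  simp_rw [adjointNonlocal_snd_eq h hf hb]
  refine (continuous_of_dominated (bound := fun r => memory ρ r * C) (fun p => ?_) (fun p => ?_)
    ((integrable_memory h).mul_const C) (ae_of_all _ fun r => by fun_prop)).neg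
  · exact ((measurable_memory ρ).mul (by fun_prop : Continuous _).measurable).aestronglyMeasurable
  · refine ae_of_all _ fun r => ?_
    rw [norm_mul, Real.norm_of_nonneg (memory_nonneg ρ r)]
    exact mul_le_mul_of_nonneg_left (hC _) (memory_nonneg ρ r)

omit hf in
lemma adjointNonlocal_snd_eq_zero {p : ℝ × ℝ} (hp : p ∉ Icc (-R) R ×ˢ Icc (a - δ) T) :
    adjointNonlocal δ ρ (fun r => f (p.1, r)) p.2 = 0 := by
  by_cases hx : p.1 ∈ Icc (-R) R
  · exact adjointNonlocal_eq_zero_of_le h (tsupport_snd_subset hb p.1) fun h' => hp ⟨hx, h'⟩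
  · have : ∀ r, f (p.1, r) = 0 := fun r => eq_zero_of_notMem_box hb fun h' => hx h'.1
    simp [adjointNonlocal, this]

lemma integral_cos_mul_adjointNonlocal (ξ t : ℝ) :
    ∫ x, Real.cos (2 * Real.pi * ξ * x) * adjointNonlocal δ ρ (fun r => f (x, r)) t =
      adjointNonlocal δ ρ (cosTransform f ξ) t := by
  have hb' := (tsupport_dirDeriv_subset (0, 1) f).trans hb
  have hf' := contDiff_dirDeriv (0, 1) hf
  obtain ⟨C, hC0, hC⟩ := exists_abs_le_of_box hf' hb'
  have hcs : HasCompactSupport (cosTransform f ξ) :=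
    isCompact_Icc.of_isClosed_subset (isClosed_tsupport _) (tsupport_cosTransform_subset hb ξ)
  rw [adjointNonlocal_eq h (contDiff_cosTransform hf hb ξ) hcs,
    funext fun t => (hasDerivAt_cosTransform hf hb ξ t).deriv]
  simp_rw [adjointNonlocal_snd_eq h hf hb, mul_neg, integral_neg, cosTransform,
    ← integral_const_mul]
  congr 1
  have hI : Integrable (Function.uncurry fun x r => Real.cos (2 * Real.pi * ξ * x) *
      (memory ρ r * dirDeriv (0, 1) f (x, t + r))) (volume.prod volume) := by
    have h1 : Integrable ((Icc (-R) R).indicator fun _ => C) :=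
      (integrable_indicator_iff measurableSet_Icc).2 (by simp)
    refine (h1.mul_prod (integrable_memory h)).mono' ?_ (ae_of_all _ fun p => ?_)
    · have hd := hf'.continuous
      exact ((by fun_prop : Continuous fun p : ℝ × ℝ =>
        Real.cos (2 * Real.pi * ξ * p.1)).measurable.mul
        (((measurable_memory ρ).comp measurable_snd).mul
        (by fun_prop : Continuous fun p : ℝ × ℝ =>
          dirDeriv (0, 1) f (p.1, t + p.2)).measurable)).aestronglyMeasurable
    · simp only [Function.uncurry, norm_mul, Real.norm_of_nonneg (memory_nonneg ρ p.2)]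
      by_cases hx : p.1 ∈ Icc (-R) R
      · rw [indicator_of_mem hx]
        calc _ ≤ 1 * (memory ρ p.2 * C) := by
              refine mul_le_mul (Real.abs_cos_le_one _) (mul_le_mul_of_nonneg_left (hC _)
                (memory_nonneg ρ _)) ?_ zero_le_one
              exact mul_nonneg (memory_nonneg ρ _) (norm_nonneg _)
          _ = C * memory ρ p.2 := by ring
      · rw [eq_zero_of_notMem_box hb' (p := (p.1, t + p.2)) fun h => hx h.1]
        simp [hx]
  rw [integral_integral_swap hI]
  refine integral_congr_ae (ae_of_all _ fun r => ?_)
  refine integral_congr_ae (ae_of_all _ fun x => ?_)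
  simp only
  ring

end

end

end NonlocalDiffusion

/-! ### Existence: `kern` satisfies the weak equation -/

namespace NonlocalDiffusion

noncomputable section

section

variable {δ : ℝ} {ρ : ℝ → ℝ} (h : IsKernel δ ρ) {f : ℝ × ℝ → ℝ} {R a T : ℝ} (ha : 0 < a)
  (hf : ContDiff ℝ ∞ f) (hb : tsupport f ⊆ Icc (-R) R ×ˢ Icc a T)

/-- The adjoint nonlocal diffusion operator applied to a function of space and time. -/
def adjointOp (δ : ℝ) (ρ : ℝ → ℝ) (f : ℝ × ℝ → ℝ) (p : ℝ × ℝ) : ℝ :=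
  adjointNonlocal δ ρ (fun r => f (p.1, r)) p.2 - dirDeriv (1, 0) (dirDeriv (1, 0) f) p

include h hb

lemma adjointOp_eq_zero {p : ℝ × ℝ} (hp : p ∉ Icc (-R) R ×ˢ Icc (a - δ) T) :
    adjointOp δ ρ f p = 0 := by
  have hb' := ((tsupport_dirDeriv_subset (1, 0) _).trans (tsupport_dirDeriv_subset (1, 0) f)).trans hb
  have hδ := h.delta_pos
  rw [adjointOp, adjointNonlocal_snd_eq_zero h hb hp, eq_zero_of_notMem_box hb' fun h' => hp ⟨h'.1,
    ⟨by linarith [h'.2.1], h'.2.2⟩⟩, sub_zero]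

include hf

lemma continuous_adjointOp : Continuous (adjointOp δ ρ f) :=
  (continuous_adjointNonlocal_snd h hf hb).sub
    (contDiff_dirDeriv _ (contDiff_dirDeriv _ hf)).continuous

lemma integral_cos_mul_adjointOp (ξ t : ℝ) :
    ∫ x, Real.cos (2 * Real.pi * ξ * x) * adjointOp δ ρ f (x, t) =
      adjointNonlocal δ ρ (cosTransform f ξ) t + symb ξ * cosTransform f ξ t := by
  have hb1 := (tsupport_dirDeriv_subset (1, 0) f).trans hb
  have hf1 := contDiff_dirDeriv (1, 0) hf
  have hb2 := (tsupport_dirDeriv_subset (1, 0) (dirDeriv (1, 0) f)).trans hb1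
  have hf2 := contDiff_dirDeriv (1, 0) hf1
  have h1 : Integrable fun x => adjointNonlocal δ ρ (fun r => f (x, r)) t :=
    ((continuous_adjointNonlocal_snd h hf hb).comp (by fun_prop :
      Continuous fun x : ℝ => (x, t))).integrable_of_hasCompactSupport
      (HasCompactSupport.intro (isCompact_Icc (a := -R) (b := R)) fun x hx =>
        adjointNonlocal_snd_eq_zero h hb (p := (x, t)) fun h' => hx h'.1)
  simp only [adjointOp, mul_sub]
  rw [integral_sub (integrable_cos_mul' h1 _) (integrable_cos_mul' (integrable_fst hf2 hb2 t) _),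
    integral_cos_mul_adjointNonlocal h hf hb]
  have := cosTransform_dirDeriv_fst hf hb ξ t
  rw [cosTransform] at this
  rw [this, sub_neg_eq_add]

include ha

/-- In the scalar weak equation the past contributes the integral of `𝒢*Ψ` over `t ≤ 0`, because `W
= 1` there. Since `𝒢*Ψ` has total integral zero, this is minus its integral over `t > 0`. -/
lemma integral_cos_mul_setIntegral_adjointNonlocal (ξ : ℝ) :
    ∫ x, Real.cos (2 * Real.pi * ξ * x) *
        ∫ t in Ioi 0, adjointNonlocal δ ρ (fun r => f (x, r)) t =
      ∫ t in Ioi 0, relaxation ρ (symb ξ) t *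
        ∫ x, Real.cos (2 * Real.pi * ξ * x) * adjointOp δ ρ f (x, t) := by
  have hm := measurable_relaxation h (symb ξ)
  have hΨ := contDiff_cosTransform hf hb ξ
  have hs := tsupport_cosTransform_subset hb ξ
  have hw := relaxation_pairing h (symb_nonneg ξ) ha hΨ hs
  have hG := integrable_adjointNonlocal h hΨ hs
  have hwG : Integrable fun t => relaxation ρ (symb ξ) t * adjointNonlocal δ ρ (cosTransform f ξ) t :=
    hG.bdd_mul (c := 1) hm.aestronglyMeasurable
      (ae_of_all _ fun t => abs_relaxation_le h (symb_nonneg ξ) t)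
  have hwΨ : Integrable fun t => relaxation ρ (symb ξ) t * cosTransform f ξ t :=
    (hΨ.continuous.integrable_of_hasCompactSupport (isCompact_Icc.of_isClosed_subset
      (isClosed_tsupport _) hs)).bdd_mul (c := 1) hm.aestronglyMeasurable
      (ae_of_all _ fun t => abs_relaxation_le h (symb_nonneg ξ) t)
  have h0 := integral_adjointNonlocal h hΨ hs
  rw [← integral_add_compl (measurableSet_Ioi (a := (0 : ℝ))) hG] at h0
  rw [← integral_add_compl (measurableSet_Ioi (a := (0 : ℝ))) hwG] at hw
  have h1 : ∫ t in (Ioi (0 : ℝ))ᶜ, relaxation ρ (symb ξ) t *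
      adjointNonlocal δ ρ (cosTransform f ξ) t =
      ∫ t in (Ioi (0 : ℝ))ᶜ, adjointNonlocal δ ρ (cosTransform f ξ) t := by
    refine setIntegral_congr_fun measurableSet_Ioi.compl fun t ht => ?_
    simp only [mem_compl_iff, mem_Ioi, not_lt] at ht
    simp only [relaxation_of_nonpos _ ht, one_mul]
  simp_rw [integral_cos_mul_adjointOp h hf hb, mul_add, mul_left_comm _ (symb ξ)]
  rw [integral_add hwG.integrableOn (hwΨ.const_mul _).integrableOn, integral_const_mul]
  have h2 : ∫ x, Real.cos (2 * Real.pi * ξ * x) *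
      ∫ t in Ioi 0, adjointNonlocal δ ρ (fun r => f (x, r)) t =
      ∫ t in Ioi 0, adjointNonlocal δ ρ (cosTransform f ξ) t := by
    have hc := continuous_adjointNonlocal_snd h hf hb
    have hI : Integrable (Function.uncurry fun x t => Real.cos (2 * Real.pi * ξ * x) *
        adjointNonlocal δ ρ (fun r => f (x, r)) t) (volume.prod (volume.restrict (Ioi 0))) := by
      rw [prod_restrict_right]
      refine Integrable.integrableOn ?_
      rw [← Measure.volume_eq_prod]
      refine Continuous.integrable_of_hasCompactSupport ((by fun_prop : Continuous
        fun p : ℝ × ℝ => Real.cos (2 * Real.pi * ξ * p.1)).mul hc)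
        (HasCompactSupport.intro (K := Icc (-R) R ×ˢ Icc (a - δ) T)
          (isCompact_Icc.prod isCompact_Icc) fun p hp => ?_)
      simp only [Function.uncurry]
      rw [adjointNonlocal_snd_eq_zero h hb hp, mul_zero]
    simp_rw [← integral_const_mul]
    rw [integral_integral_swap hI]
    simp_rw [integral_cos_mul_adjointNonlocal h hf hb]
  rw [h2]
  linarith

omit ha in
lemma integrable_relaxation_mul_cosTransform : Integrable (Function.uncurry fun ξ t =>
    relaxation ρ (symb ξ) t * ∫ x, Real.cos (2 * Real.pi * ξ * x) * adjointOp δ ρ f (x, t))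
    (volume.prod (volume.restrict (Ioi 0))) := by
  have hc := continuous_adjointOp h hf hb
  obtain ⟨C, hC⟩ := (HasCompactSupport.intro (f := adjointOp δ ρ f)
    (isCompact_Icc.prod isCompact_Icc)
    fun p hp => adjointOp_eq_zero h hb hp).exists_bound_of_continuous hc
  have hm : Measurable fun p : ℝ × ℝ =>
      ∫ x, Real.cos (2 * Real.pi * p.1 * x) * adjointOp δ ρ f (x, p.2) := by
    have : Continuous fun q : (ℝ × ℝ) × ℝ =>
        Real.cos (2 * Real.pi * q.1.1 * q.2) * adjointOp δ ρ f (q.2, q.1.2) := by fun_prop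
    exact this.stronglyMeasurable.integral_prod_right'.measurable
  have hCb : ∀ ξ t, ‖∫ x, Real.cos (2 * Real.pi * ξ * x) * adjointOp δ ρ f (x, t)‖ ≤
      ∫ x, (Icc (-R) R).indicator (fun _ => C) x := fun ξ t => by
    refine norm_integral_le_of_norm_le ((integrable_indicator_iff measurableSet_Icc).2 (by simp))
      (ae_of_all _ fun x => ?_)
    by_cases hx : x ∈ Icc (-R) R
    · rw [indicator_of_mem hx, norm_mul]
      calc _ ≤ 1 * C := mul_le_mul (Real.abs_cos_le_one _) (hC _) (norm_nonneg _) zero_le_one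
        _ = C := one_mul C
    · rw [adjointOp_eq_zero h hb fun h' => hx h'.1]
      simp [hx]
  have h1 := (integrable_relaxation_prod h (le_max_right (T + 1) 0)).mul_bdd hm.aestronglyMeasurable
    (ae_of_all _ fun p => hCb p.1 p.2)
  rw [prod_restrict_right]
  refine h1.integrableOn.congr_fun (fun p hp => ?_) (MeasurableSet.univ.prod measurableSet_Ioi)
  have hp0 : 0 < p.2 := hp.2
  simp only [Function.uncurry]
  by_cases hpT : p.2 ∈ Ioo 0 (max (T + 1) 0)
  · rw [indicator_of_mem hpT]
  · have hT : T < p.2 := by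
      by_contra hle
      exact hpT ⟨hp0, lt_max_of_lt_left (by linarith)⟩
    have : ∀ x, adjointOp δ ρ f (x, p.2) = 0 := fun x =>
      adjointOp_eq_zero h hb fun h' => hT.not_ge h'.2.2
    simp [this]

/-- Integrating the frequency identity over `ξ`, Fourier inversion at the origin recovers `∫_{t>0}
𝒢*f(0, t) dt` on one side and the multiplication formula produces the pairing with `kern` on the
other. Adding the contribution of the Dirac past completes the integral of `𝒢*f(0, ·)` over all
times, which is zero. -/
lemma kern_weak_equation :
    ∫ t in Ioi (-δ), spatialIntegral (kern ρ)
        (fun x => adjointNonlocal δ ρ (fun r => f (x, r)) t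
          - iteratedDeriv 2 (fun y => f (y, t)) x) t = 0 := by
  have hδ := h.delta_pos
  have hA := continuous_adjointNonlocal_snd h hf hb
  set g : ℝ → ℝ := fun x => ∫ t in Ioi 0, adjointNonlocal δ ρ (fun r => f (x, r)) t with hg
  have hH := integrable_relaxation_mul_cosTransform h hf hb
  have hA0 := integrable_adjointNonlocal h (contDiff_slice hf 0) (tsupport_snd_subset hb 0)
  have hgi : ∀ ξ, ∫ x, Real.cos (2 * Real.pi * ξ * x) * g x =
      ∫ t in Ioi 0, relaxation ρ (symb ξ) t *
        ∫ x, Real.cos (2 * Real.pi * ξ * x) * adjointOp δ ρ f (x, t) :=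
    integral_cos_mul_setIntegral_adjointNonlocal h ha hf hb
  have hgc : Continuous g := by
    obtain ⟨C, hC⟩ := (HasCompactSupport.intro
      (f := fun p : ℝ × ℝ => adjointNonlocal δ ρ (fun r => f (p.1, r)) p.2)
      (isCompact_Icc.prod isCompact_Icc)
      fun p hp => adjointNonlocal_snd_eq_zero h hb hp).exists_bound_of_continuous hA
    refine continuous_of_dominated (bound := (Icc (a - δ) T).indicator fun _ => C) (fun x => ?_)
      (fun x => ae_of_all _ fun t => ?_)
      ((integrable_indicator_iff measurableSet_Icc).2 (by simp)).integrableOn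
      (ae_of_all _ fun t => hA.comp (by fun_prop : Continuous fun x : ℝ => (x, t)))
    · exact (hA.comp (by fun_prop : Continuous fun t : ℝ => (x, t))).aestronglyMeasurable
    · by_cases ht : t ∈ Icc (a - δ) T
      · rw [indicator_of_mem ht]
        exact hC (x, t)
      · rw [indicator_of_notMem ht,
          adjointNonlocal_snd_eq_zero h hb (p := (x, t)) fun h' => ht h'.2, norm_zero]
  have hgs : HasCompactSupport g := HasCompactSupport.intro (isCompact_Icc (a := -R) (b := R))
    fun x hx => by
      have : ∀ t, adjointNonlocal δ ρ (fun r => f (x, r)) t = 0 := fun t =>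
        adjointNonlocal_snd_eq_zero h hb (p := (x, t)) fun h' => hx h'.1
      simp [hg, this]
  have hinv := integral_cosine_transform (hgc.integrable_of_hasCompactSupport hgs) hgc (by
    simp_rw [hgi]
    exact hH.integral_prod_left)
  have hB : ∀ t, Integrable fun x => adjointOp δ ρ f (x, t) := fun t =>
    ((continuous_adjointOp h hf hb).comp (by fun_prop :
      Continuous fun x : ℝ => (x, t))).integrable_of_hasCompactSupport
      (HasCompactSupport.intro (isCompact_Icc (a := -R) (b := R)) fun x hx =>
        adjointOp_eq_zero h hb (p := (x, t)) fun h' => hx h'.1)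
  have hmul : ∀ t ∈ Ioi (0 : ℝ), ∫ ξ, relaxation ρ (symb ξ) t *
      ∫ x, Real.cos (2 * Real.pi * ξ * x) * adjointOp δ ρ f (x, t) =
      ∫ x, adjointOp δ ρ f (x, t) * kern ρ x t := fun t ht =>
    integral_mul_cosine_transform (integrable_relaxation_symb h ht) (hB t)
  have hKi : IntegrableOn (fun t => ∫ x, adjointOp δ ρ f (x, t) * kern ρ x t) (Ioi 0) :=
    IntegrableOn.congr_fun hH.integral_prod_right hmul measurableSet_Ioi
  simp_rw [hgi] at hinv
  rw [integral_integral_swap hH, setIntegral_congr_fun measurableSet_Ioi hmul] at hinv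
  simp_rw [iteratedDeriv_two_fst hf]
  have hpos : ∀ t ∈ Ioi (0 : ℝ), spatialIntegral (kern ρ)
      (fun x => adjointNonlocal δ ρ (fun r => f (x, r)) t -
        dirDeriv (1, 0) (dirDeriv (1, 0) f) (x, t)) t =
      ∫ x, adjointOp δ ρ f (x, t) * kern ρ x t := fun t ht => if_pos ht
  have hb2 := ((tsupport_dirDeriv_subset (1, 0) _).trans
    (tsupport_dirDeriv_subset (1, 0) f)).trans hb
  have hneg : ∀ t ∈ Ioc (-δ) 0, spatialIntegral (kern ρ)
      (fun x => adjointNonlocal δ ρ (fun r => f (x, r)) t -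
        dirDeriv (1, 0) (dirDeriv (1, 0) f) (x, t)) t =
      adjointNonlocal δ ρ (fun r => f (0, r)) t := fun t ht => by
    rw [spatialIntegral, if_neg ht.2.not_gt, integral_dirac,
      eq_zero_of_notMem_box hb2 (p := (0, t)) fun h' => by linarith [h'.2.1, ht.2], sub_zero]
  rw [← Ioc_union_Ioi_eq_Ioi (by linarith : -δ ≤ 0),
    setIntegral_union (Ioc_disjoint_Ioi le_rfl) measurableSet_Ioi
      (hA0.integrableOn.congr_fun (fun t ht => (hneg t ht).symm) measurableSet_Ioc)
      (hKi.congr_fun (fun t ht => (hpos t ht).symm) measurableSet_Ioi),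
    setIntegral_congr_fun measurableSet_Ioi hpos, setIntegral_congr_fun measurableSet_Ioc hneg,
    hinv, hg, ← setIntegral_union (Ioc_disjoint_Ioi le_rfl) measurableSet_Ioi hA0.integrableOn
      hA0.integrableOn, Ioc_union_Ioi_eq_Ioi (by linarith : -δ ≤ 0),
    setIntegral_eq_integral_of_forall_compl_eq_zero]
  · exact integral_adjointNonlocal h (contDiff_slice hf 0) (tsupport_snd_subset hb 0)
  · intro t ht
    simp only [mem_Ioi, not_lt] at ht
    exact adjointNonlocal_eq_zero_of_le h (tsupport_snd_subset hb 0) fun h' => by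
      linarith [h'.1]

end

lemma isFundamentalSolution_kern {δ : ℝ} {ρ : ℝ → ℝ} (h : IsKernel δ ρ) :
    IsFundamentalSolution δ ρ (kern ρ) where
  continuousOn := continuousOn_kern h
  integrable t ht := integrable_kern h ht
  locally_bounded T _ := ⟨1, fun t ht => (integral_abs_kern h ht.1).le⟩
  weak_equation φ hφ hc ht := by
    obtain ⟨R, a, T, ha, hb⟩ := exists_tsupport_subset_box hc ht
    exact kern_weak_equation h ha hφ hb

end

end NonlocalDiffusion

/-! ### Approximation of plane waves by test functions -/

namespace NonlocalDiffusion

noncomputable section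

/-- A plane wave is a bounded pointwise limit of test functions, together with its second
derivative. -/
lemma exists_tendsto_cos (c θ : ℝ) : ∃ (g : ℕ → ℝ → ℝ) (M : ℝ),
    (∀ n, ContDiff ℝ ∞ (g n)) ∧ (∀ n, HasCompactSupport (g n)) ∧
    (∀ n x, |g n x| ≤ M) ∧ (∀ n x, |deriv (deriv (g n)) x| ≤ M) ∧
    (∀ x, Tendsto (fun n => g n x) atTop (𝓝 (Real.cos (c * x + θ)))) ∧
    ∀ x, Tendsto (fun n => deriv (deriv (g n)) x) atTop
      (𝓝 (-(c ^ 2 * Real.cos (c * x + θ)))) := by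
  let B : ContDiffBump (0 : ℝ) := ⟨1, 2, by norm_num, by norm_num⟩
  set χ : ℝ → ℝ := fun x => B x with hχ
  have h0 : ContDiff ℝ ∞ χ := B.contDiff
  have h1 : ContDiff ℝ ∞ (deriv χ) := (contDiff_infty_iff_deriv.1 h0).2
  have h2 : ContDiff ℝ ∞ (deriv (deriv χ)) := (contDiff_infty_iff_deriv.1 h1).2
  have hc : HasCompactSupport χ := B.hasCompactSupport
  obtain ⟨C0, hC0⟩ := hc.exists_bound_of_continuous h0.continuous
  obtain ⟨C1, hC1⟩ := hc.deriv.exists_bound_of_continuous h1.continuous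
  obtain ⟨C2, hC2⟩ := hc.deriv.deriv.exists_bound_of_continuous h2.continuous
  have hC0' := (norm_nonneg _).trans (hC0 0)
  have hC1' := (norm_nonneg _).trans (hC1 0)
  have hC2' := (norm_nonneg _).trans (hC2 0)
  set ε : ℕ → ℝ := fun n => 1 / ((n : ℝ) + 1) with hε
  have hεpos : ∀ n, 0 < ε n := fun n => Nat.one_div_pos_of_nat
  have hε1 : ∀ n, ε n ≤ 1 := fun n => by
    rw [hε]; simp only; rw [div_le_one (by positivity)]; linarith [n.cast_nonneg (α := ℝ)]
  have hε0 : Tendsto ε atTop (𝓝 0) := tendsto_one_div_add_atTop_nhds_zero_nat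
  have hcos : ∀ x, HasDerivAt (fun x => Real.cos (c * x + θ)) (-(c * Real.sin (c * x + θ))) x :=
    fun x => ((((hasDerivAt_id' x).const_mul c).add_const θ).cos).congr_deriv (by ring)
  have hsin : ∀ x, HasDerivAt (fun x => -(c * Real.sin (c * x + θ)))
      (-(c ^ 2 * Real.cos (c * x + θ))) x :=
    fun x => (((((hasDerivAt_id' x).const_mul c).add_const θ).sin).const_mul c).neg.congr_deriv
      (by ring)
  have hsc : ∀ {η : ℝ → ℝ}, ContDiff ℝ ∞ η → ∀ n x,
      HasDerivAt (fun x => η (ε n * x)) (ε n * deriv η (ε n * x)) x := fun hη n x => by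
    have := (hη.differentiable (by simp) (ε n * x)).hasDerivAt.comp x
      ((hasDerivAt_id' x).const_mul (ε n))
    exact this.congr_deriv (by ring)
  -- The cut-off is dilated, so every derivative falling on it gains a factor `ε n` and only the
  -- derivatives of the wave survive in the limit.
  set g : ℕ → ℝ → ℝ := fun n x => χ (ε n * x) * Real.cos (c * x + θ) with hg
  have hd1 : ∀ n, deriv (g n) = fun x => ε n * deriv χ (ε n * x) * Real.cos (c * x + θ) +
      χ (ε n * x) * -(c * Real.sin (c * x + θ)) := fun n => funext fun x =>
    ((hsc h0 n x).mul (hcos x)).deriv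
  have hd2 : ∀ n x, deriv (deriv (g n)) x =
      ε n * (ε n * deriv (deriv χ) (ε n * x)) * Real.cos (c * x + θ) +
      ε n * deriv χ (ε n * x) * -(c * Real.sin (c * x + θ)) +
      (ε n * deriv χ (ε n * x) * -(c * Real.sin (c * x + θ)) +
      χ (ε n * x) * -(c ^ 2 * Real.cos (c * x + θ))) := fun n x => by
    rw [hd1]
    exact ((((hsc h1 n x).const_mul (ε n)).mul (hcos x)).add
      ((hsc h0 n x).mul (hsin x))).deriv
  have hcb : ∀ x, |Real.cos (c * x + θ)| ≤ 1 := fun x => Real.abs_cos_le_one _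
  have hsb : ∀ x, |-(c * Real.sin (c * x + θ))| ≤ |c| := fun x => by
    rw [abs_neg, abs_mul]
    exact mul_le_of_le_one_right (abs_nonneg c) (Real.abs_sin_le_one _)
  have hlim : ∀ {η : ℝ → ℝ}, ContDiff ℝ ∞ η → ∀ x,
      Tendsto (fun n => η (ε n * x)) atTop (𝓝 (η 0)) := fun hη x => by
    have h3 : Tendsto (fun n => ε n * x) atTop (𝓝 0) := by simpa using hε0.mul_const x
    exact (hη.continuous.tendsto 0).comp h3
  have hχ0 : χ 0 = 1 := B.one_of_mem_closedBall (by simp [B])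
  refine ⟨g, C0 + (C2 + C1 * |c| + (C1 * |c| + C0 * c ^ 2)), fun n => ?_, fun n => ?_, fun n x => ?_,
    fun n x => ?_, fun x => ?_, fun x => ?_⟩
  · exact (h0.comp (contDiff_const.mul contDiff_id)).mul
      (Real.contDiff_cos.comp ((contDiff_const.mul contDiff_id).add contDiff_const))
  · refine HasCompactSupport.mul_right ?_
    exact hc.comp_homeomorph (Homeomorph.mulLeft₀ (ε n) (hεpos n).ne')
  · have h3 : |g n x| ≤ C0 * 1 := by
      rw [hg]
      simp only
      rw [abs_mul]
      exact mul_le_mul (hC0 _) (hcb x) (abs_nonneg _) hC0'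
    have : 0 ≤ C2 + C1 * |c| + (C1 * |c| + C0 * c ^ 2) := by positivity
    linarith
  · have e1 : |ε n * (ε n * deriv (deriv χ) (ε n * x)) * Real.cos (c * x + θ)| ≤ C2 := by
      rw [abs_mul, abs_mul, abs_mul, abs_of_pos (hεpos n)]
      calc _ ≤ 1 * (1 * C2) * 1 := by
            gcongr
            · exact hε1 n
            · exact hε1 n
            · exact hC2 _
            · exact hcb x
        _ = C2 := by ring
    have e2 : |ε n * deriv χ (ε n * x) * -(c * Real.sin (c * x + θ))| ≤ C1 * |c| := by
      rw [abs_mul, abs_mul, abs_of_pos (hεpos n)]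
      refine mul_le_mul ?_ (hsb x) (abs_nonneg _) hC1'
      exact (mul_le_mul (hε1 n) (hC1 _) (abs_nonneg _) zero_le_one).trans (one_mul C1).le
    have e3 : |χ (ε n * x) * -(c ^ 2 * Real.cos (c * x + θ))| ≤ C0 * c ^ 2 := by
      rw [abs_mul, abs_neg, abs_mul, abs_of_nonneg (sq_nonneg c)]
      calc _ ≤ C0 * (c ^ 2 * 1) := by
            gcongr
            · exact hC0 _
            · exact hcb x
        _ = C0 * c ^ 2 := by ring
    rw [hd2]
    refine (abs_add_le _ _).trans ?_
    have := (abs_add_le _ _).trans (add_le_add e1 e2)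
    have := (abs_add_le _ _).trans (add_le_add e2 e3)
    linarith
  · have h3 := (hlim h0 x).mul_const (Real.cos (c * x + θ))
    rwa [hχ0, one_mul] at h3
  · have k0 := hlim h0 x
    have k1 := hlim h1 x
    have k2 := hlim h2 x
    have h3 := (((hε0.mul (hε0.mul k2)).mul_const (Real.cos (c * x + θ))).add
      ((hε0.mul k1).mul_const (-(c * Real.sin (c * x + θ))))).add
      (((hε0.mul k1).mul_const (-(c * Real.sin (c * x + θ)))).add
      (k0.mul_const (-(c ^ 2 * Real.cos (c * x + θ)))))
    simp only [hχ0, zero_mul, zero_add, one_mul] at h3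
    exact h3.congr fun n => (hd2 n x).symm

end

end NonlocalDiffusion

/-! ### Uniqueness of fundamental solutions -/

namespace NonlocalDiffusion

noncomputable section

namespace IsFundamentalSolution

variable {δ : ℝ} {ρ : ℝ → ℝ} {u : ℝ → ℝ → ℝ} (hu : IsFundamentalSolution δ ρ u)

include hu

lemma continuous_slice {t : ℝ} (ht : 0 < t) : Continuous fun x => u x t := by
  refine hu.continuousOn.comp_continuous (by fun_prop : Continuous fun x : ℝ => (x, t)) fun x => ?_
  exact ht

lemma measurable_indicator :
    Measurable ({p : ℝ × ℝ | 0 < p.2}.indicator fun p : ℝ × ℝ => u p.1 p.2) := by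
  classical
  rw [← piecewise_eq_indicator]
  exact hu.continuousOn.measurable_piecewise continuousOn_const
    (measurableSet_lt measurable_const measurable_snd)

lemma measurable_spatialIntegral {g : ℝ → ℝ} (hg : Measurable g) :
    Measurable (spatialIntegral u g) := by
  have h1 : Measurable fun p : ℝ × ℝ => g p.2 *
      {p : ℝ × ℝ | 0 < p.2}.indicator (fun p : ℝ × ℝ => u p.1 p.2) (p.2, p.1) :=
    (hg.comp measurable_snd).mul (hu.measurable_indicator.comp measurable_swap)
  have h2 := (h1.stronglyMeasurable.integral_prod_right' (ν := volume)).measurable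
  have e : spatialIntegral u g = fun t => if 0 < t then ∫ x, g x *
      {p : ℝ × ℝ | 0 < p.2}.indicator (fun p : ℝ × ℝ => u p.1 p.2) (x, t)
      else ∫ x, g x ∂(Measure.dirac (0 : ℝ)) := by
    funext t
    unfold spatialIntegral
    split_ifs with ht
    · simp [ht]
    · rfl
  rw [e]
  exact Measurable.ite measurableSet_Ioi h2 measurable_const

omit hu in
lemma _root_.NonlocalDiffusion.spatialIntegral_of_nonpos (u : ℝ → ℝ → ℝ) (g : ℝ → ℝ) {t : ℝ}
    (ht : t ≤ 0) : spatialIntegral u g t = g 0 := by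
  rw [spatialIntegral, if_neg ht.not_gt, integral_dirac]

lemma exists_bound (T : ℝ) : ∃ C, 0 ≤ C ∧ ∀ (g : ℝ → ℝ) (M : ℝ), (∀ x, |g x| ≤ M) →
    ∀ t ≤ T, |spatialIntegral u g t| ≤ M * C := by
  obtain ⟨C, hC⟩ := hu.locally_bounded (max T 1) (by positivity)
  refine ⟨max C 1, by positivity, fun g M hg t ht => ?_⟩
  have hM := (abs_nonneg _).trans (hg 0)
  rcases le_or_gt t 0 with h0 | h0
  · rw [spatialIntegral_of_nonpos _ _ h0]
    exact (hg 0).trans (le_mul_of_one_le_right hM (le_max_right _ _))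
  · rw [spatialIntegral, if_pos h0]
    refine (norm_integral_le_of_norm_le (f := fun x => g x * u x t) ((hu.integrable t h0).norm.const_mul M)
      (ae_of_all _ fun x => ?_)).trans ?_
    · rw [norm_mul]
      exact mul_le_mul_of_nonneg_right (hg x) (norm_nonneg _)
    · rw [integral_const_mul]
      exact mul_le_mul_of_nonneg_left
        ((hC t ⟨h0, ht.trans (le_max_left _ _)⟩).trans (le_max_left _ _)) hM

lemma tendsto_spatialIntegral {g : ℕ → ℝ → ℝ} {b : ℝ → ℝ} {M : ℝ} (hg : ∀ n, Measurable (g n))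
    (hM : ∀ n x, |g n x| ≤ M) (hb : ∀ x, Tendsto (fun n => g n x) atTop (𝓝 (b x))) (t : ℝ) :
    Tendsto (fun n => spatialIntegral u (g n) t) atTop (𝓝 (spatialIntegral u b t)) := by
  rcases le_or_gt t 0 with h0 | h0
  · simp_rw [spatialIntegral_of_nonpos _ _ h0]
    exact hb 0
  · simp only [spatialIntegral, if_pos h0]
    refine tendsto_integral_of_dominated_convergence (fun x => M * ‖u x t‖) (fun n => ?_)
      ((hu.integrable t h0).norm.const_mul M) (fun n => ae_of_all _ fun x => ?_)
      (ae_of_all _ fun x => (hb x).mul_const _)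
    · exact (hg n).aestronglyMeasurable.mul (hu.integrable t h0).aestronglyMeasurable
    · rw [norm_mul]
      exact mul_le_mul_of_nonneg_right (hM n x) (norm_nonneg _)

omit hu in
lemma _root_.NonlocalDiffusion.spatialIntegral_neg_const_mul (u : ℝ → ℝ → ℝ) (c : ℝ) (g : ℝ → ℝ)
    (t : ℝ) : spatialIntegral u (fun x => -(c * g x)) t = -(c * spatialIntegral u g t) := by
  unfold spatialIntegral
  split_ifs <;> simp only [neg_mul, mul_assoc, integral_neg, integral_const_mul]

lemma pairing_of_test {g Ψ : ℝ → ℝ} (hg : ContDiff ℝ ∞ g)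
    (hgc : HasCompactSupport g) (hΨ : ContDiff ℝ ∞ Ψ) (hΨc : HasCompactSupport Ψ)
    (hΨt : tsupport Ψ ⊆ Ioi 0) :
    ∫ t in Ioi (-δ), (spatialIntegral u g t * adjointNonlocal δ ρ Ψ t -
      spatialIntegral u (deriv (deriv g)) t * Ψ t) = 0 := by
  have hΨ0 : ∀ t ≤ 0, Ψ t = 0 := fun t ht =>
    image_eq_zero_of_notMem_tsupport fun h' => ht.not_gt (hΨt h')
  have hsub : tsupport (fun p : ℝ × ℝ => g p.1 * Ψ p.2) ⊆ tsupport g ×ˢ tsupport Ψ := by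
    refine closure_minimal (fun p hp => ?_) ((isClosed_tsupport g).prod (isClosed_tsupport Ψ))
    rw [Function.mem_support] at hp
    exact ⟨subset_tsupport g (left_ne_zero_of_mul hp), subset_tsupport Ψ (right_ne_zero_of_mul hp)⟩
  have h1 := hu.weak_equation (fun p => g p.1 * Ψ p.2)
    ((hg.comp contDiff_fst).mul (hΨ.comp contDiff_snd))
    ((hgc.prod hΨc).of_isClosed_subset (isClosed_tsupport _) hsub)
    (hsub.trans fun p hp => hΨt hp.2)
  rw [← h1]
  refine setIntegral_congr_fun measurableSet_Ioi fun t _ => ?_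
  have hadj : ∀ x, adjointNonlocal δ ρ (fun r => g x * Ψ r) t =
      g x * adjointNonlocal δ ρ Ψ t := fun x => by
    rw [adjointNonlocal, adjointNonlocal, ← integral_const_mul]
    refine integral_congr_ae (ae_of_all _ fun s => ?_)
    simp only
    ring
  have hder : ∀ x, iteratedDeriv 2 (fun y => g y * Ψ t) x = deriv (deriv g) x * Ψ t := fun x => by
    rw [iteratedDeriv_succ, iteratedDeriv_one]
    simp
  simp only [hadj, hder]
  rcases le_or_gt t 0 with h0 | h0
  · rw [spatialIntegral_of_nonpos _ _ h0, spatialIntegral_of_nonpos _ _ h0,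
      spatialIntegral_of_nonpos _ _ h0]
  · simp only [spatialIntegral, if_pos h0]
    have hg2 : ContDiff ℝ ∞ (deriv (deriv g)) :=
      (contDiff_infty_iff_deriv.1 (contDiff_infty_iff_deriv.1 hg).2).2
    obtain ⟨C, hC⟩ := hgc.exists_bound_of_continuous hg.continuous
    obtain ⟨C2, hC2⟩ := hgc.deriv.deriv.exists_bound_of_continuous hg2.continuous
    have i1 := (hu.integrable t h0).bdd_mul (c := C) hg.continuous.aestronglyMeasurable
      (ae_of_all _ hC)
    have i2 := (hu.integrable t h0).bdd_mul (c := C2) hg2.continuous.aestronglyMeasurable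
      (ae_of_all _ hC2)
    rw [← integral_mul_const, ← integral_mul_const, ← integral_sub (i1.mul_const _) (i2.mul_const _)]
    refine integral_congr_ae (ae_of_all _ fun x => ?_)
    simp only
    ring

/-- Separated test functions give the equation for compactly supported profiles. The locally uniform
`L¹` bound allows passage to plane waves by dominated convergence, and a wave is an eigenfunction of
the second derivative. -/
lemma pairing_cos (h : IsKernel δ ρ) (c θ : ℝ) {Ψ : ℝ → ℝ} (hΨ : ContDiff ℝ ∞ Ψ)
    (hΨc : HasCompactSupport Ψ) (hΨt : tsupport Ψ ⊆ Ioi 0) :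
    (∫ t, spatialIntegral u (fun x => Real.cos (c * x + θ)) t * adjointNonlocal δ ρ Ψ t) +
      c ^ 2 * ∫ t in Ioi 0, spatialIntegral u (fun x => Real.cos (c * x + θ)) t * Ψ t = 0 := by
  obtain ⟨a, T, ha, hs⟩ := exists_tsupport_subset_Icc hΨc hΨt
  have hδ := h.delta_pos
  have hΨ1 : ContDiff ℝ 1 Ψ := hΨ.of_le (by norm_cast)
  have hΨ0 : ∀ t, t ∉ Icc a T → Ψ t = 0 := fun t ht =>
    image_eq_zero_of_notMem_tsupport fun h' => ht (hs h')
  have hG0 : ∀ t, t ∉ Icc (a - δ) T → adjointNonlocal δ ρ Ψ t = 0 := fun t ht =>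
    adjointNonlocal_eq_zero_of_le h hs ht
  have hGi := integrable_adjointNonlocal h hΨ1 hs
  have hΨi : Integrable Ψ := hΨ.continuous.integrable_of_hasCompactSupport hΨc
  obtain ⟨g, M, hg, hgc, hM, hM2, hlim, hlim2⟩ := exists_tendsto_cos c θ
  obtain ⟨C, hC0, hC⟩ := hu.exists_bound T
  have hbm : Measurable fun x => Real.cos (c * x + θ) :=
    (by fun_prop : Continuous fun x => Real.cos (c * x + θ)).measurable
  have hmg : ∀ n, Measurable (g n) := fun n => (hg n).continuous.measurable
  have hmg2 : ∀ n, Measurable (deriv (deriv (g n))) := fun n => measurable_deriv _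
  have hbd : ∀ (k w : ℝ → ℝ) (N : ℝ), (∀ x, |k x| ≤ N) → (∀ t, T < t → w t = 0) → ∀ t,
      ‖spatialIntegral u k t * w t‖ ≤ N * C * ‖w t‖ := fun k w N hk hw t => by
    rcases le_or_gt t T with ht | ht
    · rw [norm_mul]
      exact mul_le_mul_of_nonneg_right (hC k N hk t ht) (norm_nonneg _)
    · simp [hw t ht]
  have hGT : ∀ t, T < t → adjointNonlocal δ ρ Ψ t = 0 := fun t ht => hG0 t fun h' => ht.not_ge h'.2
  have hΨT : ∀ t, T < t → Ψ t = 0 := fun t ht => hΨ0 t fun h' => ht.not_ge h'.2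
  have hb2 : ∀ t, spatialIntegral u (fun x => -(c ^ 2 * Real.cos (c * x + θ))) t =
      -(c ^ 2 * spatialIntegral u (fun x => Real.cos (c * x + θ)) t) :=
    spatialIntegral_neg_const_mul u _ _
  have hconv : Tendsto (fun n => ∫ t in Ioi (-δ), (spatialIntegral u (g n) t *
      adjointNonlocal δ ρ Ψ t - spatialIntegral u (deriv (deriv (g n))) t * Ψ t)) atTop
      (𝓝 (∫ t in Ioi (-δ), (spatialIntegral u (fun x => Real.cos (c * x + θ)) t *
        adjointNonlocal δ ρ Ψ t -
        spatialIntegral u (fun x => -(c ^ 2 * Real.cos (c * x + θ))) t * Ψ t))) := by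
    refine tendsto_integral_of_dominated_convergence
      (fun t => M * C * ‖adjointNonlocal δ ρ Ψ t‖ + M * C * ‖Ψ t‖) (fun n => ?_)
      ((hGi.norm.const_mul _).add (hΨi.norm.const_mul _)).integrableOn
      (fun n => ae_of_all _ fun t => ?_) (ae_of_all _ fun t => ?_)
    · exact (((hu.measurable_spatialIntegral (hmg n)).aestronglyMeasurable.mul
        hGi.aestronglyMeasurable.restrict).sub
        ((hu.measurable_spatialIntegral (hmg2 n)).aestronglyMeasurable.mul
        hΨi.aestronglyMeasurable.restrict))
    · exact (norm_sub_le _ _).trans (add_le_add (hbd _ _ M (hM n) hGT t) (hbd _ _ M (hM2 n) hΨT t))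
    · exact ((hu.tendsto_spatialIntegral hmg hM hlim t).mul_const _).sub
        ((hu.tendsto_spatialIntegral hmg2 hM2 hlim2 t).mul_const _)
  have hz := tendsto_nhds_unique hconv (tendsto_const_nhds.congr fun n =>
    (hu.pairing_of_test (hg n) (hgc n) hΨ hΨc hΨt).symm)
  have hvm := hu.measurable_spatialIntegral hbm
  have i1 : Integrable fun t => spatialIntegral u (fun x => Real.cos (c * x + θ)) t *
      adjointNonlocal δ ρ Ψ t :=
    (hGi.norm.const_mul (1 * C)).mono' (hvm.aestronglyMeasurable.mul hGi.aestronglyMeasurable)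
      (ae_of_all _ (hbd _ _ 1 (fun x => Real.abs_cos_le_one _) hGT))
  have i2 : Integrable fun t => spatialIntegral u (fun x => Real.cos (c * x + θ)) t * Ψ t :=
    (hΨi.norm.const_mul (1 * C)).mono' (hvm.aestronglyMeasurable.mul hΨi.aestronglyMeasurable)
      (ae_of_all _ (hbd _ _ 1 (fun x => Real.abs_cos_le_one _) hΨT))
  simp_rw [hb2, neg_mul, sub_neg_eq_add, mul_assoc] at hz
  rw [setIntegral_eq_integral_of_forall_compl_eq_zero, integral_add i1 (i2.const_mul _),
    integral_const_mul] at hz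
  · rw [setIntegral_eq_integral_of_forall_compl_eq_zero (s := Ioi (0 : ℝ)), hz]
    intro t ht
    simp only [mem_Ioi, not_lt] at ht
    rw [hΨ0 t fun h' => by linarith [h'.1], mul_zero]
  · intro t ht
    simp only [mem_Ioi, not_lt] at ht
    rw [hΨ0 t fun h' => by linarith [h'.1], hG0 t fun h' => by linarith [h'.1]]
    simp

lemma ae_eq_relaxation (h : IsKernel δ ρ) (c θ : ℝ) :
    ∀ᵐ t, spatialIntegral u (fun x => Real.cos (c * x + θ)) t =
      Real.cos θ * relaxation ρ (c ^ 2) t := by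
  refine ae_eq_relaxation_of_pairing h (sq_nonneg c) (hu.measurable_spatialIntegral
    (by fun_prop : Continuous fun x => Real.cos (c * x + θ)).measurable) (fun T => ?_)
    (fun t ht => ?_) fun Ψ hΨ hΨc hΨt => hu.pairing_cos h c θ hΨ hΨc hΨt
  · obtain ⟨C, -, hC⟩ := hu.exists_bound T
    exact ⟨1 * C, hC _ 1 fun x => Real.abs_cos_le_one _⟩
  · rw [spatialIntegral_of_nonpos _ _ ht]
    simp

lemma continuous_cos_integral {t : ℝ} (ht : 0 < t) (θ : ℝ) :
    Continuous fun ξ => ∫ x, Real.cos (2 * Real.pi * ξ * x + θ) * u x t := by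
  refine continuous_of_dominated (bound := fun x => ‖u x t‖) (fun ξ => ?_)
    (fun ξ => ae_of_all _ fun x => ?_) (hu.integrable t ht).norm (ae_of_all _ fun x => by fun_prop)
  · exact (integrable_cos_mul (hu.integrable t ht) _ θ).aestronglyMeasurable
  · rw [norm_mul]
    exact mul_le_of_le_one_left (norm_nonneg _) (Real.abs_cos_le_one _)

/-- The exceptional null set of times depends on the frequency, so rational frequencies are treated
first; both sides are continuous in `ξ`, which extends the identity to all of them at once. -/
lemma ae_forall_cos_integral (h : IsKernel δ ρ) (θ : ℝ) : ∀ᵐ t, 0 < t → ∀ ξ,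
    ∫ x, Real.cos (2 * Real.pi * ξ * x + θ) * u x t =
      Real.cos θ * relaxation ρ (symb ξ) t := by
  have h1 : ∀ᵐ t, ∀ q : ℚ, spatialIntegral u (fun x => Real.cos (2 * Real.pi * q * x + θ)) t =
      Real.cos θ * relaxation ρ (symb q) t :=
    ae_all_iff.2 fun q => hu.ae_eq_relaxation h (2 * Real.pi * q) θ
  filter_upwards [h1] with t ht h0
  refine congrFun (Continuous.ext_on Rat.denseRange_cast (hu.continuous_cos_integral h0 θ)
    ((continuous_relaxation_symb h t).const_mul _) ?_)
  rintro _ ⟨q, rfl⟩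
  have := ht q
  rwa [spatialIntegral, if_pos h0] at this

/-- No evenness of `u` is assumed. The phases `0` and `-π/2` give the cosine and sine transforms;
the latter vanishes because the sine wave is zero at the Dirac point, and Fourier inversion
identifies `u`. -/
lemma ae_eq_kern (h : IsKernel δ ρ) : ∀ᵐ t, 0 < t → ∀ x, u x t = kern ρ x t := by
  filter_upwards [hu.ae_forall_cos_integral h 0,
    hu.ae_forall_cos_integral h (-(Real.pi / 2))] with t hc hs h0 x
  refine eq_of_cosine_transform (F := fun x => u x t) (f := fun ξ => relaxation ρ (symb ξ) t)
    (hu.integrable t h0) (hu.continuous_slice h0)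
    (integrable_relaxation_symb h h0) (fun ξ => ?_) (fun ξ => ?_) x
  · have h2 := hc h0 ξ
    simp only [add_zero, Real.cos_zero, one_mul] at h2
    exact h2
  · have h2 := hs h0 ξ
    simp only [← sub_eq_add_neg, Real.cos_sub_pi_div_two, Real.cos_neg, Real.cos_pi_div_two,
      zero_mul] at h2
    exact h2

/-- Fundamental solutions are unique. -/
lemma eq_kern (h : IsKernel δ ρ) {t : ℝ} (ht : 0 < t) (x : ℝ) : u x t = kern ρ x t := by
  have h2 : ContinuousOn (fun r : ℝ => (x, r)) (Ioi 0) :=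
    (by fun_prop : Continuous fun r : ℝ => (x, r)).continuousOn
  have hmaps : MapsTo (fun r : ℝ => (x, r)) (Ioi 0) {p : ℝ × ℝ | 0 < p.2} := fun r hr => hr
  have h3 : ContinuousOn (fun r => u x r) (Ioi 0) :=
    ContinuousOn.comp (g := fun p : ℝ × ℝ => u p.1 p.2) hu.continuousOn h2 hmaps
  have h4 : ContinuousOn (fun r => kern ρ x r) (Ioi 0) := by
    have := ContinuousOn.comp (continuousOn_kern h) h2 hmaps
    simpa only [Function.comp_def] using this
  have h5 : (fun r => u x r) =ᵐ[volume.restrict (Ioi 0)] fun r => kern ρ x r :=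
    (ae_restrict_iff' measurableSet_Ioi).2 ((hu.ae_eq_kern h).mono fun t h' h0 => h' h0 x)
  have h6 : EqOn (fun r => u x r) (fun r => kern ρ x r) (Ioi 0) :=
    Measure.eqOn_open_of_ae_eq (μ := volume) h5 isOpen_Ioi h3 h4
  exact h6 (mem_Ioi.2 ht)

end IsFundamentalSolution

end

end NonlocalDiffusion

/-! ### Independence of the chosen version of the density, and conclusion -/

namespace NonlocalDiffusion

noncomputable section

section

variable {δ : ℝ} {ρ ρ' : ℝ → ℝ}

/-- A density kernel is only almost everywhere measurable on the window and arbitrary outside it.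
All notions involved depend on its class modulo null sets on the window, so a measurable nonnegative
version vanishing elsewhere may replace it. -/
lemma IsDensityKernel.exists_isKernel (hδ : 0 < δ) (hρ : IsDensityKernel δ ρ) :
    ∃ ρ' : ℝ → ℝ, IsKernel δ ρ' ∧ ∀ᵐ s, s ∈ Ioo 0 δ → ρ s = ρ' s := by
  have hm := hρ.integrableOn.aestronglyMeasurable
  set g := hm.mk ρ with hg
  have hgm : Measurable g := hm.stronglyMeasurable_mk.measurable
  have hae : ∀ᵐ s, s ∈ Ioo 0 δ → ρ s = (Ioo 0 δ).indicator (fun s => max (g s) 0) s := by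
    filter_upwards [(ae_restrict_iff' measurableSet_Ioo).1 hm.ae_eq_mk] with s hs hs'
    have e : ρ s = g s := hs hs'
    rw [indicator_of_mem hs', ← e, max_eq_left (hρ.nonneg s hs')]
  have hae' : ρ =ᵐ[volume.restrict (Ioo 0 δ)] (Ioo 0 δ).indicator (fun s => max (g s) 0) :=
    (ae_restrict_iff' measurableSet_Ioo).2 hae
  have h0 : ∀ s, s ∉ Ioo 0 δ → (Ioo 0 δ).indicator (fun s => max (g s) 0) s = 0 := fun s hs =>
    indicator_of_notMem hs _
  refine ⟨(Ioo 0 δ).indicator fun s => max (g s) 0, ⟨hδ,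
    (hgm.max measurable_const).indicator measurableSet_Ioo,
    fun s => indicator_nonneg (fun _ _ => le_max_right _ _) s, h0, ?_, ?_⟩, hae⟩
  · refine (integrableOn_iff_integrable_of_support_subset fun s hs => ?_).1
      (hρ.integrableOn.congr hae')
    by_contra hs'
    exact hs (h0 s hs')
  · rw [← setIntegral_eq_integral_of_forall_compl_eq_zero h0, ← integral_congr_ae hae']
    exact hρ.integral_eq_one

lemma IsKernel.isDensityKernel (h : IsKernel δ ρ) : IsDensityKernel δ ρ where
  nonneg s _ := h.nonneg s
  integrableOn := h.integrable.integrableOn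
  integral_eq_one := by
    rw [setIntegral_eq_integral_of_forall_compl_eq_zero h.eq_zero]
    exact h.integral_eq_one

lemma adjointNonlocal_congr (he : ∀ᵐ s, s ∈ Ioo 0 δ → ρ s = ρ' s) (ψ : ℝ → ℝ) (t : ℝ) :
    adjointNonlocal δ ρ ψ t = adjointNonlocal δ ρ' ψ t :=
  setIntegral_congr_ae measurableSet_Ioo (he.mono fun s hs hs' => by rw [hs hs'])

lemma IsFundamentalSolution.congr {u : ℝ → ℝ → ℝ} (he : ∀ᵐ s, s ∈ Ioo 0 δ → ρ s = ρ' s)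
    (hu : IsFundamentalSolution δ ρ u) : IsFundamentalSolution δ ρ' u where
  continuousOn := hu.continuousOn
  integrable := hu.integrable
  locally_bounded := hu.locally_bounded
  weak_equation φ hφ hc ht := by
    simp_rw [← adjointNonlocal_congr he]
    exact hu.weak_equation φ hφ hc ht

lemma HasNonlocalDeriv.congr {v : ℝ → ℝ} {t L : ℝ} (he : ∀ᵐ s, s ∈ Ioo 0 δ → ρ s = ρ' s)
    (hv : HasNonlocalDeriv δ ρ v t L) : HasNonlocalDeriv δ ρ' v t L := by
  have h1 : ∀ ε > 0, ∀ᵐ s, s ∈ Ioo ε δ →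
      (v t - v (t - s)) / s * ρ s = (v t - v (t - s)) / s * ρ' s := fun ε hε =>
    he.mono fun s hs hs' => by rw [hs ⟨hε.trans hs'.1, hs'.2⟩]
  refine ⟨fun ε hε => (hv.1 ε hε).congr
    ((ae_restrict_iff' measurableSet_Ioo).2 (h1 ε hε.1)), hv.2.congr' ?_⟩
  filter_upwards [self_mem_nhdsWithin] with ε hε
  exact setIntegral_congr_ae measurableSet_Ioo (h1 ε hε)

variable {u : ℝ → ℝ → ℝ}

lemma meanSquareDisplacement_eq (h : IsKernel δ ρ) (hu : IsFundamentalSolution δ ρ u) :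
    meanSquareDisplacement u = fun t => 2 * halfMoment ρ t := by
  funext t
  rcases le_or_gt t 0 with ht | ht
  · rw [meanSquareDisplacement, spatialIntegral_of_nonpos _ _ ht, halfMoment_of_nonpos _ ht]
    simp
  · rw [meanSquareDisplacement, spatialIntegral, if_pos ht, halfMoment, if_pos ht,
      mul_div_cancel₀ _ two_ne_zero]
    simp_rw [hu.eq_kern h ht]

end

end

end NonlocalDiffusion

theorem mainTheorem1 (δ : ℝ) (hδ : 0 < δ) :
    (∀ ρ : ℝ → ℝ, NonlocalDiffusion.IsDensityKernel δ ρ →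
      (∃ u : ℝ → ℝ → ℝ, NonlocalDiffusion.IsFundamentalSolution δ ρ u) ∧
      ∀ u : ℝ → ℝ → ℝ, NonlocalDiffusion.IsFundamentalSolution δ ρ u →
        (∀ t : ℝ, 0 < t → MeasureTheory.Integrable (fun x : ℝ => x ^ 2 * u x t)) ∧
        (∀ t ∈ Set.Ioo (-δ) 0, NonlocalDiffusion.meanSquareDisplacement u t = 0) ∧
        (∀ t : ℝ, 0 < t →
          NonlocalDiffusion.HasNonlocalDeriv δ ρ
            (NonlocalDiffusion.meanSquareDisplacement u) t 2) ∧
        Asymptotics.IsEquivalent Filter.atTop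
          (NonlocalDiffusion.meanSquareDisplacement u) (fun t : ℝ => 2 * t)) ∧
    (∀ α ∈ Set.Ioo (0 : ℝ) 1,
      NonlocalDiffusion.IsDensityKernel δ (NonlocalDiffusion.fractionalKernel α δ) ∧
      ∀ u : ℝ → ℝ → ℝ,
        NonlocalDiffusion.IsFundamentalSolution δ (NonlocalDiffusion.fractionalKernel α δ) u →
        Asymptotics.IsEquivalent (𝓝[>] (0 : ℝ))
          (NonlocalDiffusion.meanSquareDisplacement u)
          (fun t : ℝ =>
            2 * Real.sin (α * Real.pi) * δ ^ (1 - α) / ((1 - α) * Real.pi) * t ^ α)) := by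
  refine ⟨fun ρ hρ => ?_, fun α hα => ?_⟩
  · obtain ⟨ρ', h, he⟩ := hρ.exists_isKernel hδ
    have he' : ∀ᵐ s, s ∈ Ioo 0 δ → ρ' s = ρ s := he.mono fun s hs hs' => (hs hs').symm
    refine ⟨⟨_, (NonlocalDiffusion.isFundamentalSolution_kern h).congr he'⟩, fun u hu => ?_⟩
    have hu' := hu.congr he
    rw [NonlocalDiffusion.meanSquareDisplacement_eq h hu']
    refine ⟨fun t ht => ?_, fun t ht => ?_, fun t ht => ?_, ?_⟩
    · simp_rw [hu'.eq_kern h ht]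
      exact NonlocalDiffusion.integrable_sq_mul_kern h ht
    · simp only [NonlocalDiffusion.halfMoment_of_nonpos ρ' ht.2.le, mul_zero]
    · exact (NonlocalDiffusion.hasNonlocalDeriv_halfMoment h ht).congr he'
    · exact NonlocalDiffusion.halfMoment_isEquivalent h
  · have h := NonlocalDiffusion.isKernel_fractionalKernel hα hδ
    refine ⟨h.isDensityKernel, fun u hu => ?_⟩
    rw [NonlocalDiffusion.meanSquareDisplacement_eq h hu]
    exact NonlocalDiffusion.halfMoment_fractional_isEquivalent hα hδ
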